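/- **Setting.** Let $\Gamma$ be a connected nonempty graph (possibly infinite, loops and multiple edges allowed) whose geometric edges $e$ carry a chosen orientation from $o(e)$ to $t(e)$. A graph of groups on $\Gamma$ consists of vertex groups $G_v$, edge groups $G_e$ and injective homomorphisms $o_e\colon G_e\to G_{o(e)}$, $t_e\colon G_e\to G_{t(e)}$. Its fundamental group with respect to a spanning tree $T$ is the group $G$ generated by all the $G_v$ and all the edges of $\Gamma$, subject to the relations of the $G_v$, $e\,t_e(c)\,e^{-1}=o_e(c)$ for every edge $e$ and every $c\in G_e$, and $e=1$ for $e\in T$. An element of $G$ is *hyperbolic* if it is not conjugate into the image of any vertex group. A subgroup $H\le K$ is *left relatively convex* if $K/H=\{kH\}$ has a total order $\prec$ invariant under left multiplication by $K$; given such an order, $\mathrm{sign}_H(k)$ is $1$, $0$ or $-1$ according as $kH\succ H$, $kH=H$ or $kH\prec H$. A function $\phi\colon G\to\mathbb R$ is a *homogeneous quasimorphism* if its defect $D(\phi)=\inf\{D : |\phi(x)+\phi(y)-\phi(xy)|\le D \text{ for all } x,y\in G\}$ is finite and $\phi(x^n)=n\,\phi(x)$ for all $x\in G$, $n\in\mathbb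 Z$. The stable commutator length $\mathrm{scl}_G(g)$ is $\lim_n \mathrm{cl}_G(g^{Nn})/(Nn)$ if $g^N\in[G,G]$ for some $N\ge1$ ($\mathrm{cl}_G$ being the least number of commutators with the given product), and $\infty$ otherwise. **Letter-quasimorphisms.** Let $F$ be the free group on $\mathtt a,\mathtt b$. An element of $F$ is *alternating* if the letters of its reduced word alternate between $\mathtt a^{\pm1}$ and $\mathtt b^{\pm1}$. A map $\Phi\colon G\to F$ is a *letter-quasimorphism* if $\Phi(x^{-1})=\Phi(x)^{-1}$ for all $x$, and for all $x,y$ either $\Phi(x)\Phi(y)=\Phi(xy)$ or some cyclic permutation of $(\Phi(x),\Phi(y),\Phi(xy)^{-1})$ equals $(c_1^{-1}\mathtt x c_2,\;c_2^{-1}\mathtt x c_3,\;c_3^{-1}\mathtt x^{-1}c_1)$, with all expressions reduced, for some alternating $c_1,c_2,c_3$ and a letter $\mathtt x$. * Let $G=A\star_C B$ with $A/C$ and $B/C$ ordered invariantly. The map $\Phi$ of this amalgam is trivial on $C$ and sends a product of elements taken alternately from $A\setminus C$ and $B\setminus C$ to the product of the corresponding letters $\mathtt a^{\mathrm{sign}_A(\cdot)}$,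 $\mathtt b^{\mathrm{sign}_B(\cdot)}$, where $\mathrm{sign}_A$, $\mathrm{sign}_B$ are the signs for the orders on $A/C$, $B/C$. * Let $G=\langle V,t \mid tat^{-1}=f(a),\ a\in A\rangle$ be an HNN extension, where $A,B\le V$ and $f\colon A\to B$ is an isomorphism, with $G/A$ ordered invariantly and $\mathrm{sign}_A$ the sign for this order. The map $\Phi$ of this HNN extension is trivial on $V$ and sends a reduced word $v_0t^{\epsilon_0}v_1\cdots t^{\epsilon_{n-1}}v_n$, $n\ge1$, to $$\mathtt a\,\mathtt b^{\epsilon_0}\mathtt a^{\mathrm{sign}_A(\tilde v_1)}\mathtt b^{\epsilon_1}\cdots \mathtt a^{\mathrm{sign}_A(\tilde v_{n-1})}\mathtt b^{\epsilon_{n-1}}\mathtt a^{-1},$$ where $\tilde v_i$ is $v_i$ multiplied on the left by $t^{-1}$ if $\epsilon_{i-1}=-1$ and on the right by $t$ if $\epsilon_i=1$. **Circle quasimorphisms.** Let $b=\mathtt x_0\cdots\mathtt x_{M-1}\in F$ be alternating of even length $M>0$, with indices read modulo $M$. For a letter $\mathtt y$ let $\bar\rho_b(\mathtt y)\colon\mathbb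 Z\to\mathbb Z$ send $i$ to $i+1$ if $\mathtt y=\mathtt x_i$, to $i-1$ if $\mathtt y=\mathtt x_{i-1}^{-1}$, and to $i$ otherwise. For a reduced word $w=\mathtt y_1\cdots\mathtt y_m$ put $\bar\rho_b(w)=\bar\rho_b(\mathtt y_1)\circ\cdots\circ\bar\rho_b(\mathtt y_m)$, and let $\overline{\mathrm{rot}}_b(w)=\lim_{n\to\infty}\bar\rho_b(w^n)(0)/n$. **Theorem.** Let $G$ be the fundamental group of a graph of groups such that, for every edge $e$, $o_e(G_e)$ is left relatively convex in $G_{o(e)}$ and $t_e(G_e)$ is left relatively convex in $G_{t(e)}$. Let $g\in G$ be hyperbolic. Then there is a homogeneous quasimorphism $\phi\colon G\to\mathbb R$ with $$\phi(g)\ge 1,\qquad D(\phi)\le 1,$$ and in particular $\mathrm{scl}_G(g)\ge\frac12$. Explicitly, $\phi$ can be chosen as follows. There is a splitting of $G$ as an amalgamated free product $A\star_C B$ or as an HNN extension of a subgroup $V$, in which the edge group ($C$, respectively $A\le V$) is a conjugate of the image in $G$ of an edge group $G_e$, together with invariant orders as above ($A/C$ and $B/C$, respectively $G/A$), such that the map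 $\Phi\colon G\to F$ of this splitting is a letter-quasimorphism; and there is an alternating $b\in F$ of even length $|b|>0$ such that all limits defining $\overline{\mathrm{rot}}_b$ exist and $\phi$ is the homogenization of $\frac1{|b|}\,\overline{\mathrm{rot}}_b\circ\Phi$: $$\phi(h)=\lim_{n\to\infty}\frac{\overline{\mathrm{rot}}_b(\Phi(h^n))}{n\,|b|}\qquad\text{for all } h\in G.$$ -/

import Mathlib

open Filter Topology
open scoped ENNReal

/-! ### Quasimorphisms and stable commutator length -/

/-- A quasimorphism: `|φ g + φ h - φ (gh)|` is bounded uniformly in `g, h`. -/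
def IsQuasimorphism {G : Type*} [Group G] (φ : G → ℝ) : Prop :=
  ∃ D : ℝ, ∀ g h : G, |φ g + φ h - φ (g * h)| ≤ D

/-- The defect: the infimum of all `D` with `|φ g + φ h - φ (gh)| ≤ D` for all `g, h`. -/
noncomputable def defect {G : Type*} [Group G] (φ : G → ℝ) : ℝ :=
  sInf {D : ℝ | ∀ g h : G, |φ g + φ h - φ (g * h)| ≤ D}

/-- A homogeneous quasimorphism: `φ (g ^ n) = n φ g` for all integers `n`. -/
def IsHomogeneousQuasimorphism {G : Type*} [Group G] (φ : G → ℝ) : Prop :=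
  IsQuasimorphism φ ∧ ∀ (g : G) (n : ℤ), φ (g ^ n) = n * φ g

/-- The commutator length of `g`: the least number of commutators with product `g`, and `⊤` if
`g` is not in the commutator subgroup. -/
noncomputable def commutatorLength {G : Type*} [Group G] (g : G) : ℕ∞ :=
  ⨅ (n : ℕ) (_ : ∃ l : List (G × G), l.length = n ∧ (l.map fun p => p.1 * p.2 * p.1⁻¹ * p.2⁻¹).prod = g), (n : ℕ∞)

/-- The stable commutator length. If `N ≥ 1` is least with `g ^ N` in the commutator subgroup,
`commutatorLength (g ^ n)` is finite exactly for the multiples `n` of `N`, and the lower limit is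
the limit along them, that is, the stable commutator length of `g ^ N` divided by `N`; if there is
no such `N`, it is `∞`. -/
noncomputable def scl {G : Type*} [Group G] (g : G) : ℝ≥0∞ :=
  liminf (fun n : ℕ => ((commutatorLength (g ^ n) : ℕ∞) : ℝ≥0∞) / (n : ℝ≥0∞)) atTop

/-! ### Left relatively convex subgroups -/

/-- `r` is a strict total order on the left cosets `G / H` that is invariant under `G`. -/
def IsInvariantCosetOrder {G : Type*} [Group G] (H : Subgroup G) (r : G ⧸ H → G ⧸ H → Prop) :
    Prop :=
  IsStrictTotalOrder (G ⧸ H) r ∧ ∀ (g : G) (x y : G ⧸ H), r x y → r (g • x) (g • y)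

/-- `H` is left relatively convex in `G`. -/
def IsLeftRelativelyConvex {G : Type*} [Group G] (H : Subgroup G) : Prop :=
  ∃ r : G ⧸ H → G ⧸ H → Prop, IsInvariantCosetOrder H r

open Classical in
/-- The sign of `g` for an order on `G / H`: it is `1` if `H ≺ gH`, `-1` if `gH ≺ H`,
and `0` if `gH = H`. -/
noncomputable def cosetSign {G : Type*} [Group G] {H : Subgroup G} (r : G ⧸ H → G ⧸ H → Prop)
    (g : G) : ℤ :=
  if r ((1 : G) : G ⧸ H) (g : G ⧸ H) then 1
  else if r (g : G ⧸ H) ((1 : G) : G ⧸ H) then -1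
  else 0

/-! ### Graphs of groups -/

set_option linter.checkUnivs false in
/-- A graph of groups. The underlying graph may be infinite and may have loops and multiple edges;
each of its geometric edges is listed once, with a preferred orientation from `src` to `tgt`. -/
structure GraphOfGroups.{u, v, w, x} (V : Type u) (E : Type v) where
  src : E → V
  tgt : E → V
  vGroup : V → Type w
  vGroupGroup : ∀ v, Group (vGroup v)
  eGroup : E → Type x
  eGroupGroup : ∀ e, Group (eGroup e)
  srcHom : ∀ e, eGroup e →* vGroup (src e)
  tgtHom : ∀ e, eGroup e →* vGroup (tgt e)
  srcHom_injective : ∀ e, Function.Injective (srcHom e)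
  tgtHom_injective : ∀ e, Function.Injective (tgtHom e)

attribute [instance] GraphOfGroups.vGroupGroup GraphOfGroups.eGroupGroup

namespace GraphOfGroups

variable {V E : Type*} (𝒢 : GraphOfGroups V E)

/-- The edges in `T`, together with all vertices, form a tree: no edge in `T` is a loop, no two
edges in `T` join the same two vertices, and the resulting simple graph on `V` is a tree.
In particular the underlying graph is connected and nonempty. -/
def IsSpanningTree (T : Set E) : Prop :=
  (∀ e ∈ T, 𝒢.src e ≠ 𝒢.tgt e) ∧
  Set.InjOn (fun e => s(𝒢.src e, 𝒢.tgt e)) T ∧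
  (SimpleGraph.fromEdgeSet ((fun e => s(𝒢.src e, 𝒢.tgt e)) '' T)).IsTree

/-- The free product of all vertex groups and of the free group on the edges. -/
abbrev BigFreeProduct : Type _ := Monoid.Coprod (Monoid.CoprodI 𝒢.vGroup) (FreeGroup E)

/-- The element of the free product given by an edge. -/
def edgeElt (e : E) : 𝒢.BigFreeProduct := Monoid.Coprod.inr (FreeGroup.of e)

/-- The inclusion of a vertex group into the free product. -/
def vertexIncl (v : V) : 𝒢.vGroup v →* 𝒢.BigFreeProduct :=
  Monoid.Coprod.inl.comp Monoid.CoprodI.of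

/-- The relators: `e tgt_e(c) e⁻¹ = src_e(c)` for each edge `e` and each `c` in its edge group,
and `e = 1` for each edge `e` of the spanning tree. -/
def relators (T : Set E) : Set 𝒢.BigFreeProduct :=
  {x | ∃ (e : E) (c : 𝒢.eGroup e), x = 𝒢.edgeElt e * 𝒢.vertexIncl (𝒢.tgt e) (𝒢.tgtHom e c) *
      (𝒢.edgeElt e)⁻¹ * (𝒢.vertexIncl (𝒢.src e) (𝒢.srcHom e c))⁻¹} ∪
  {x | ∃ e ∈ T, x = 𝒢.edgeElt e}

/-- The fundamental group of the graph of groups with respect to the spanning tree `T`. -/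
abbrev FundamentalGroup (T : Set E) : Type _ :=
  𝒢.BigFreeProduct ⧸ Subgroup.normalClosure (𝒢.relators T)

/-- The canonical homomorphism from a vertex group to the fundamental group. -/
def ofVertex (T : Set E) (v : V) : 𝒢.vGroup v →* 𝒢.FundamentalGroup T :=
  (QuotientGroup.mk' (Subgroup.normalClosure (𝒢.relators T))).comp (𝒢.vertexIncl v)

/-- The image of an edge group in the fundamental group. -/
def edgeSubgroup (T : Set E) (e : E) : Subgroup (𝒢.FundamentalGroup T) :=
  ((𝒢.ofVertex T (𝒢.tgt e)).comp (𝒢.tgtHom e)).range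

/-- An element is hyperbolic if it is not conjugate into any vertex group. -/
def IsHyperbolic (T : Set E) (g : 𝒢.FundamentalGroup T) : Prop :=
  ∀ (v : V) (x : 𝒢.vGroup v) (k : 𝒢.FundamentalGroup T), g ≠ k * 𝒢.ofVertex T v x * k⁻¹

end GraphOfGroups

/-! ### The free group on two letters, letter-quasimorphisms and circle quasimorphisms

The free group `F(a, b)` is `FreeGroup Bool`, with `a` the generator `false` and `b` the generator
`true`. A letter is a pair `(generator, sign)`, with sign `true` for the generator itself and
`false` for its inverse; `FreeGroup.toWord` is the list of letters of the reduced word. -/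

/-- A word is alternating if its letters alternate between `a, a⁻¹` and `b, b⁻¹`. -/
def IsAlternating (w : FreeGroup Bool) : Prop :=
  w.toWord.IsChain (fun x y => x.1 ≠ y.1)

/-- `u = c₁⁻¹ x c₂`, `v = c₂⁻¹ x c₃`, `w = c₃⁻¹ x⁻¹ c₁` as reduced expressions, for alternating
words `c₁, c₂, c₃` and a letter `x`. -/
def IsLetterTriple (u v w : FreeGroup Bool) : Prop :=
  ∃ c₁ c₂ c₃ : FreeGroup Bool, IsAlternating c₁ ∧ IsAlternating c₂ ∧ IsAlternating c₃ ∧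
    ∃ x : Bool × Bool,
      u.toWord = c₁⁻¹.toWord ++ x :: c₂.toWord ∧
      v.toWord = c₂⁻¹.toWord ++ x :: c₃.toWord ∧
      w.toWord = c₃⁻¹.toWord ++ (x.1, !x.2) :: c₁.toWord

/-- A letter-quasimorphism. -/
def IsLetterQuasimorphism {G : Type*} [Group G] (Φ : G → FreeGroup Bool) : Prop :=
  (∀ g, Φ g⁻¹ = (Φ g)⁻¹) ∧
  ∀ g h, Φ g * Φ h = Φ (g * h) ∨
    IsLetterTriple (Φ g) (Φ h) (Φ (g * h))⁻¹ ∨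
    IsLetterTriple (Φ h) (Φ (g * h))⁻¹ (Φ g) ∨
    IsLetterTriple (Φ (g * h))⁻¹ (Φ g) (Φ h)

/-- The letter with index `i`, taken modulo the length, of a list of letters. -/
def cyclicLetter (L : List (Bool × Bool)) (i : ℤ) : Option (Bool × Bool) :=
  L[(i % (L.length : ℤ)).toNat]?

/-- The action of a letter `y` on `ℤ` with base `x₀ ⋯ x_{M-1}`: `i` goes to `i + 1` if `y = x_i`,
to `i - 1` if `y = x_{i-1}⁻¹`, and stays fixed otherwise (indices modulo `M`). -/
def circleStep (L : List (Bool × Bool)) (y : Bool × Bool) (i : ℤ) : ℤ :=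
  if cyclicLetter L i = some y then i + 1
  else if cyclicLetter L (i - 1) = some (y.1, !y.2) then i - 1
  else i

/-- The map `ℤ → ℤ` of a reduced word `y₁ ⋯ y_m`: the composition of the maps of `y₁, …, y_m`,
that of `y_m` applied first. -/
def circleWordMap (b w : FreeGroup Bool) (i : ℤ) : ℤ :=
  w.toWord.foldr (circleStep b.toWord) i

/-- `rot` is the circle quasimorphism with base `b`: `rot w = lim (circleWordMap b (w ^ n) 0) / n`. -/
def IsCircleQuasimorphism (b : FreeGroup Bool) (rot : FreeGroup Bool → ℝ) : Prop :=
  ∀ w, Tendsto (fun n : ℕ => (circleWordMap b (w ^ n) 0 : ℝ) / n) atTop (𝓝 (rot w))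

/-! ### The letter-quasimorphisms of amalgams and HNN extensions -/

/-- `G` is the amalgamated free product of its subgroups `A = S false` and `B = S true` over the
subgroup `C` of both, and `Φ` is the map `G → F(a, b)` that this splitting and some invariant
orders on `A / C` and `B / C` define: it is trivial on `C`, and sends a product of elements taken
alternately from `A \ C` and `B \ C` to the product of the letters `a ^ sign_A` and `b ^ sign_B`. -/
def IsAmalgamLetterMap {G : Type*} [Group G] (C : Subgroup G) (Φ : G → FreeGroup Bool) : Prop :=
  ∃ (S : Bool → Subgroup G) (hC : ∀ i, C ≤ S i),
    Function.Bijective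
      (Monoid.PushoutI.lift (φ := fun i => Subgroup.inclusion (hC i))
        (fun i => (S i).subtype) C.subtype (fun _ => rfl)) ∧
    ∃ r : ∀ i, (S i ⧸ C.subgroupOf (S i)) → (S i ⧸ C.subgroupOf (S i)) → Prop,
      (∀ i, IsInvariantCosetOrder (C.subgroupOf (S i)) (r i)) ∧
      (∀ c ∈ C, Φ c = 1) ∧
      ∀ L : List (Σ i, S i), L.IsChain (fun p q => p.1 ≠ q.1) → (∀ p ∈ L, (p.2 : G) ∉ C) →
        Φ (L.map fun p => (p.2 : G)).prod =
          (L.map fun p => FreeGroup.of p.1 ^ cosetSign (r p.1) p.2).prod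

/-- For the letters `(ε₀, v₁), …, (ε_{n-1}, v_n)` of a word `v₀ t ^ ε₀ v₁ ⋯ t ^ ε_{n-1} v_n`, the word
`b ^ ε₀ a ^ s(v₁') b ^ ε₁ ⋯ a ^ s(v_{n-1}') b ^ ε_{n-1}`, where `v_i'` is `v_i`, multiplied on the left by
`t⁻¹` if `ε_{i-1} = -1` and on the right by `t` if `ε_i = 1`. -/
def hnnLetters {G : Type*} [Group G] (t : G) (s : G → ℤ) : List (ℤˣ × G) → FreeGroup Bool
  | [] => 1
  | [p] => FreeGroup.of true ^ (p.1 : ℤ)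
  | p :: q :: l =>
      FreeGroup.of true ^ (p.1 : ℤ) *
        FreeGroup.of false ^
          s ((if p.1 = -1 then t⁻¹ else 1) * p.2 * (if q.1 = 1 then t else 1)) *
        hnnLetters t s (q :: l)

/-- `G` is the HNN extension of a subgroup `V` with stable letter `t`, which conjugates the subgroup
`A` of `V` to a subgroup `B` of `V`, and `Φ` is the map `G → F(a, b)` that this splitting and some
invariant order on `G / A` define: it is trivial on `V`, and sends a reduced word
`v₀ t ^ ε₀ v₁ ⋯ t ^ ε_{n-1} v_n` with `n ≥ 1` to `a b ^ ε₀ a ^ sign_A(v₁') ⋯ b ^ ε_{n-1} a⁻¹`. -/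
def IsHNNLetterMap {G : Type*} [Group G] (A : Subgroup G) (Φ : G → FreeGroup Bool) : Prop :=
  ∃ (V : Subgroup G) (A₀ B₀ : Subgroup V) (f : A₀ ≃* B₀) (t : G)
    (ht : ∀ x : A₀, t * V.subtype x = V.subtype (f x : V) * t),
    A = A₀.map V.subtype ∧
    Function.Bijective (HNNExtension.lift (φ := f) V.subtype t ht) ∧
    ∃ r : G ⧸ A → G ⧸ A → Prop, IsInvariantCosetOrder A r ∧
      ∀ w : HNNExtension.NormalWord.ReducedWord V A₀ B₀,
        Φ (HNNExtension.lift (φ := f) V.subtype t ht (w.prod f)) =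
          if w.toList = [] then 1
          else FreeGroup.of false *
            hnnLetters t (cosetSign r) (w.toList.map fun p => (p.1, (p.2 : G))) *
            (FreeGroup.of false)⁻¹

/-!
The group `G` acts on its Bass–Serre tree. An oriented tree is encoded here by its vertices, its
edges and, instead of acyclicity, an integral potential for every edge that jumps across this edge
only (`OrientedTree`). For the Bass–Serre tree such potentials come from an affine action of `G` on
the integral functions on the edges, which the universal property of `G` provides
(`exists_treePotential`). Vertex groups embed in `G` because free actions of all vertex groups on one
large set can be matched along the edges (`ofVertex_injective`); hence stabilizers of vertices and
edges are what they should be, and invariant orders on cosets of edge groups in vertex groups become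
invariant total orders on the edges at each vertex of the tree.

Such local orders give signs to the turns of a path in the tree. For two distinct edges, the number
of positive minus the number of negative turns along the path from one to the other is odd, and by
comparing paths along a tripod it is additive up to an error of one. So its sign is an invariant
total order on all edges (`IsEquivariant.exists_edgeOrder`, `exists_treeEdgeOrder`).

A hyperbolic `g` fixes no vertex, so it has an axis (`exists_axis`). Fix an edge `q₀` on it and
collapse all edges outside the orbit of `q₀` (`collapse`). On the resulting tree, with the order on
its edges restricted from the old one, `g` still has an axis, and `G` is an amalgam or an HNN
extension over the stabilizer of `q₀`, a conjugate of an edge group: reduced words in the splitting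
are paths without backtracking (`bijective_pushout_lift`, `bijective_hnn_lift`). The orientation of
`q₀` has to be reversed in one case, which `flip` takes care of.

Recording, along a path, a letter for each turn, with the generator given by the kind of node and
the exponent by the sign of the turn, turns the path from a base node to its translate by `h` into an
alternating word `Φ h`. The three paths between the base node, its translate by `x` and its translate
by `x y` form a tripod, and at its centre two of the three turns have one sign and the third has the
other. So `Φ` is a letter-quasimorphism (`isLetterQuasimorphism_pathWord`), and reading off the path
of a reduced word shows that it is the map of the splitting (`isAmalgamLetterMap`,
`isHNNLetterMap`). Along the axis of `g` the letters are periodic, so `Φ (g ^ n)` is, up to its two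
ends, a power of an alternating word `w` of even length.

Let `b` be the word of the letters of `w` in reverse order and `M` its length. The combinatorial maps
of the circle quasimorphism of `b` follow an honest action of the free group on the line by order
isomorphisms that commute with the translation by `M` (`CircleAction.rep`). The number `f` of full
turns of the orbit of `1 / 2` satisfies `f (u v) - f u - f v ∈ {0, 1}`, and it does not change when a
letter of a reduced word is doubled, so that `f ∘ Φ` satisfies the same inequalities for every
letter-quasimorphism `Φ` (`CircleAction.turns_letterQuasimorphism`). The homogenization `φ` of a
function with this one-sided error has defect at most `1` (`exists_homogeneous_of_quasi`). Each
further period of `Φ (g ^ n)` moves the combinatorial position by one full turn, so `1 ≤ φ g`, and the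
bound on the stable commutator length is the easy half of Bavard duality (`half_le_scl`).
-/

/-! ### Homogenization of quasimorphisms with one-sided error -/

section Homogenization

variable {G : Type*} [Group G]

/-- Superadditivity along powers. -/
theorem nsmul_le_apply_pow {f : G → ℝ} (hlo : ∀ x y, f x + f y ≤ f (x * y)) (x : G) (n : ℕ)
    (hn : n ≠ 0) : n * f x ≤ f (x ^ n) := by
  induction n with
  | zero => exact absurd rfl hn
  | succ k ih =>
    rcases Nat.eq_zero_or_pos k with rfl | hk
    · simp
    · have := ih hk.ne'
      have h2 := hlo (x ^ k) x
      rw [pow_succ]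
      push_cast
      linarith

/-- If `f x + f y ≤ f (x y) ≤ f x + f y + 1`, then `f (x ^ n) / n` converges to a homogeneous
function at distance at most `1` from `f`. -/
theorem exists_homogenization {f : G → ℝ} (hlo : ∀ x y, f x + f y ≤ f (x * y))
    (hhi : ∀ x y, f (x * y) ≤ f x + f y + 1) :
    ∃ φ : G → ℝ, (∀ x, Tendsto (fun n : ℕ => f (x ^ n) / n) atTop (𝓝 (φ x))) ∧
      (∀ x, f x ≤ φ x) ∧ (∀ x, φ x ≤ f x + 1) := by
  have key : ∀ x, ∃ l, Tendsto (fun n : ℕ => f (x ^ n) / n) atTop (𝓝 l) ∧ f x ≤ l ∧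
      l ≤ f x + 1 := by
    intro x
    have hsub : Subadditive (fun n : ℕ => f (x ^ n) + 1) := by
      intro m n
      have := hhi (x ^ m) (x ^ n)
      simp only [pow_add]
      linarith
    have hge : ∀ n : ℕ, n ≠ 0 → f x ≤ (f (x ^ n) + 1) / n := by
      intro n hn
      have hn' : (0 : ℝ) < n := by positivity
      rw [le_div_iff₀ hn']
      have := nsmul_le_apply_pow hlo x n hn
      linarith
    have hbdd : BddBelow (Set.range fun n : ℕ => (f (x ^ n) + 1) / n) := by
      refine ⟨min (f x) 0, ?_⟩
      rintro _ ⟨n, rfl⟩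
      rcases eq_or_ne n 0 with rfl | hn
      · simp
      · exact (min_le_left _ _).trans (hge n hn)
    have hlim := hsub.tendsto_lim hbdd
    refine ⟨hsub.lim, ?_, ?_, ?_⟩
    · have h0 : Tendsto (fun n : ℕ => (1 : ℝ) / n) atTop (𝓝 0) :=
        tendsto_one_div_atTop_nhds_zero_nat
      have := hlim.sub h0
      simp only [sub_zero] at this
      refine this.congr fun n => ?_
      ring
    · refine ge_of_tendsto hlim ?_
      filter_upwards [eventually_ne_atTop 0] with n hn using hge n hn
    · have := hsub.lim_le_div hbdd one_ne_zero
      simpa using this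
  choose φ h1 h2 h3 using key
  exact ⟨φ, h1, h2, h3⟩

/-- If the multiples of `a` exceed those of `b` by at most a constant, then `a ≤ b`. -/
theorem le_of_forall_nat_mul_le {a b C : ℝ} (h : ∀ n : ℕ, n * a ≤ n * b + C) : a ≤ b := by
  by_contra hab
  push Not at hab
  obtain ⟨n, hn⟩ := exists_nat_gt (C / (a - b))
  rw [div_lt_iff₀ (by linarith)] at hn
  have := h n
  nlinarith

/-- The homogenization of a function with `f x + f y ≤ f (x y) ≤ f x + f y + 1` is a homogeneous
quasimorphism of defect at most `1`. For the defect, write `(x y) ^ n = x₁ ⋯ x_n y ^ n` with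
conjugates `x_i` of `x`, at each of which `f` differs from `φ x` by at most `1`. -/
theorem exists_homogeneous_of_quasi {f : G → ℝ} (hlo : ∀ x y, f x + f y ≤ f (x * y))
    (hhi : ∀ x y, f (x * y) ≤ f x + f y + 1) :
    ∃ φ : G → ℝ, (∀ x, Tendsto (fun n : ℕ => f (x ^ n) / n) atTop (𝓝 (φ x))) ∧
      (∀ x, f x ≤ φ x) ∧ (∀ x, φ x ≤ f x + 1) ∧
      (∀ (x : G) (n : ℤ), φ (x ^ n) = n * φ x) ∧ ∀ x y, |φ x + φ y - φ (x * y)| ≤ 1 := by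
  obtain ⟨φ, hlim, hge, hle⟩ := exists_homogenization hlo hhi
  have hpow : ∀ (x : G) (n : ℕ), φ (x ^ n) = n * φ x := by
    intro x n
    rcases eq_or_ne n 0 with rfl | hn
    · have h1 := hlim (1 : G)
      have h0 : Tendsto (fun n : ℕ => f 1 * ((1 : ℝ) / n)) atTop (𝓝 (f 1 * 0)) :=
        tendsto_one_div_atTop_nhds_zero_nat.const_mul _
      have : φ 1 = f 1 * 0 := by
        refine tendsto_nhds_unique h1 (h0.congr fun n => ?_)
        rw [one_pow]; ring
      simp [this]
    · have h1 := hlim (x ^ n)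
      have h2 : Tendsto (fun k : ℕ => (n : ℝ) * (f (x ^ (n * k)) / ((n * k : ℕ) : ℝ))) atTop
          (𝓝 (n * φ x)) := by
        refine Tendsto.const_mul _ ((hlim x).comp ?_)
        exact tendsto_id.const_mul_atTop' (Nat.pos_of_ne_zero hn)
      refine tendsto_nhds_unique h1 (h2.congr fun k => ?_)
      rw [pow_mul]
      push_cast
      have : (n : ℝ) ≠ 0 := by exact_mod_cast hn
      rcases eq_or_ne k 0 with rfl | hk
      · simp
      · have hk' : (k : ℝ) ≠ 0 := by exact_mod_cast hk
        field_simp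
  have hone : φ 1 = 0 := by simpa using hpow 1 0
  have hqlo : ∀ x y, φ x + φ y - 2 ≤ φ (x * y) := fun x y => by
    linarith [hlo x y, hge (x * y), hle x, hle y]
  have hqhi : ∀ x y, φ (x * y) ≤ φ x + φ y + 2 := fun x y => by
    linarith [hhi x y, hge x, hge y, hle (x * y)]
  have hinv : ∀ x, φ x⁻¹ = - φ x := by
    intro x
    have aux : ∀ n : ℕ, |(n : ℝ) * (φ x + φ x⁻¹)| ≤ 2 := by
      intro n
      have h1 := hqlo (x ^ n) (x⁻¹ ^ n)
      have h2 := hqhi (x ^ n) (x⁻¹ ^ n)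
      rw [inv_pow, mul_inv_cancel, ← inv_pow, hpow, hpow, hone] at h1 h2
      rw [abs_le]
      constructor <;> linarith
    have h1 : φ x + φ x⁻¹ ≤ 0 := le_of_forall_nat_mul_le (C := 2) fun n => by
      have := (abs_le.1 (aux n)).2; linarith
    have h2 : 0 ≤ φ x + φ x⁻¹ := le_of_forall_nat_mul_le (C := 2) fun n => by
      have := (abs_le.1 (aux n)).1; linarith
    linarith
  have hconj : ∀ k x, φ (k * x * k⁻¹) = φ x := by
    intro k x
    have aux : ∀ n : ℕ, |(n : ℝ) * φ (k * x * k⁻¹) - n * φ x| ≤ 4 := by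
      intro n
      have h0 : (k * x * k⁻¹) ^ n = k * x ^ n * k⁻¹ := conj_pow
      have h1 := hqlo (k * x ^ n) k⁻¹
      have h2 := hqhi (k * x ^ n) k⁻¹
      have h3 := hqlo k (x ^ n)
      have h4 := hqhi k (x ^ n)
      rw [← h0, hpow, hinv] at h1 h2
      rw [hpow] at h3 h4
      rw [abs_le]
      constructor <;> linarith
    apply le_antisymm
    · exact le_of_forall_nat_mul_le (C := 4) fun n => by
        have := (abs_le.1 (aux n)).2; linarith
    · exact le_of_forall_nat_mul_le (C := 4) fun n => by
        have := (abs_le.1 (aux n)).1; linarith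
  refine ⟨φ, hlim, hge, hle, ?_, ?_⟩
  · intro x n
    obtain ⟨m, rfl | rfl⟩ := n.eq_nat_or_neg
    · simp [hpow]
    · rw [zpow_neg, hinv, zpow_natCast, hpow]; push_cast; ring
  · intro x y
    -- `z n` is the product of the conjugates `y ^ i * x * y ^ (-i)`, `i < n`
    let z : ℕ → G := fun n => (x * y) ^ n * (y ^ n)⁻¹
    have hz : ∀ n, z (n + 1) = z n * (y ^ n * x * (y ^ n)⁻¹) := by
      intro n
      simp only [z, pow_succ, mul_inv_rev]
      group
    have hz1 : ∀ n : ℕ, f (z n) ≤ n * φ x + n + f 1 := by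
      intro n
      induction n with
      | zero => simp [z]
      | succ n ih =>
        have h1 := hhi (z n) (y ^ n * x * (y ^ n)⁻¹)
        have h2 := hge (y ^ n * x * (y ^ n)⁻¹)
        rw [hconj] at h2
        rw [hz]; push_cast; linarith
    have hz2 : ∀ n : ℕ, n * φ x - n + f 1 ≤ f (z n) := by
      intro n
      induction n with
      | zero => simp [z]
      | succ n ih =>
        have h1 := hlo (z n) (y ^ n * x * (y ^ n)⁻¹)
        have h2 := hle (y ^ n * x * (y ^ n)⁻¹)
        rw [hconj] at h2
        rw [hz]; push_cast; linarith
    have hzy : ∀ n, (x * y) ^ n = z n * y ^ n := fun n => by simp [z]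
    rw [abs_le]
    constructor
    · have : φ (x * y) ≤ φ x + φ y + 1 :=
        le_of_forall_nat_mul_le (C := 3 + f 1) fun n => by
          have h1 := hqhi (z n) (y ^ n)
          rw [← hzy, hpow, hpow] at h1
          have h2 := hle (z n)
          have := hz1 n
          linarith
      linarith
    · have : φ x + φ y - 1 ≤ φ (x * y) :=
        le_of_forall_nat_mul_le (C := 2 - f 1) fun n => by
          have h1 := hqlo (z n) (y ^ n)
          rw [← hzy, hpow, hpow] at h1
          have h2 := hge (z n)
          have := hz2 n
          linarith
      linarith

end Homogenization

/-! ### The easy half of Bavard duality -/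

section Bavard

variable {G : Type*} [Group G] {φ : G → ℝ}

theorem defect_le_one (h : ∀ x y, |φ x + φ y - φ (x * y)| ≤ 1) : defect φ ≤ 1 := by
  refine csInf_le ⟨0, ?_⟩ h
  intro D hD
  exact (abs_nonneg _).trans (hD 1 1)

theorem apply_prod_commutators_le (hhom : ∀ (x : G) (n : ℤ), φ (x ^ n) = n * φ x)
    (h : ∀ x y, |φ x + φ y - φ (x * y)| ≤ 1) (l : List (G × G)) :
    φ (l.map fun p => p.1 * p.2 * p.1⁻¹ * p.2⁻¹).prod ≤ 2 * l.length := by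
  have hone : φ 1 = 0 := by simpa using hhom 1 0
  have hinv : ∀ x, φ x⁻¹ = - φ x := fun x => by simpa using hhom x (-1)
  have hpow : ∀ x (n : ℕ), φ (x ^ n) = n * φ x := fun x n => by simpa using hhom x n
  have hconj : ∀ k x, φ (k * x * k⁻¹) ≤ φ x := by
    intro k x
    refine le_of_forall_nat_mul_le (C := 2) fun n => ?_
    rw [← hpow, conj_pow]
    have h1 := (abs_le.1 (h (k * x ^ n) k⁻¹)).1
    have h2 := (abs_le.1 (h k (x ^ n))).1
    rw [hinv] at h1
    rw [hpow] at h2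
    linarith
  induction l with
  | nil => simp [hone]
  | cons p l ih =>
    rw [List.map_cons, List.prod_cons, List.length_cons]
    have h1 := (abs_le.1 (h (p.1 * p.2 * p.1⁻¹ * p.2⁻¹)
      (l.map fun p => p.1 * p.2 * p.1⁻¹ * p.2⁻¹).prod)).1
    have h2 := (abs_le.1 (h (p.1 * p.2 * p.1⁻¹) p.2⁻¹)).1
    have h3 := hconj p.1 p.2
    rw [hinv] at h2
    push_cast
    linarith

/-- A homogeneous quasimorphism of defect at most `1` with `φ g ≥ 1` bounds `scl g` below by
`1 / 2`. -/
theorem half_le_scl (hhom : ∀ (x : G) (n : ℤ), φ (x ^ n) = n * φ x)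
    (h : ∀ x y, |φ x + φ y - φ (x * y)| ≤ 1) {g : G} (hg : 1 ≤ φ g) : 1 / 2 ≤ scl g := by
  refine le_liminf_of_le (by isBoundedDefault) ?_
  filter_upwards [eventually_ne_atTop 0] with n hn
  have hn0 : (n : ℝ≥0∞) ≠ 0 := by exact_mod_cast hn
  rw [ENNReal.le_div_iff_mul_le (Or.inl hn0) (Or.inl (ENNReal.natCast_ne_top n))]
  rcases eq_or_ne (commutatorLength (g ^ n)) ⊤ with htop | htop
  · rw [htop]; simp
  obtain ⟨m, hm⟩ := ENat.ne_top_iff_exists.1 htop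
  have hle : n ≤ 2 * m := by
    have : ((⌈(n : ℝ) / 2⌉₊ : ℕ) : ℕ∞) ≤ commutatorLength (g ^ n) := by
      refine le_iInf₂ fun k hk => ?_
      obtain ⟨l, hl, hprod⟩ := hk
      have h1 := apply_prod_commutators_le hhom h l
      rw [hprod, hl] at h1
      have h2 := hhom g n
      rw [zpow_natCast] at h2
      push_cast at h2
      have h3 : (n : ℝ) ≤ 2 * k := by
        have : (0 : ℝ) ≤ n := by positivity
        nlinarith
      exact_mod_cast Nat.ceil_le.2 (by linarith : (n : ℝ) / 2 ≤ k)
    rw [← hm] at this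
    have h4 : ⌈(n : ℝ) / 2⌉₊ ≤ m := by exact_mod_cast this
    have h5 := Nat.ceil_le.1 h4
    have : (n : ℝ) ≤ 2 * m := by linarith
    exact_mod_cast this
  rw [← hm]
  have : (n : ℝ≥0∞) ≤ 2 * m := by exact_mod_cast hle
  simp only [ENat.toENNReal_coe]
  calc (1 / 2 : ℝ≥0∞) * n ≤ 1 / 2 * (2 * m) := by gcongr
    _ = m := by
      rw [← mul_assoc, one_div, ENNReal.inv_mul_cancel (by norm_num) (by norm_num), one_mul]

end Bavard

/-! ### Circle quasimorphisms -/

namespace CircleAction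

/-- The homeomorphism of `[0, 2]` that pushes `[2/5, 2]` into `[8/5, 2]` (for `true`), and its
inverse, which pushes `[0, 8/5]` into `[0, 2/5]`. -/
noncomputable def push : Bool → ℝ → ℝ
  | true, s => min (4 * s) (2 - (2 - s) / 4)
  | false, s => max (s / 4) (2 - 4 * (2 - s))

theorem push_not_push (ε : Bool) (s : ℝ) : push (!ε) (push ε s) = s := by
  cases ε <;> simp only [push, Bool.not_true, Bool.not_false]
  · rcases le_total (s / 4) (2 - 4 * (2 - s)) with h | h
    · rw [max_eq_right h, min_eq_right] <;> linarith
    · rw [max_eq_left h, min_eq_left] <;> linarith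
  · rcases le_total (4 * s) (2 - (2 - s) / 4) with h | h
    · rw [min_eq_left h, max_eq_left] <;> linarith
    · rw [min_eq_right h, max_eq_right] <;> linarith

theorem push_strictMono (ε : Bool) : StrictMono (push ε) := by
  intro s t h
  cases ε <;> simp only [push]
  · exact max_lt_max (by linarith) (by linarith)
  · exact min_lt_min (by linarith) (by linarith)

theorem push_zero (ε : Bool) : push ε 0 = 0 := by cases ε <;> norm_num [push]

theorem push_two (ε : Bool) : push ε 2 = 2 := by cases ε <;> norm_num [push]

theorem push_mem {ε : Bool} {s : ℝ} (h0 : 0 ≤ s) (h2 : s < 2) : 0 ≤ push ε s ∧ push ε s < 2 := by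
  constructor
  · rw [← push_zero ε]; exact (push_strictMono ε).monotone h0
  · calc push ε s < push ε 2 := push_strictMono ε h2
      _ = 2 := push_two ε

theorem push_true_ge {s : ℝ} (h : 2 / 5 ≤ s) : 8 / 5 ≤ push true s := by
  simp only [push]; exact le_min (by linarith) (by linarith)

theorem push_false_le {s : ℝ} (h : s ≤ 8 / 5) : push false s ≤ 2 / 5 := by
  simp only [push]; exact max_le (by linarith) (by linarith)

/-! In what follows `x : ℤ → Bool × Bool` is a bi-infinite sequence of letters, alternating between
the two generators. The generator `c` acts on `ℝ` preserving every interval `[j, j + 2]` with `x j`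
a power of `c`, and pushes it to the right or to the left according to the sign of `x j`. -/

variable {x : ℤ → Bool × Bool}

open Classical in
/-- The left end of the interval `[j, j + 2)` containing `r` with `x j` of type `c`. -/
noncomputable def base (x : ℤ → Bool × Bool) (c : Bool) (r : ℝ) : ℤ :=
  if (x ⌊r⌋).1 = c then ⌊r⌋ else ⌊r⌋ - 1

theorem base_eq_iff (hx : ∀ i, (x (i + 1)).1 = !(x i).1) {c : Bool} {r : ℝ} {j : ℤ} :
    base x c r = j ↔ (x j).1 = c ∧ (j : ℝ) ≤ r ∧ r < j + 2 := by
  have h1 := Int.floor_le r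
  have h2 := Int.lt_floor_add_one r
  constructor
  · rintro rfl
    unfold base
    split_ifs with h
    · exact ⟨h, h1, by linarith⟩
    · refine ⟨?_, by push_cast; linarith, by push_cast; linarith⟩
      have := hx (⌊r⌋ - 1)
      rw [sub_add_cancel] at this
      rw [this] at h
      revert h; cases c <;> cases (x (⌊r⌋ - 1)).1 <;> simp
  · rintro ⟨h3, h4, h5⟩
    have h6 : j ≤ ⌊r⌋ := Int.le_floor.2 h4
    have h7 : ⌊r⌋ < j + 2 := by
      rw [Int.floor_lt]; push_cast; exact h5
    have h8 : ⌊r⌋ = j ∨ ⌊r⌋ = j + 1 := by omega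
    unfold base
    rcases h8 with h8 | h8
    · rw [h8, if_pos h3]
    · rw [h8, if_neg, add_sub_cancel_right]
      rw [hx, h3]; simp

/-- The action of the letter `y` on the line. -/
noncomputable def act (x : ℤ → Bool × Bool) (y : Bool × Bool) (r : ℝ) : ℝ :=
  base x y.1 r + push ((x (base x y.1 r)).2 == y.2) (r - base x y.1 r)

theorem act_eq (hx : ∀ i, (x (i + 1)).1 = !(x i).1) {y : Bool × Bool} {r : ℝ} {j : ℤ}
    (h1 : (x j).1 = y.1) (h2 : (j : ℝ) ≤ r) (h3 : r < j + 2) :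
    act x y r = j + push ((x j).2 == y.2) (r - j) := by
  rw [act, (base_eq_iff hx).2 ⟨h1, h2, h3⟩]

theorem act_mem (hx : ∀ i, (x (i + 1)).1 = !(x i).1) (y : Bool × Bool) (r : ℝ) :
    (base x y.1 r : ℝ) ≤ act x y r ∧ act x y r < base x y.1 r + 2 := by
  obtain ⟨-, h2, h3⟩ := (base_eq_iff hx (c := y.1) (r := r)).1 rfl
  have := push_mem (ε := ((x (base x y.1 r)).2 == y.2)) (sub_nonneg.2 h2)
    (by linarith : r - base x y.1 r < 2)
  rw [act]
  constructor <;> linarith [this.1, this.2]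

theorem base_act (hx : ∀ i, (x (i + 1)).1 = !(x i).1) (y : Bool × Bool) (r : ℝ) :
    base x y.1 (act x y r) = base x y.1 r := by
  obtain ⟨h1, -, -⟩ := (base_eq_iff hx (c := y.1) (r := r)).1 rfl
  exact (base_eq_iff hx).2 ⟨h1, (act_mem hx y r).1, (act_mem hx y r).2⟩

theorem act_not_act (hx : ∀ i, (x (i + 1)).1 = !(x i).1) (y : Bool × Bool) (r : ℝ) :
    act x (y.1, !y.2) (act x y r) = r := by
  have h := base_act hx y r
  conv_lhs => rw [act]
  simp only
  rw [h, act]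
  have : ((x (base x y.1 r)).2 == !y.2) = !((x (base x y.1 r)).2 == y.2) := by
    cases (x (base x y.1 r)).2 <;> cases y.2 <;> rfl
  rw [this, add_sub_cancel_left, push_not_push]
  ring

theorem act_strictMono (hx : ∀ i, (x (i + 1)).1 = !(x i).1) (y : Bool × Bool) :
    StrictMono (act x y) := by
  intro r s hrs
  obtain ⟨h1, h2, h3⟩ := (base_eq_iff hx (c := y.1) (r := r)).1 rfl
  obtain ⟨h1', h2', h3'⟩ := (base_eq_iff hx (c := y.1) (r := s)).1 rfl
  have m1 := act_mem hx y r
  have m2 := act_mem hx y s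
  rcases lt_trichotomy (base x y.1 r) (base x y.1 s) with h | h | h
  · rcases (Int.add_one_le_iff.2 h).eq_or_lt with h' | h'
    · rw [← h', hx, h1] at h1'
      cases y.1 <;> simp at h1'
    · have : (base x y.1 r : ℝ) + 2 ≤ base x y.1 s := by exact_mod_cast (by omega)
      linarith
  · rw [act, act, ← h]
    gcongr
    exact push_strictMono _ (by linarith)
  · have : (base x y.1 s : ℝ) + 1 ≤ base x y.1 r := by exact_mod_cast h
    rcases (Int.add_one_le_iff.2 h).eq_or_lt with h' | h'
    · rw [← h', hx, h1'] at h1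
      cases y.1 <;> simp at h1
    · have : (base x y.1 s : ℝ) + 2 ≤ base x y.1 r := by exact_mod_cast (by omega)
      linarith

theorem act_add (hx : ∀ i, (x (i + 1)).1 = !(x i).1) {M : ℤ} (hM : ∀ i, x (i + M) = x i)
    (y : Bool × Bool) (r : ℝ) : act x y (r + M) = act x y r + M := by
  obtain ⟨h1, h2, h3⟩ := (base_eq_iff hx (c := y.1) (r := r)).1 rfl
  have h := act_eq hx (y := y) (r := r + M) (j := base x y.1 r + M) (by rw [hM, h1])
    (by push_cast; linarith) (by push_cast; linarith)
  rw [h, hM, act]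
  push_cast
  rw [add_sub_add_right_eq_sub]
  ring

/-- The action of a generator, as an order isomorphism of the line. -/
noncomputable def genIso (hx : ∀ i, (x (i + 1)).1 = !(x i).1) (c : Bool) : ℝ ≃o ℝ where
  toFun := act x (c, true)
  invFun := act x (c, false)
  left_inv r := act_not_act hx (c, true) r
  right_inv r := act_not_act hx (c, false) r
  map_rel_iff' := (act_strictMono hx (c, true)).le_iff_le

/-- The action of the free group on the line. -/
noncomputable def rep (hx : ∀ i, (x (i + 1)).1 = !(x i).1) : FreeGroup Bool →* (ℝ ≃o ℝ) :=
  FreeGroup.lift (genIso hx)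

theorem rep_mk_cons (hx : ∀ i, (x (i + 1)).1 = !(x i).1) (y : Bool × Bool)
    (l : List (Bool × Bool)) (r : ℝ) :
    rep hx (FreeGroup.mk (y :: l)) r = act x y (rep hx (FreeGroup.mk l) r) := by
  have : FreeGroup.mk (y :: l) = FreeGroup.mk [y] * FreeGroup.mk l := by
    rw [FreeGroup.mul_mk]; rfl
  rw [this, map_mul, RelIso.mul_apply]
  obtain ⟨c, ε⟩ := y
  have h2 : rep hx (FreeGroup.mk [(c, ε)]) = cond ε (genIso hx c) (genIso hx c)⁻¹ := by
    rw [rep, FreeGroup.lift_mk]; simp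
  rw [h2]
  cases ε <;> rfl

theorem rep_add (hx : ∀ i, (x (i + 1)).1 = !(x i).1) {M : ℤ} (hM : ∀ i, x (i + M) = x i)
    (w : FreeGroup Bool) (r : ℝ) : rep hx w (r + M) = rep hx w r + M := by
  rw [← FreeGroup.mk_toWord (x := w)]
  induction w.toWord with
  | nil => rfl
  | cons y l ih => rw [rep_mk_cons, rep_mk_cons, ih, act_add hx hM]

/-- `circleStep`, for a bi-infinite sequence of letters. -/
def step (x : ℤ → Bool × Bool) (y : Bool × Bool) (i : ℤ) : ℤ :=
  if x i = y then i + 1 else if x (i - 1) = (y.1, !y.2) then i - 1 else i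

/-- The part of the unit interval at `i` where the point `r` lies after the letter `y` has acted:
near the left end if `x i` is a power of the same generator as `y`, so that `i` is the left end of an
interval preserved by `y`, and near the right end otherwise. The interval is pushed towards `r`. -/
def Near (x : ℤ → Bool × Bool) (y : Bool × Bool) (i : ℤ) (r : ℝ) : Prop :=
  ((x i).1 = y.1 ∧ x i ≠ y ∧ (i : ℝ) ≤ r ∧ r ≤ i + 2 / 5) ∨
    ((x i).1 ≠ y.1 ∧ x (i - 1) = y ∧ (i : ℝ) + 3 / 5 ≤ r ∧ r < i + 1)

theorem near_step_of_mem (hx : ∀ i, (x (i + 1)).1 = !(x i).1) {y : Bool × Bool} {j : ℤ} {r : ℝ}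
    (hj : (x j).1 = y.1) {i : ℤ} (hi : i = j ∨ i = j + 1)
    (h1 : (j : ℝ) ≤ r) (h2 : r < j + 2)
    (h3 : x j = y → (j : ℝ) + 2 / 5 ≤ r) (h4 : x j ≠ y → r ≤ j + 8 / 5) :
    Near x y (step x y i) (act x y r) := by
  have hne : (x (j + 1)).1 ≠ y.1 := by rw [hx, hj]; cases y.1 <;> simp
  have hne' : (x (j - 1)).1 ≠ y.1 := by
    have := hx (j - 1)
    rw [sub_add_cancel, hj] at this
    rw [this]; cases (x (j - 1)).1 <;> simp
  have hne1 : x (j + 1) ≠ y := fun h => hne (by rw [h])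
  have hne2 : x (j - 1) ≠ (y.1, !y.2) := fun h => hne' (by rw [h])
  rw [act_eq hx hj h1 h2]
  have hm := push_mem (ε := ((x j).2 == y.2)) (sub_nonneg.2 h1) (by linarith : r - j < 2)
  by_cases hxy : x j = y
  · have hstep : step x y i = j + 1 := by
      rcases hi with rfl | rfl
      · simp [step, hxy]
      · rw [step, if_neg hne1, add_sub_cancel_right, if_neg]
        rw [hxy]
        intro h
        have := congrArg Prod.snd h
        simp at this
    rw [hstep]
    right
    have he : ((x j).2 == y.2) = true := by simp [hxy]
    rw [he] at hm ⊢
    have := push_true_ge (s := r - j) (by linarith [h3 hxy])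
    refine ⟨hne, by rwa [add_sub_cancel_right], ?_, ?_⟩ <;> push_cast <;> linarith [hm.2]
  · have hyj : x j = (y.1, !y.2) := by
      ext1
      · exact hj
      · have : (x j).2 ≠ y.2 := fun h => hxy (Prod.ext hj h)
        revert this; cases (x j).2 <;> cases y.2 <;> simp
    have hstep : step x y i = j := by
      rcases hi with rfl | rfl
      · rw [step, if_neg hxy, if_neg hne2]
      · rw [step, if_neg hne1, add_sub_cancel_right, if_pos hyj]
    rw [hstep]
    left
    have he : ((x j).2 == y.2) = false := by
      rw [hyj]; cases y.2 <;> rfl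
    rw [he] at hm ⊢
    have := push_false_le (s := r - j) (by linarith [h4 hxy])
    exact ⟨hj, hxy, by linarith [hm.1], by linarith⟩

/-- The combinatorial action on `ℤ` follows the action on the line: after a nonempty reduced word, the
image of `1 / 2` lies in the part of the unit interval at the image of `0` described by `Near`. -/
theorem near_foldr (hx : ∀ i, (x (i + 1)).1 = !(x i).1) (l : List (Bool × Bool)) :
    ∀ y, FreeGroup.IsReduced (y :: l) →
      Near x y ((y :: l).foldr (step x) 0) (rep hx (FreeGroup.mk (y :: l)) (1 / 2)) := by
  -- an index `i` of either parity lies in exactly one interval of the given type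
  have hmember : ∀ (i : ℤ) (c : Bool), ∃ j, (x j).1 = c ∧ (i = j ∨ i = j + 1) := by
    intro i c
    by_cases h : (x i).1 = c
    · exact ⟨i, h, Or.inl rfl⟩
    · refine ⟨i - 1, ?_, Or.inr (by ring)⟩
      have := hx (i - 1)
      rw [sub_add_cancel] at this
      rw [this] at h
      revert h; cases c <;> cases (x (i - 1)).1 <;> simp
  induction l with
  | nil =>
    intro y _
    rw [rep_mk_cons]
    have h1 : rep hx (FreeGroup.mk []) (1 / 2) = 1 / 2 := rfl
    rw [h1]
    obtain ⟨j, hj, hi⟩ := hmember 0 y.1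
    simp only [List.foldr_cons, List.foldr_nil]
    have hjr : (j : ℝ) = 0 ∨ (j : ℝ) = -1 := by
      rcases hi with h | h
      · left; exact_mod_cast h.symm
      · right; exact_mod_cast (by omega : j = -1)
    refine near_step_of_mem hx hj hi ?_ ?_ (fun _ => ?_) (fun _ => ?_) <;>
      rcases hjr with h | h <;> rw [h] <;> norm_num
  | cons y' l ih =>
    intro y hred
    have hred' : FreeGroup.IsReduced (y' :: l) := by
      rw [FreeGroup.IsReduced] at hred ⊢
      exact (List.isChain_cons_cons.1 hred).2
    have hyy : y.1 = y'.1 → y.2 = y'.2 := by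
      rw [FreeGroup.IsReduced] at hred
      exact (List.isChain_cons_cons.1 hred).1
    have hn := ih y' hred'
    rw [rep_mk_cons, List.foldr_cons]
    generalize (y' :: l).foldr (step x) 0 = i at hn ⊢
    generalize rep hx (FreeGroup.mk (y' :: l)) (1 / 2) = r at hn ⊢
    by_cases hc : y.1 = y'.1
    · have hy : y = y' := Prod.ext hc (hyy hc)
      subst hy
      rcases hn with ⟨h1, h0, h2, h3⟩ | ⟨h1, h0, h2, h3⟩
      · exact near_step_of_mem hx h1 (Or.inl rfl) h2 (by linarith) (fun h => absurd h h0)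
          (fun _ => by linarith)
      · exact near_step_of_mem hx (j := i - 1) (by rw [h0]) (Or.inr (by ring))
          (by push_cast; linarith) (by push_cast; linarith) (fun _ => by push_cast; linarith)
          (fun h => absurd h0 h)
    · obtain ⟨j, hj, hi⟩ := hmember i y.1
      have hj1 : (x (j + 1)).1 ≠ y.1 := by rw [hx, hj]; cases y.1 <;> simp
      have hor : ∀ i, (x i).1 ≠ y'.1 ↔ (x i).1 = y.1 := by
        intro i
        revert hc; cases y.1 <;> cases y'.1 <;> cases (x i).1 <;> simp
      rcases hi with rfl | rfl
      · rcases hn with ⟨h1, -, h2, h3⟩ | ⟨h1, -, h2, h3⟩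
        · exact absurd hj ((hor i).not.1 (not_not.2 h1))
        · exact near_step_of_mem hx hj (Or.inl rfl) (by linarith) (by linarith)
            (fun _ => by linarith) (fun _ => by linarith)
      · rcases hn with ⟨h1, -, h2, h3⟩ | ⟨h1, -, h2, h3⟩
        · push_cast at h2 h3
          exact near_step_of_mem hx hj (Or.inr rfl) (by linarith) (by linarith)
            (fun _ => by linarith) (fun _ => by linarith)
        · exact absurd ((hor _).1 h1) hj1

/-- The number of half-integers passed by the orbit of `1 / 2`. -/
noncomputable def shift (hx : ∀ i, (x (i + 1)).1 = !(x i).1) (w : FreeGroup Bool) : ℤ :=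
  ⌊rep hx w (1 / 2) - 1 / 2⌋

open Classical in
theorem shift_mk_cons (hx : ∀ i, (x (i + 1)).1 = !(x i).1) {y : Bool × Bool}
    {l : List (Bool × Bool)} (h : FreeGroup.IsReduced (y :: l)) :
    shift hx (FreeGroup.mk (y :: l)) =
      (y :: l).foldr (step x) 0 -
        if (x ((y :: l).foldr (step x) 0)).1 = y.1 then 1 else 0 := by
  rw [shift, Int.floor_eq_iff]
  rcases near_foldr hx l y h with ⟨h1, -, h2, h3⟩ | ⟨h1, -, h2, h3⟩
  · rw [if_pos h1]; push_cast; constructor <;> linarith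
  · rw [if_neg h1]; push_cast; constructor <;> linarith

/-- The number of full turns made by the orbit of `1 / 2`, for sequences of period `M`. -/
noncomputable def turns (hx : ∀ i, (x (i + 1)).1 = !(x i).1) (M : ℤ) (w : FreeGroup Bool) : ℤ :=
  shift hx w / M

theorem turns_spec (hx : ∀ i, (x (i + 1)).1 = !(x i).1) {M : ℤ} (h0 : 0 < M)
    (w : FreeGroup Bool) (k : ℤ) :
    turns hx M w = k ↔ 1 / 2 + (k * M : ℤ) ≤ rep hx w (1 / 2) ∧
      rep hx w (1 / 2) < 1 / 2 + (k * M : ℤ) + M := by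
  rw [turns, Int.ediv_eq_iff_of_pos h0, shift, Int.le_floor, Int.floor_lt]
  push_cast
  constructor <;> rintro ⟨h1, h2⟩ <;> constructor <;> linarith

/-- The number of turns is a quasimorphism with error in `{0, 1}`, since `1 / 2` and its image under
`v` lie in translates of the fundamental domain `[1 / 2, 1 / 2 + M)`. -/
theorem turns_mul (hx : ∀ i, (x (i + 1)).1 = !(x i).1) {M : ℤ} (hM : ∀ i, x (i + M) = x i)
    (h0 : 0 < M) (u v : FreeGroup Bool) :
    turns hx M u + turns hx M v ≤ turns hx M (u * v) ∧
      turns hx M (u * v) ≤ turns hx M u + turns hx M v + 1 := by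
  have hadd : ∀ (w : FreeGroup Bool) (k : ℕ) (r : ℝ),
      rep hx w (r + (k * M : ℤ)) = rep hx w r + (k * M : ℤ) := by
    intro w k
    induction k with
    | zero => intro r; simp
    | succ k ih =>
      intro r
      have : r + (((k + 1 : ℕ) : ℤ) * M : ℤ) = (r + (k * M : ℤ)) + M := by push_cast; ring
      rw [this, rep_add hx hM, ih]; push_cast; ring
  have haddz : ∀ (w : FreeGroup Bool) (k : ℤ) (r : ℝ),
      rep hx w (r + (k * M : ℤ)) = rep hx w r + (k * M : ℤ) := by
    intro w k r
    obtain ⟨n, rfl | rfl⟩ := k.eq_nat_or_neg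
    · exact hadd w n r
    · have := hadd w n (r + (-(n : ℤ) * M : ℤ))
      push_cast at this ⊢
      rw [show r + -(n : ℝ) * M + n * M = r by ring] at this
      linarith
  obtain ⟨hu1, hu2⟩ := (turns_spec hx h0 u _).1 rfl
  obtain ⟨hv1, hv2⟩ := (turns_spec hx h0 v _).1 rfl
  obtain ⟨hw1, hw2⟩ := (turns_spec hx h0 (u * v) _).1 rfl
  have e : rep hx (u * v) (1 / 2) = rep hx u (rep hx v (1 / 2)) := by
    rw [map_mul, RelIso.mul_apply]
  have m1 := (rep hx u).monotone hv1
  have m2 := (rep hx u).strictMono hv2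
  rw [rep_add hx hM, haddz] at m2
  rw [haddz] at m1
  rw [← e] at m1 m2
  have hMr : (0 : ℝ) < M := by exact_mod_cast h0
  push_cast at *
  constructor
  · by_contra h
    have h' : (turns hx M (u * v) : ℝ) + 1 ≤ turns hx M u + turns hx M v := by
      exact_mod_cast (by omega)
    nlinarith
  · by_contra h
    have h' : (turns hx M u : ℝ) + turns hx M v + 2 ≤ turns hx M (u * v) := by
      exact_mod_cast (by omega)
    nlinarith

theorem step_step (hx : ∀ i, (x (i + 1)).1 = !(x i).1) (y : Bool × Bool) (i : ℤ) :
    step x y (step x y i) = step x y i := by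
  have hn : ∀ i, x i = y → x (i + 1) ≠ y := fun i h h' => by
    have := hx i; rw [h, h'] at this; cases h : y.1 <;> simp [h] at this
  have hne : x i = y → x i ≠ (y.1, !y.2) := fun h h' => by
    rw [h] at h'; have := congrArg Prod.snd h'; simp at this
  have hm : x (i - 1) = (y.1, !y.2) → x (i - 1 - 1) ≠ (y.1, !y.2) := fun h h' => by
    have := hx (i - 1 - 1); rw [sub_add_cancel, h, h'] at this; cases h : y.1 <;> simp [h] at this
  have hne' : x (i - 1) = (y.1, !y.2) → x (i - 1) ≠ y := fun h h' => by
    rw [h] at h'; have := congrArg Prod.snd h'; simp at this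
  by_cases h1 : x i = y
  · have : step x y i = i + 1 := by rw [step, if_pos h1]
    rw [this, step, if_neg (hn i h1), add_sub_cancel_right, if_neg (hne h1)]
  · by_cases h2 : x (i - 1) = (y.1, !y.2)
    · have : step x y i = i - 1 := by rw [step, if_neg h1, if_pos h2]
      rw [this, step, if_neg (hne' h2), if_neg (hm h2)]
    · have : step x y i = i := by rw [step, if_neg h1, if_neg h2]
      rw [this, this]

/-- Doubling a letter of a reduced word does not change the number of turns. -/
theorem turns_double (hx : ∀ i, (x (i + 1)).1 = !(x i).1) (M : ℤ) {p s : List (Bool × Bool)}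
    {y : Bool × Bool} (h : FreeGroup.IsReduced (p ++ y :: s)) :
    turns hx M (FreeGroup.mk (p ++ y :: y :: s)) = turns hx M (FreeGroup.mk (p ++ y :: s)) := by
  have h2 : FreeGroup.IsReduced (p ++ y :: y :: s) := by
    rw [FreeGroup.IsReduced] at h ⊢
    rw [List.isChain_split] at h ⊢
    exact ⟨h.1, List.isChain_cons_cons.2 ⟨fun _ => rfl, h.2⟩⟩
  have hf : (p ++ y :: y :: s).foldr (step x) 0 = (p ++ y :: s).foldr (step x) 0 := by
    simp only [List.foldr_append, List.foldr_cons, step_step hx]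
  unfold turns
  cases p with
  | nil =>
    simp only [List.nil_append] at *
    rw [shift_mk_cons hx h2, shift_mk_cons hx h, hf]
  | cons z p =>
    simp only [List.cons_append] at *
    rw [shift_mk_cons hx h2, shift_mk_cons hx h, hf]

theorem shift_toWord (hx : ∀ i, (x (i + 1)).1 = !(x i).1) (w : FreeGroup Bool) :
    w.toWord.foldr (step x) 0 - 1 ≤ shift hx w ∧ shift hx w ≤ w.toWord.foldr (step x) 0 := by
  classical
  have hred := FreeGroup.isReduced_toWord (x := w)
  have hw := FreeGroup.mk_toWord (x := w)
  cases h : w.toWord with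
  | nil =>
    rw [h] at hw
    have : shift hx w = 0 := by
      rw [← hw, shift]
      have h1 : rep hx (FreeGroup.mk []) (1 / 2) = 1 / 2 := rfl
      rw [h1]; simp
    simp [this]
  | cons y l =>
    rw [h] at hw hred
    have := shift_mk_cons hx hred
    rw [hw] at this
    rw [this]
    split_ifs <;> constructor <;> linarith

theorem step_monotone (y : Bool × Bool) : Monotone (step x y) := by
  refine monotone_int_of_le_succ fun i => ?_
  have hne : x i = y → x i ≠ (y.1, !y.2) := fun h h' => by
    rw [h] at h'; have := congrArg Prod.snd h'; simp at this
  unfold step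
  rw [add_sub_cancel_right]
  by_cases h1 : x i = y
  · rw [if_pos h1, if_neg (hne h1)]
    split_ifs <;> omega
  · rw [if_neg h1]
    split_ifs <;> omega

theorem foldr_step_monotone (l : List (Bool × Bool)) : Monotone fun i => l.foldr (step x) i := by
  induction l with
  | nil => exact monotone_id
  | cons y l ih => exact (step_monotone y).comp ih

theorem sub_length_le_foldr_step (l : List (Bool × Bool)) (i : ℤ) :
    i - l.length ≤ l.foldr (step x) i := by
  induction l with
  | nil => simp
  | cons y l ih =>
    rw [List.foldr_cons, List.length_cons]
    have : ∀ j, j - 1 ≤ step x y j := by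
      intro j; unfold step; split_ifs <;> omega
    have := this (l.foldr (step x) i)
    push_cast; omega

end CircleAction

namespace CircleAction

/-- The turns of the three terms of a letter triple fit together, up to replacing one of them by a
word with a doubled letter. -/
theorem turns_letterTriple {x : ℤ → Bool × Bool} (hx : ∀ i, (x (i + 1)).1 = !(x i).1) (M : ℤ)
    {u v w : FreeGroup Bool} (h : IsLetterTriple u v w) :
    turns hx M w⁻¹ = turns hx M (u * v) ∧
      (∃ A, turns hx M A = turns hx M w ∧ A * u = v⁻¹) ∧
      ∃ A, turns hx M A = turns hx M w ∧ v * A = u⁻¹ := by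
  obtain ⟨c₁, c₂, c₃, -, -, -, y, hu, hv, hw⟩ := h
  have hmk : ∀ {a P S : FreeGroup Bool} {z : Bool × Bool}, a.toWord = P.toWord ++ z :: S.toWord →
      a = P * FreeGroup.mk [z] * S := by
    intro a P S z h
    rw [← FreeGroup.mk_toWord (x := a), h]
    conv_rhs => rw [← FreeGroup.mk_toWord (x := P), ← FreeGroup.mk_toWord (x := S)]
    rw [FreeGroup.mul_mk, FreeGroup.mul_mk]
    simp
  have hdbl : ∀ {a P S : FreeGroup Bool} {z : Bool × Bool},
      a.toWord = P.toWord ++ z :: S.toWord →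
      turns hx M (P * FreeGroup.mk [z] * FreeGroup.mk [z] * S) = turns hx M a := by
    intro a P S z h
    have hred := FreeGroup.isReduced_toWord (x := a)
    have ha := FreeGroup.mk_toWord (x := a)
    rw [h] at hred ha
    rw [← ha, ← turns_double hx M hred]
    congr 1
    conv_lhs => rw [← FreeGroup.mk_toWord (x := P), ← FreeGroup.mk_toWord (x := S)]
    rw [FreeGroup.mul_mk, FreeGroup.mul_mk, FreeGroup.mul_mk]
    simp
  have hw' : (w⁻¹).toWord = (c₁⁻¹).toWord ++ y :: c₃.toWord := by
    have : c₃.toWord = FreeGroup.invRev (c₃⁻¹).toWord := by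
      rw [← FreeGroup.toWord_inv, inv_inv]
    rw [FreeGroup.toWord_inv, hw, this, FreeGroup.toWord_inv c₁]
    simp [FreeGroup.invRev]
  have hyi : FreeGroup.mk [(y.1, !y.2)] = (FreeGroup.mk [y])⁻¹ := by
    rw [FreeGroup.inv_mk]; rfl
  refine ⟨?_, ⟨c₃⁻¹ * FreeGroup.mk [(y.1, !y.2)] * FreeGroup.mk [(y.1, !y.2)] * c₁, hdbl hw, ?_⟩,
    ⟨c₃⁻¹ * FreeGroup.mk [(y.1, !y.2)] * FreeGroup.mk [(y.1, !y.2)] * c₁, hdbl hw, ?_⟩⟩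
  · rw [← hdbl hw', hmk hu, hmk hv]
    congr 1
    group
  · rw [hmk hu, hmk hv, hyi]
    group
  · rw [hmk hu, hmk hv, hyi]
    group

/-- The number of turns along a letter-quasimorphism is a quasimorphism with error in `{0, 1}`. -/
theorem turns_letterQuasimorphism {G : Type*} [Group G] {Φ : G → FreeGroup Bool}
    (hΦ : IsLetterQuasimorphism Φ) {x : ℤ → Bool × Bool} (hx : ∀ i, (x (i + 1)).1 = !(x i).1)
    {M : ℤ} (hM : ∀ i, x (i + M) = x i) (h0 : 0 < M) (g h : G) :
    turns hx M (Φ g) + turns hx M (Φ h) ≤ turns hx M (Φ (g * h)) ∧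
      turns hx M (Φ (g * h)) ≤ turns hx M (Φ g) + turns hx M (Φ h) + 1 := by
  rcases hΦ.2 g h with h1 | h1 | h1 | h1
  · rw [← h1]; exact turns_mul hx hM h0 _ _
  · have := (turns_letterTriple hx M h1).1
    rw [inv_inv] at this
    rw [this]; exact turns_mul hx hM h0 _ _
  · obtain ⟨A, hA, hA'⟩ := (turns_letterTriple hx M h1).2.1
    rw [inv_inv] at hA'
    rw [← hA, ← hA']; exact turns_mul hx hM h0 _ _
  · obtain ⟨A, hA, hA'⟩ := (turns_letterTriple hx M h1).2.2
    rw [inv_inv] at hA'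
    rw [← hA, ← hA']; exact turns_mul hx hM h0 _ _

/-- The generator of a letter of an alternating word depends on the parity of its index. -/
theorem fst_getElem_of_isChain {L : List (Bool × Bool)} (h : L.IsChain fun y z => y.1 ≠ z.1)
    (k : ℕ) (hk : k < L.length) :
    (L[k]).1 = ((L[0]'(by omega)).1 ^^ decide (k % 2 = 1)) := by
  induction k with
  | zero => simp
  | succ k ih =>
    have h1 := ih (by omega)
    have h2 := (List.isChain_iff_getElem.1 h) k hk
    rw [h1] at h2
    have h3 : decide ((k + 1) % 2 = 1) = !decide (k % 2 = 1) := by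
      rcases Nat.mod_two_eq_zero_or_one k with h | h <;> simp [Nat.add_mod, h]
    rw [h3]
    revert h2
    cases (L[k + 1]).1 <;> cases (L[0]).1 <;> cases decide (k % 2 = 1) <;> simp

/-- The bi-infinite periodic sequence of the letters of a cyclically alternating word. -/
theorem exists_letters {L : List (Bool × Bool)} (h : L.IsChain fun y z => y.1 ≠ z.1)
    (he : Even L.length) (h0 : 0 < L.length) :
    ∃ x : ℤ → Bool × Bool, (∀ i, cyclicLetter L i = some (x i)) ∧
      (∀ i, (x (i + 1)).1 = !(x i).1) ∧ (∀ i, x (i + L.length) = x i) ∧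
      ∀ (k : ℕ) (hk : k < L.length), x k = L[k] := by
  have hlt : ∀ i : ℤ, (i % (L.length : ℤ)).toNat < L.length := by
    intro i
    have h1 := Int.emod_nonneg i (b := (L.length : ℤ)) (by omega)
    have h2 := Int.emod_lt_of_pos i (b := (L.length : ℤ)) (by omega)
    omega
  refine ⟨fun i => L[(i % (L.length : ℤ)).toNat]'(hlt i), fun i => ?_, fun i => ?_, fun i => ?_,
    fun k hk => ?_⟩
  · rw [cyclicLetter, List.getElem?_eq_getElem (hlt i)]
  · rw [fst_getElem_of_isChain h _ (hlt (i + 1)), fst_getElem_of_isChain h _ (hlt i)]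
    obtain ⟨m, hm⟩ := he
    have e2 : ∀ i : ℤ, (i % (L.length : ℤ)).toNat % 2 = (i % 2).toNat := by
      intro i
      have h1 := Int.emod_nonneg i (b := (L.length : ℤ)) (by omega)
      have h3 : (i % (L.length : ℤ)) % 2 = i % 2 :=
        Int.emod_emod_of_dvd i (by rw [hm]; push_cast; exact ⟨m, by ring⟩)
      omega
    rw [e2, e2]
    rcases Int.emod_two_eq_zero_or_one i with h | h
    · rw [h, show (i + 1) % 2 = 1 by omega]; simp
    · rw [h, show (i + 1) % 2 = 0 by omega]; simp
  · have h1 : (i + L.length) % (L.length : ℤ) = i % (L.length : ℤ) := Int.add_emod_right ..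
    simp only [h1]
  · have h1 : ((k : ℤ) % (L.length : ℤ)).toNat = k := by
      rw [Int.emod_eq_of_lt (by omega) (by omega)]; rfl
    simp only [h1]

/-- One period of the word moves through one period of the circle. -/
theorem foldr_step_reverse {x : ℤ → Bool × Bool} {L : List (Bool × Bool)}
    (hM : ∀ i, x (i + L.length) = x i)
    (hL : ∀ (k : ℕ) (hk : k < L.length), x k = L[k]) (n : ℕ) :
    ((List.replicate n L.reverse).flatten).foldr (step x) 0 = n * L.length := by
  have hper : ∀ (n : ℕ) (i : ℤ), x (i + n * L.length) = x i := by
    intro n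
    induction n with
    | zero => simp
    | succ n ih =>
      intro i
      have : i + ((n + 1 : ℕ) : ℤ) * L.length = (i + n * L.length) + L.length := by
        push_cast; ring
      rw [this, hM, ih]
  induction n with
  | zero => simp
  | succ n ih =>
    have aux : ∀ j ≤ L.length, (L.take j).reverse.foldr (step x) (n * L.length) =
        n * L.length + j := by
      intro j
      induction j with
      | zero => simp
      | succ j ihj =>
        intro hj
        rw [List.take_succ_eq_append_getElem (by omega), List.reverse_append]
        simp only [List.reverse_singleton, List.singleton_append, List.foldr_cons]
        rw [ihj (by omega), step, if_pos]
        · push_cast; ring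
        · rw [add_comm, hper, hL]
    have := aux L.length le_rfl
    rw [List.take_length] at this
    rw [List.replicate_succ, List.flatten_cons, List.foldr_append, ih, this]
    push_cast; ring

end CircleAction

open CircleAction in
/-- A letter-quasimorphism whose values on the powers of `g` are, up to a bounded beginning and end,
the powers of a cyclically alternating word `w`, gives an extremal homogeneous quasimorphism, with
base the word of the letters of `w` in reverse order. -/
theorem IsLetterQuasimorphism.exists_homogeneous {G : Type*} [Group G] {Φ : G → FreeGroup Bool}
    (hΦ : IsLetterQuasimorphism Φ) (g : G) {p w s : List (Bool × Bool)} (hw : w ≠ [])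
    (hww : (w ++ w).IsChain fun y z => y.1 ≠ z.1)
    (hg : ∀ n : ℕ, (Φ (g ^ (n + 1))).toWord = p ++ (List.replicate n w).flatten ++ s) :
    ∃ φ : G → ℝ, IsHomogeneousQuasimorphism φ ∧ 1 ≤ φ g ∧ defect φ ≤ 1 ∧ 1 / 2 ≤ scl g ∧
      ∃ (b : FreeGroup Bool) (rot : FreeGroup Bool → ℝ),
        IsAlternating b ∧ Even b.toWord.length ∧ 0 < b.toWord.length ∧
        IsCircleQuasimorphism b rot ∧
        ∀ h : G, Tendsto (fun n : ℕ => rot (Φ (h ^ n)) / (n * b.toWord.length)) atTop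
          (𝓝 (φ h)) := by
  -- the base and its letters
  have hlen : 0 < w.length := List.length_pos_iff.2 hw
  have heven : Even w.length := by
    have h1 := fst_getElem_of_isChain hww w.length (by simpa using hlen)
    rw [List.getElem_append_right le_rfl] at h1
    have h0 : (w ++ w)[0]'(by simpa using hlen) = w[0] := List.getElem_append_left hlen
    simp only [Nat.sub_self] at h1
    rw [h0] at h1
    rcases Nat.even_or_odd w.length with h | h
    · exact h
    · rw [Nat.odd_iff.1 h] at h1
      revert h1; cases (w[0]).1 <;> simp
  have hwalt : w.IsChain fun y z => y.1 ≠ z.1 := hww.left_of_append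
  have hralt : w.reverse.IsChain fun y z => y.1 ≠ z.1 :=
    List.isChain_reverse.2 (hwalt.imp fun _ _ h => h.symm)
  have hb : (FreeGroup.mk w.reverse).toWord = w.reverse := by
    rw [FreeGroup.toWord_mk]
    exact FreeGroup.IsReduced.reduce_eq (hralt.imp fun _ _ h h' => absurd h' h)
  obtain ⟨x, hcyc, hx, hM, hL⟩ := exists_letters hralt (by simpa using heven) (by simpa using hlen)
  have hstep : circleStep w.reverse = step x := by
    funext y i
    simp only [circleStep, step, hcyc, Option.some.injEq]
  set M : ℤ := (w.reverse.length : ℤ) with hMdef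
  have hM0 : 0 < M := by rw [hMdef]; simpa using hlen
  have hMr : (0 : ℝ) < M := by exact_mod_cast hM0
  have hcm : ∀ v : FreeGroup Bool, circleWordMap (FreeGroup.mk w.reverse) v 0 =
      v.toWord.foldr (step x) 0 := by
    intro v; rw [circleWordMap, hb, hstep]
  have hclose : ∀ v : FreeGroup Bool,
      M * turns hx M v ≤ v.toWord.foldr (step x) 0 ∧
        v.toWord.foldr (step x) 0 ≤ M * turns hx M v + M := by
    intro v
    have h1 := shift_toWord hx v
    have h2 : M * turns hx M v + shift hx v % M = shift hx v := Int.mul_ediv_add_emod _ _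
    have h3 := Int.emod_nonneg (shift hx v) hM0.ne'
    have h4 := Int.emod_lt_of_pos (shift hx v) hM0
    omega
  -- the quasimorphisms on the free group and on `G`
  obtain ⟨ψ, hψlim, hψ1, hψ2, -, -⟩ := exists_homogeneous_of_quasi
    (f := fun v : FreeGroup Bool => (turns hx M v : ℝ))
    (fun u v => by exact_mod_cast (turns_mul hx hM hM0 u v).1)
    (fun u v => by exact_mod_cast (turns_mul hx hM hM0 u v).2)
  obtain ⟨φ, hφlim, hφ1, hφ2, hφhom, hφdef⟩ := exists_homogeneous_of_quasi
    (f := fun v : G => (turns hx M (Φ v) : ℝ))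
    (fun u v => by exact_mod_cast (turns_letterQuasimorphism hΦ hx hM hM0 u v).1)
    (fun u v => by exact_mod_cast (turns_letterQuasimorphism hΦ hx hM hM0 u v).2)
  have hφg : 1 ≤ φ g := by
    refine le_of_forall_nat_mul_le (C := p.length + s.length + 2) fun n => ?_
    rw [mul_one]
    have h1 : φ (g ^ (n + 1)) = (n + 1) * φ g := by
      have := hφhom g ((n + 1 : ℕ) : ℤ)
      rw [zpow_natCast] at this
      rw [this]; push_cast; ring
    rcases Nat.eq_zero_or_pos n with rfl | hn
    · have := hφhom g 0
      simp only [Nat.cast_zero, zero_mul, zero_add]; positivity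
    · obtain ⟨m, rfl⟩ : ∃ m, n = m + 1 := ⟨n - 1, by omega⟩
      have h1 : φ (g ^ (m + 1)) = ((m + 1 : ℕ) : ℝ) * φ g := by
        have := hφhom g ((m + 1 : ℕ) : ℤ)
        rwa [zpow_natCast] at this
      rw [← h1]
      have h2 := hφ1 (g ^ (m + 1))
      have h3 := (hclose (Φ (g ^ (m + 1)))).2
      rw [hg] at h3
      rw [List.foldr_append, List.foldr_append] at h3
      have h4 : -(s.length : ℤ) ≤ s.foldr (step x) 0 := by
        have := sub_length_le_foldr_step (x := x) s 0
        omega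
      -- `s` moves `0` back by at most `s.length` periods
      have h5 : -((s.length : ℤ) * M) ≤ s.foldr (step x) 0 := by nlinarith
      have h6 := foldr_step_reverse (x := x) hM hL m
      rw [List.reverse_reverse] at h6
      have hshift : ∀ (l : List (Bool × Bool)) (k : ℕ) (i : ℤ),
          l.foldr (step x) (i - k * M) = l.foldr (step x) i - k * M := by
        have hper : ∀ (k : ℕ) (i : ℤ), x (i - k * M) = x i := by
          intro k
          induction k with
          | zero => simp
          | succ k ih =>
            intro i
            have : i - ((k + 1 : ℕ) : ℤ) * M + M = i - k * M := by push_cast; ring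
            rw [← hM, this, ih]
        intro l k i
        induction l with
        | nil => rfl
        | cons y l ih =>
          rw [List.foldr_cons, List.foldr_cons, ih]
          generalize l.foldr (step x) i = j
          have e1 := hper k j
          have e2 := hper k (j - 1)
          rw [show j - 1 - k * M = j - k * M - 1 by ring] at e2
          unfold step
          rw [e1, e2]
          split_ifs <;> ring
      have h7 : (m : ℤ) * M - s.length * M ≤
          ((List.replicate m w).flatten).foldr (step x) (s.foldr (step x) 0) := by
        have a1 := foldr_step_monotone (x := x) ((List.replicate m w).flatten) h5
        have a2 := hshift ((List.replicate m w).flatten) s.length 0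
        rw [zero_sub, h6] at a2
        simp only at a1
        rw [a2] at a1
        exact a1
      have h8 := sub_length_le_foldr_step (x := x) p
        (((List.replicate m w).flatten).foldr (step x) (s.foldr (step x) 0))
      have h9 : (m : ℤ) * M - s.length * M - p.length * M ≤
          M * turns hx M (Φ (g ^ (m + 1))) + M := by
        have : (p.length : ℤ) ≤ p.length * M := by nlinarith
        linarith
      have h10 : (m : ℤ) - s.length - p.length ≤ turns hx M (Φ (g ^ (m + 1))) + 1 := by
        by_contra hc
        push Not at hc
        nlinarith
      have h11 : (m : ℝ) - s.length - p.length ≤ turns hx M (Φ (g ^ (m + 1))) + 1 := by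
        exact_mod_cast h10
      push_cast
      linarith
  refine ⟨φ, ⟨⟨1, hφdef⟩, hφhom⟩, hφg, defect_le_one hφdef, half_le_scl hφhom hφdef hφg,
    FreeGroup.mk w.reverse, fun v => M * ψ v, ?_, ?_, ?_, ?_, ?_⟩
  · rw [IsAlternating, hb]; exact hralt
  · rw [hb]; simpa using heven
  · rw [hb]; simpa using hlen
  · intro v
    have h0 : Tendsto (fun n : ℕ => (M : ℝ) * ((turns hx M (v ^ n) : ℝ) / n)) atTop
        (𝓝 (M * ψ v)) := (hψlim v).const_mul _
    have h1 : Tendsto (fun n : ℕ => (M : ℝ) * ((turns hx M (v ^ n) : ℝ) / n) + M * (1 / n)) atTop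
        (𝓝 (M * ψ v)) := by
      have := h0.add (tendsto_one_div_atTop_nhds_zero_nat (𝕜 := ℝ) |>.const_mul (M : ℝ))
      simpa using this
    refine tendsto_of_tendsto_of_tendsto_of_le_of_le h0 h1 (fun n => ?_) (fun n => ?_)
    · simp only
      rw [hcm, ← mul_div_assoc]
      gcongr
      exact_mod_cast (hclose (v ^ n)).1
    · simp only
      rw [hcm, ← mul_div_assoc, ← mul_div_assoc, mul_one, ← add_div]
      gcongr
      exact_mod_cast (hclose (v ^ n)).2
  · intro h
    have h0 := hφlim h
    have h1 : Tendsto (fun n : ℕ => (turns hx M (Φ (h ^ n)) : ℝ) / n + 1 / n) atTop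
        (𝓝 (φ h)) := by
      have := h0.add (tendsto_one_div_atTop_nhds_zero_nat (𝕜 := ℝ))
      simpa using this
    have hdiv : ∀ n : ℕ, (M : ℝ) * ψ (Φ (h ^ n)) / (n * (FreeGroup.mk w.reverse).toWord.length) =
        ψ (Φ (h ^ n)) / n := by
      intro n
      rw [hb, hMdef, Int.cast_natCast, mul_comm (n : ℝ)]
      exact mul_div_mul_left _ _ (by simpa using hw)
    refine tendsto_of_tendsto_of_tendsto_of_le_of_le h0 h1 (fun n => ?_) (fun n => ?_)
    · simp only
      rw [hdiv]
      gcongr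
      exact hψ1 _
    · simp only
      rw [hdiv, ← add_div]
      gcongr
      exact hψ2 _

/-! ### Paths without backtracking -/

section Paths

variable {N : Type*} {adj : N → N → Prop}

/-- The list of the successive nodes of a path without backtracking. -/
def Reduced (adj : N → N → Prop) : List N → Prop
  | [] => True
  | [_] => True
  | x :: y :: l => adj x y ∧ (∀ z ∈ l.head?, x ≠ z) ∧ Reduced adj (y :: l)


@[simp] theorem reduced_singleton (x : N) : Reduced adj [x] := trivial

theorem reduced_cons_cons {x y : N} {l : List N} :
    Reduced adj (x :: y :: l) ↔ adj x y ∧ (∀ z ∈ l.head?, x ≠ z) ∧ Reduced adj (y :: l) :=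
  Iff.rfl

@[simp] theorem reduced_pair {x y : N} : Reduced adj [x, y] ↔ adj x y := by
  simp [reduced_cons_cons]

theorem reduced_triple {x y z : N} : Reduced adj [x, y, z] ↔ adj x y ∧ x ≠ z ∧ adj y z := by
  simp [reduced_cons_cons]

/-- Two paths without backtracking that overlap in an edge can be glued. -/
theorem reduced_append {A B : List N} {x m : N} :
    Reduced adj (A ++ x :: m :: B) ↔ Reduced adj (A ++ [x, m]) ∧ Reduced adj (x :: m :: B) := by
  induction A with
  | nil => simp [reduced_cons_cons]
  | cons a A ih =>
    rcases A with _ | ⟨a', A⟩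
    · simp [reduced_cons_cons]; tauto
    · rcases A with _ | ⟨a'', A⟩
      · simp only [List.cons_append, List.nil_append, reduced_cons_cons, List.head?_cons] at ih ⊢
        simp at ih ⊢
        tauto
      · simp only [List.cons_append] at ih ⊢
        rw [reduced_cons_cons, ih, reduced_cons_cons (l := a'' :: (A ++ [x, m]))]
        simp only [List.head?_cons]
        tauto

theorem Reduced.tail {x : N} {l : List N} (h : Reduced adj (x :: l)) : Reduced adj l := by
  cases l with
  | nil => trivial
  | cons y l => exact h.2.2

theorem Reduced.right {A B : List N} (h : Reduced adj (A ++ B)) : Reduced adj B := by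
  induction A with
  | nil => exact h
  | cons a A ih => exact ih h.tail

theorem Reduced.left {A B : List N} (h : Reduced adj (A ++ B)) : Reduced adj A := by
  induction A with
  | nil => trivial
  | cons a A ih =>
    rcases A with _ | ⟨a', A⟩
    · trivial
    · refine ⟨h.1, ?_, ih h.tail⟩
      intro z hz
      refine h.2.1 z ?_
      cases A with
      | nil => simp at hz
      | cons b A => simpa using hz

theorem Reduced.isChain {L : List N} (h : Reduced adj L) : L.IsChain adj := by
  induction L with
  | nil => exact List.isChain_nil
  | cons x l ih =>
    cases l with
    | nil => exact List.isChain_singleton x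
    | cons y l => exact List.isChain_cons_cons.2 ⟨h.1, ih h.tail⟩

theorem Reduced.reverse (hs : ∀ x y, adj x y → adj y x) {L : List N} (h : Reduced adj L) :
    Reduced adj L.reverse := by
  induction L with
  | nil => trivial
  | cons x l ih =>
    rcases l with _ | ⟨y, l⟩
    · trivial
    · rcases l with _ | ⟨z, l⟩
      · simpa using hs _ _ h.1
      · have h1 := ih h.tail
        simp only [List.reverse_cons, List.append_assoc, List.cons_append, List.nil_append] at h1 ⊢
        rw [reduced_append]
        refine ⟨h1, reduced_triple.2 ⟨hs _ _ h.2.2.1, ?_, hs _ _ h.1⟩⟩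
        exact fun e => h.2.1 z (by simp) e.symm

theorem Reduced.map {N' : Type*} {adj' : N' → N' → Prop} {f : N → N'} (hf : Function.Injective f)
    (hadj : ∀ x y, adj x y → adj' (f x) (f y)) {L : List N} (h : Reduced adj L) :
    Reduced adj' (L.map f) := by
  induction L with
  | nil => trivial
  | cons x l ih =>
    rcases l with _ | ⟨y, l⟩
    · trivial
    · refine ⟨hadj _ _ h.1, ?_, ih h.tail⟩
      intro z hz
      cases l with
      | nil => simp at hz
      | cons w l =>
        simp only [List.map_cons, List.head?_cons, Option.mem_def, Option.some.injEq] at hz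
        rw [← hz]
        exact fun e => h.2.1 w (by simp) (hf e)

/-- Gluing two paths at a common node where they do not backtrack. -/
theorem reduced_glue {A B : List N} {x m y : N} (h1 : Reduced adj (A ++ [x, m]))
    (h2 : Reduced adj (m :: y :: B)) (hxy : x ≠ y) : Reduced adj (A ++ x :: m :: y :: B) := by
  rw [reduced_append]
  refine ⟨h1, (reduced_pair.1 h1.right), ?_, h2⟩
  simpa using hxy

/-- A tree, given by an adjacency relation for which each adjacent pair is separated by a function
that is constant across all other adjacent pairs. -/
structure IsTreeAdj (adj : N → N → Prop) : Prop where
  symm : ∀ x y, adj x y → adj y x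
  conn : ∀ x y, Relation.ReflTransGen adj x y
  sep : ∀ x y, adj x y → ∃ H : N → ℤ, H x ≠ H y ∧
    ∀ u v, adj u v → H u ≠ H v → (u = x ∧ v = y) ∨ (u = y ∧ v = x)

/-- `L` is the path without backtracking from `x` to `y`. -/
def IsPath (adj : N → N → Prop) (x y : N) (L : List N) : Prop :=
  Reduced adj L ∧ L.head? = some x ∧ L.getLast? = some y

theorem IsPath.reverse (hs : ∀ x y, adj x y → adj y x) {x y : N} {L : List N}
    (h : IsPath adj x y L) : IsPath adj y x L.reverse :=
  ⟨h.1.reverse hs, by rw [List.head?_reverse, h.2.2], by rw [List.getLast?_reverse, h.2.1]⟩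

theorem IsPath.map {N' : Type*} {adj' : N' → N' → Prop} {f : N → N'} (hf : Function.Injective f)
    (hadj : ∀ x y, adj x y → adj' (f x) (f y)) {x y : N} {L : List N} (h : IsPath adj x y L) :
    IsPath adj' (f x) (f y) (L.map f) :=
  ⟨h.1.map hf hadj, by rw [List.head?_map, h.2.1]; rfl, by rw [List.getLast?_map, h.2.2]; rfl⟩

theorem exists_ne_of_isChain {r : N → N → Prop} {H : N → ℤ} {l : List N} :
    ∀ {x y : N}, (x :: (l ++ [y])).IsChain r → H x ≠ H y →
      ∃ A u v B, x :: (l ++ [y]) = A ++ u :: v :: B ∧ r u v ∧ H u ≠ H v := by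
  induction l with
  | nil =>
    intro x y h hne
    exact ⟨[], x, y, [], rfl, (List.isChain_cons_cons.1 h).1, hne⟩
  | cons z l ih =>
    intro x y h hne
    by_cases hxz : H x = H z
    · obtain ⟨A, u, v, B, h1, h2, h3⟩ := ih (List.isChain_cons_cons.1 h).2 (by rwa [← hxz])
      exact ⟨x :: A, u, v, B, by rw [List.cons_append, h1]; rfl, h2, h3⟩
    · exact ⟨[], x, z, l ++ [y], rfl, (List.isChain_cons_cons.1 h).1, hxz⟩

namespace IsTreeAdj

/-- A path without backtracking does not return. It leaves `x` across the edge from `x` to `y`, and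
by separation it has to cross this edge again, which gives a shorter path that returns. -/
theorem not_reduced_closed (T : IsTreeAdj adj) (n : ℕ) : ∀ (x : N) (l : List N), l.length = n →
    ¬ Reduced adj (x :: (l ++ [x])) := by
  induction n using Nat.strong_induction_on with
  | _ n ih =>
  intro x l hl h
  rcases l with _ | ⟨y, l⟩
  · obtain ⟨H, h1, -⟩ := T.sep x x (reduced_pair.1 h)
    exact h1 rfl
  · obtain ⟨H, h1, h2⟩ := T.sep x y h.1
    obtain ⟨A, u, v, B, h3, h4, h5⟩ := exists_ne_of_isChain (x := y) (y := x) (l := l)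
      h.tail.isChain h1.symm
    have hlen := congrArg List.length h3
    simp only [List.length_cons, List.length_append, List.length_nil] at hlen hl
    have hxy : x ≠ y := fun e => h1 (by rw [e])
    rw [List.cons_append, h3] at h
    rcases h2 u v h4 h5 with ⟨rfl, rfl⟩ | ⟨rfl, rfl⟩
    · refine ih A.length (by omega) u A rfl ?_
      have : u :: (A ++ u :: v :: B) = (u :: (A ++ [u])) ++ v :: B := by simp
      rw [this] at h
      exact h.left
    · cases A with
      | nil => exact h.2.1 v (by simp) rfl
      | cons a A =>
        simp only [List.cons_append, List.cons.injEq] at h3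
        obtain ⟨rfl, -⟩ := h3
        refine ih A.length ?_ u A rfl ?_
        · simp at hlen; omega
        · have : v :: (u :: A ++ u :: v :: B) = [v] ++ ((u :: (A ++ [u])) ++ v :: B) := by simp
          rw [this] at h
          exact h.right.left

theorem notMem_tail (T : IsTreeAdj adj) {x : N} {l : List N}
    (h : Reduced adj (x :: l)) : x ∉ l := by
  intro hx
  obtain ⟨A, B, rfl⟩ := List.append_of_mem hx
  have : x :: (A ++ x :: B) = (x :: (A ++ [x])) ++ B := by simp
  rw [this] at h
  exact T.not_reduced_closed _ x A rfl h.left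

theorem notMem_init (T : IsTreeAdj adj) {x : N} {l : List N}
    (h : Reduced adj (l ++ [x])) : x ∉ l := by
  have := h.reverse T.symm
  rw [List.reverse_append] at this
  simpa using T.notMem_tail this

theorem exists_isPath (T : IsTreeAdj adj) (x y : N) : ∃ L, IsPath adj x y L := by
  induction T.conn x y using Relation.ReflTransGen.head_induction_on with
  | refl => exact ⟨[y], trivial, rfl, rfl⟩
  | @head a c hac _ ih =>
    obtain ⟨L, h1, h2, h3⟩ := ih
    rcases L with _ | ⟨c', l⟩
    · simp at h2
    · obtain rfl : c' = c := by simpa using h2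
      rcases l with _ | ⟨d, l⟩
      · exact ⟨[a, c'], by simpa using hac, rfl, h3⟩
      · by_cases had : a = d
        · subst had
          exact ⟨a :: l, h1.tail, rfl, by rwa [List.getLast?_cons_cons] at h3⟩
        · exact ⟨a :: c' :: d :: l, ⟨hac, by simpa using had, h1⟩, rfl,
            by rwa [List.getLast?_cons_cons]⟩

/-- The tripod spanned by the ends of two paths that start at the same node. -/
theorem exists_tripod_aux (T : IsTreeAdj adj) (l : List N) : ∀ (A l' : List N) (x : N),
    Reduced adj (A.reverse ++ x :: l) → Reduced adj (A.reverse ++ x :: l') →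
    ∃ (A' B C : List N) (m : N), A.reverse ++ x :: l = A'.reverse ++ m :: B ∧
      A.reverse ++ x :: l' = A'.reverse ++ m :: C ∧ Reduced adj (B.reverse ++ m :: C) ∧
      ∀ b ∈ B.head?, ∀ c ∈ C.head?, b ≠ c := by
  induction l with
  | nil =>
    intro A l' x h h'
    exact ⟨A, [], l', x, rfl, rfl, by simpa using h'.right, by simp⟩
  | cons z l ih =>
    intro A l' x h h'
    rcases l' with _ | ⟨z', l'⟩
    · refine ⟨A, z :: l, [], x, rfl, rfl, ?_, by simp⟩
      have := h.right.reverse T.symm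
      simpa using this
    · by_cases hz : z = z'
      · subst hz
        have := ih (x :: A) l' z (by simpa using h) (by simpa using h')
        simpa using this
      · refine ⟨A, z :: l, z' :: l', x, rfl, rfl, ?_, by simpa using hz⟩
        have h1 := h.right.reverse T.symm
        have : (z :: l).reverse ++ x :: z' :: l' = l.reverse ++ z :: x :: z' :: l' := by simp
        rw [this]
        exact reduced_glue (by simpa using h1) h'.right hz

theorem isPath_unique (T : IsTreeAdj adj) {x y : N} {L L' : List N}
    (h : IsPath adj x y L) (h' : IsPath adj x y L') : L = L' := by
  obtain ⟨h1, h2, h3⟩ := h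
  obtain ⟨h1', h2', h3'⟩ := h'
  rcases L with _ | ⟨a, l⟩
  · simp at h2
  rcases L' with _ | ⟨a', l'⟩
  · simp at h2'
  obtain rfl : a = x := by simpa using h2
  obtain rfl : a' = a := by simpa using h2'
  obtain ⟨A, B, C, m, e1, e2, hBC, hne⟩ := T.exists_tripod_aux l [] l' a' h1 h1'
  simp only [List.reverse_nil, List.nil_append] at e1 e2
  rw [e1] at h3 ⊢
  rw [e2] at h3' ⊢
  rw [List.getLast?_append_cons] at h3 h3'
  -- the two branches end at the same node, so the path joining their ends is closed
  rcases List.eq_nil_or_concat B with rfl | ⟨B', b, rfl⟩ <;>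
    rcases List.eq_nil_or_concat C with rfl | ⟨C', c, rfl⟩
  · rfl
  · exfalso
    simp only [List.concat_eq_append] at *
    rw [← List.cons_append, List.getLast?_concat] at h3'
    simp at h3 h3'
    subst h3 h3'
    exact T.not_reduced_closed _ _ C' rfl (by simpa using hBC)
  · exfalso
    simp only [List.concat_eq_append] at *
    rw [← List.cons_append, List.getLast?_concat] at h3
    simp at h3 h3'
    subst h3 h3'
    exact T.not_reduced_closed _ _ B'.reverse rfl (by simpa using hBC)
  · exfalso
    simp only [List.concat_eq_append] at *
    rw [← List.cons_append, List.getLast?_concat] at h3 h3'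
    simp at h3 h3'
    subst h3 h3'
    exact T.not_reduced_closed _ _ (B'.reverse ++ m :: C') rfl (by simpa using hBC)

/-- The paths between three nodes form a tripod. -/
theorem exists_tripod (T : IsTreeAdj adj) (x y z : N) : ∃ (A B C : List N) (m : N),
    IsPath adj x y (A.reverse ++ m :: B) ∧ IsPath adj y z (B.reverse ++ m :: C) ∧
      IsPath adj x z (A.reverse ++ m :: C) := by
  obtain ⟨L, h1, h2, h3⟩ := T.exists_isPath x y
  obtain ⟨L', h1', h2', h3'⟩ := T.exists_isPath x z
  rcases L with _ | ⟨a, l⟩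
  · simp at h2
  rcases L' with _ | ⟨a', l'⟩
  · simp at h2'
  obtain rfl : a = x := by simpa using h2
  obtain rfl : a' = a := by simpa using h2'
  obtain ⟨A, B, C, m, e1, e2, hBC, -⟩ := T.exists_tripod_aux l [] l' a' h1 h1'
  simp only [List.reverse_nil, List.nil_append] at e1 e2
  rw [e1] at h1 h2 h3
  rw [e2] at h1' h2' h3'
  rw [List.getLast?_append_cons] at h3 h3'
  refine ⟨A, B, C, m, ⟨h1, h2, by rwa [List.getLast?_append_cons]⟩, ⟨hBC, ?_, ?_⟩,
    ⟨h1', h2', by rwa [List.getLast?_append_cons]⟩⟩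
  · rw [← h3]
    rcases List.eq_nil_or_concat B with rfl | ⟨B', b, rfl⟩
    · rfl
    · simp [List.getLast?_cons]
  · rwa [List.getLast?_append_cons]

end IsTreeAdj

end Paths

/-! ### The letters of a path in a tree with ordered links -/

section Letters

variable {N : Type*} {adj : N → N → Prop}

/-- The concatenation of the lists attached to the successive turns of a path. -/
def turnList {α : Type*} (f : N → N → N → List α) : List N → List α
  | x :: m :: z :: l => f x m z ++ turnList f (m :: z :: l)
  | _ => []

section TurnList

variable {α : Type*} {f : N → N → N → List α}

@[simp] theorem turnList_singleton (x : N) : turnList f [x] = [] := rfl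
@[simp] theorem turnList_pair (x y : N) : turnList f [x, y] = [] := rfl
theorem turnList_cons (x m z : N) (l : List N) :
    turnList f (x :: m :: z :: l) = f x m z ++ turnList f (m :: z :: l) := rfl

theorem turnList_append {A B : List N} {x m : N} :
    turnList f (A ++ x :: m :: B) = turnList f (A ++ [x, m]) ++ turnList f (x :: m :: B) := by
  induction A with
  | nil => simp
  | cons a A ih =>
    rcases A with _ | ⟨a', A⟩
    · simp [turnList_cons]
    · rcases A with _ | ⟨a'', A⟩
      · simp only [List.cons_append, List.nil_append, turnList_cons, List.append_assoc] at ih ⊢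
        simp
      · simp only [List.cons_append, turnList_cons] at ih ⊢
        rw [ih]
        simp only [List.append_assoc]

theorem turnList_map {g : N → N} (hg : ∀ x m z, f (g x) (g m) (g z) = f x m z) (L : List N) :
    turnList f (L.map g) = turnList f L := by
  induction L with
  | nil => rfl
  | cons x l ih =>
    rcases l with _ | ⟨y, l⟩
    · rfl
    · rcases l with _ | ⟨z, l⟩
      · rfl
      · simp only [List.map_cons, turnList_cons, hg] at ih ⊢
        rw [ih]

end TurnList

/-- `pos p m q` says that `p` comes before `q` in a total order on the neighbours of `m`: it is
antisymmetric, and not cyclic on three neighbours. -/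
structure IsLinkOrder (adj : N → N → Prop) (pos : N → N → N → Bool) : Prop where
  anti : ∀ p m q, adj p m → adj m q → p ≠ q → pos p m q = !pos q m p
  cyc : ∀ p m q r, adj p m → adj m q → adj m r → p ≠ q → q ≠ r → r ≠ p →
    ¬ (pos p m q = pos q m r ∧ pos q m r = pos r m p)

/-- The letter of the turn at `m` from `p` to `q`: a power of the generator given by the colour of
`m`, with the sign given by the order on the link of `m`. There is no letter at uncoloured nodes. -/
def turnLetter (color : N → Option Bool) (pos : N → N → N → Bool) (p m q : N) :
    List (Bool × Bool) :=
  match color m with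
  | none => []
  | some c => [(c, pos p m q)]

variable {color : N → Option Bool} {pos : N → N → N → Bool}

theorem turnLetter_none {p m q : N} (h : color m = none) : turnLetter color pos p m q = [] := by
  rw [turnLetter, h]

theorem turnLetter_some {p m q : N} {c : Bool} (h : color m = some c) :
    turnLetter color pos p m q = [(c, pos p m q)] := by
  rw [turnLetter, h]

theorem invRev_append (l l' : List (Bool × Bool)) :
    FreeGroup.invRev (l ++ l') = FreeGroup.invRev l' ++ FreeGroup.invRev l := by
  simp [FreeGroup.invRev]

theorem invRev_turnLetter (hp : IsLinkOrder adj pos) {p m q : N} (h1 : adj p m) (h2 : adj m q)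
    (h3 : p ≠ q) (hs : ∀ x y, adj x y → adj y x) :
    FreeGroup.invRev (turnLetter color pos p m q) = turnLetter color pos q m p := by
  unfold turnLetter
  cases color m with
  | none => rfl
  | some c =>
    simp only [FreeGroup.invRev, List.map_cons, List.map_nil, List.reverse_singleton]
    rw [hp.anti q m p (hs _ _ h2) (hs _ _ h1) h3.symm]

theorem turnList_reverse (hs : ∀ x y, adj x y → adj y x) (hp : IsLinkOrder adj pos) {L : List N}
    (h : Reduced adj L) : turnList (turnLetter color pos) L.reverse =
      FreeGroup.invRev (turnList (turnLetter color pos) L) := by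
  induction L with
  | nil => rfl
  | cons x l ih =>
    rcases l with _ | ⟨y, l⟩
    · rfl
    · rcases l with _ | ⟨z, l⟩
      · rfl
      · have h1 := ih h.tail
        simp only [List.reverse_cons, List.append_assoc, List.cons_append, List.nil_append] at h1 ⊢
        rw [turnList_append, h1, turnList_cons, turnList_cons, invRev_append]
        congr 1
        rw [invRev_turnLetter hp h.1 h.2.2.1 (h.2.1 z (by simp)) hs]
        simp

/-- The letters of a path through `m` composed of two branches. -/
theorem turnList_branches (hs : ∀ x y, adj x y → adj y x) (hp : IsLinkOrder adj pos)
    {A B : List N} {a b m : N} (h : Reduced adj ((a :: A).reverse ++ m :: b :: B)) :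
    turnList (turnLetter color pos) ((a :: A).reverse ++ m :: b :: B) =
      FreeGroup.invRev (turnList (turnLetter color pos) (m :: a :: A)) ++
        turnLetter color pos a m b ++ turnList (turnLetter color pos) (m :: b :: B) := by
  have e : (a :: A).reverse ++ m :: b :: B = A.reverse ++ a :: m :: b :: B := by simp
  rw [e] at h ⊢
  have h1 := (reduced_append.1 h).1.reverse hs
  rw [turnList_append, turnList_cons, ← List.append_assoc]
  congr 2
  rw [← turnList_reverse hs hp (by simpa using h1)]
  simp

/-- If the node where two branches meet is uncoloured, or is an end, it contributes no letter. -/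
theorem turnList_branches_of_none (hs : ∀ x y, adj x y → adj y x) (hp : IsLinkOrder adj pos)
    {A B : List N} {m : N} (hm : color m = none) (h : Reduced adj (A.reverse ++ m :: B)) :
    turnList (turnLetter color pos) (A.reverse ++ m :: B) =
      FreeGroup.invRev (turnList (turnLetter color pos) (m :: A)) ++
        turnList (turnLetter color pos) (m :: B) := by
  rcases A with _ | ⟨a, A⟩
  · simp [FreeGroup.invRev]
  · rcases B with _ | ⟨b, B⟩
    · rw [← List.reverse_cons, turnList_reverse hs hp, turnList_singleton, List.append_nil]
      have := h.reverse hs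
      simpa using this
    · rw [turnList_branches hs hp h, turnLetter_none hm, List.append_nil]

/-- The colours of adjacent coloured nodes differ, and an uncoloured node in the interior of a path
lies between nodes of different colours. -/
structure IsAlternatingColoring (adj : N → N → Prop) (color : N → Option Bool) : Prop where
  ne_of_adj : ∀ p q c d, adj p q → color p = some c → color q = some d → c ≠ d
  of_none : ∀ p m q, adj p m → adj m q → p ≠ q → color m = none →
    ∃ c, color p = some c ∧ color q = some !c

theorem isChain_turnList (hc : IsAlternatingColoring adj color) {L : List N} (h : Reduced adj L) :
    (turnList (turnLetter color pos) L).IsChain fun y z => y.1 ≠ z.1 := by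
  suffices H : ∀ (l : List N) (x m z : N), Reduced adj (x :: m :: z :: l) →
      (turnList (turnLetter color pos) (x :: m :: z :: l)).IsChain (fun y z => y.1 ≠ z.1) ∧
      ∀ y ∈ (turnList (turnLetter color pos) (x :: m :: z :: l)).head?,
        color m = some y.1 ∨ (color m = none ∧ color z = some y.1) by
    rcases L with _ | ⟨x, _ | ⟨m, _ | ⟨z, l⟩⟩⟩
    · exact List.isChain_nil
    · exact List.isChain_nil
    · exact List.isChain_nil
    · exact (H l x m z h).1
  intro l
  induction l with
  | nil =>
    intro x m z h
    rw [turnList_cons, turnList_pair, List.append_nil]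
    cases hm : color m with
    | none => rw [turnLetter_none hm]; simp
    | some c => rw [turnLetter_some hm]; simp
  | cons w l ih =>
    intro x m z h
    obtain ⟨h1, h2⟩ := ih m z w h.tail
    rw [turnList_cons]
    cases hm : color m with
    | none =>
      rw [turnLetter_none hm, List.nil_append]
      refine ⟨h1, fun y hy => Or.inr ⟨rfl, ?_⟩⟩
      obtain ⟨c, hx, hz⟩ := hc.of_none x m z h.1 h.2.2.1 (h.2.1 z (by simp)) hm
      rcases h2 y hy with h3 | ⟨h3, -⟩
      · exact h3
      · rw [hz] at h3; cases h3
    | some c =>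
      rw [turnLetter_some hm]
      refine ⟨?_, by simp⟩
      rw [List.singleton_append, List.isChain_cons]
      refine ⟨fun y hy => ?_, h1⟩
      have hmz := h.2.2.1
      rcases h2 y hy with h3 | ⟨h3, h4⟩
      · exact hc.ne_of_adj m z c y.1 hmz hm h3
      · obtain ⟨d, hd1, hd2⟩ := hc.of_none m z w hmz h.2.2.2.2.1 (h.2.2.2.1 w (by simp)) h3
        rw [hm] at hd1
        rw [h4] at hd2
        simp only [Option.some.injEq] at hd1 hd2
        simp only
        rw [hd1, hd2]; simp

theorem toWord_mk_of_isChain {l : List (Bool × Bool)} (h : l.IsChain fun y z => y.1 ≠ z.1) :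
    (FreeGroup.mk l).toWord = l := by
  rw [FreeGroup.toWord_mk]
  exact FreeGroup.IsReduced.reduce_eq (h.imp fun _ _ h h' => absurd h' h)

/-- The letters of the path from `x` to `y`. -/
noncomputable def pathWord (T : IsTreeAdj adj) (color : N → Option Bool) (pos : N → N → N → Bool)
    (x y : N) : List (Bool × Bool) :=
  turnList (turnLetter color pos) (T.exists_isPath x y).choose

theorem pathWord_eq (T : IsTreeAdj adj) {x y : N} {L : List N} (h : IsPath adj x y L) :
    pathWord T color pos x y = turnList (turnLetter color pos) L := by
  rw [pathWord, T.isPath_unique (T.exists_isPath x y).choose_spec h]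

theorem pathWord_swap (T : IsTreeAdj adj) (hp : IsLinkOrder adj pos) (x y : N) :
    pathWord T color pos y x = FreeGroup.invRev (pathWord T color pos x y) := by
  obtain ⟨L, hL⟩ := T.exists_isPath x y
  rw [pathWord_eq T hL, pathWord_eq T (hL.reverse T.symm), turnList_reverse T.symm hp hL.1]

theorem pathWord_map (T : IsTreeAdj adj) {g : N → N} (hinj : Function.Injective g)
    (hadj : ∀ x y, adj x y → adj (g x) (g y)) (hcol : ∀ x, color (g x) = color x)
    (hpos : ∀ x m y, pos (g x) (g m) (g y) = pos x m y) (x y : N) :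
    pathWord T color pos (g x) (g y) = pathWord T color pos x y := by
  obtain ⟨L, hL⟩ := T.exists_isPath x y
  rw [pathWord_eq T hL, pathWord_eq T (hL.map hinj hadj), turnList_map]
  intro x m z
  simp only [turnLetter, hcol, hpos]

theorem pathWord_isChain (T : IsTreeAdj adj) (hc : IsAlternatingColoring adj color) (x y : N) :
    (pathWord T color pos x y).IsChain fun y z => y.1 ≠ z.1 :=
  isChain_turnList hc (T.exists_isPath x y).choose_spec.1

/-- The words of the paths between three uncoloured nodes multiply, or form a letter triple. At the
centre of the tripod, two of the three turns have the same sign and the third the opposite one. -/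
theorem pathWord_tripod (T : IsTreeAdj adj) (hp : IsLinkOrder adj pos)
    (hc : IsAlternatingColoring adj color) {x y z : N} (hx : color x = none) (hy : color y = none)
    (hz : color z = none) {u v w : FreeGroup Bool}
    (hu : u = FreeGroup.mk (pathWord T color pos x y))
    (hv : v = FreeGroup.mk (pathWord T color pos y z))
    (hw : w = FreeGroup.mk (pathWord T color pos z x)) :
    u * v = w⁻¹ ∨ IsLetterTriple u v w ∨ IsLetterTriple v w u ∨ IsLetterTriple w u v := by
  have hu' := hu ▸ toWord_mk_of_isChain (pathWord_isChain (pos := pos) T hc x y)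
  have hv' := hv ▸ toWord_mk_of_isChain (pathWord_isChain (pos := pos) T hc y z)
  have hw' := hw ▸ toWord_mk_of_isChain (pathWord_isChain (pos := pos) T hc z x)
  obtain ⟨A, B, C, m, h1, h2, h3⟩ := T.exists_tripod x y z
  have h3' := h3.reverse T.symm
  have e3 : (A.reverse ++ m :: C).reverse = C.reverse ++ m :: A := by simp
  rw [e3] at h3'
  rw [pathWord_eq T h1] at hu hu'
  rw [pathWord_eq T h2] at hv hv'
  rw [pathWord_eq T h3'] at hw hw'
  cases hm : color m with
  | none =>
    left
    rw [hu, hv, hw, turnList_branches_of_none T.symm hp hm h1.1,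
      turnList_branches_of_none T.symm hp hm h2.1, turnList_branches_of_none T.symm hp hm h3'.1]
    simp only [← FreeGroup.mul_mk, ← FreeGroup.inv_mk]
    group
  | some c =>
    right
    rcases A with _ | ⟨a, A⟩
    · have := h1.2.1
      simp only [List.reverse_nil, List.nil_append, List.head?_cons, Option.some.injEq] at this
      rw [this, hx] at hm; cases hm
    rcases B with _ | ⟨b, B⟩
    · have := h1.2.2
      simp only [List.getLast?_append, List.getLast?_singleton, Option.some_or,
        Option.some.injEq] at this
      rw [this, hy] at hm; cases hm
    rcases C with _ | ⟨d, C⟩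
    · have := h2.2.2
      simp only [List.getLast?_append, List.getLast?_singleton, Option.some_or,
        Option.some.injEq] at this
      rw [this, hz] at hm; cases hm
    have key : ∀ {a b : N} {A B : List N}, Reduced adj ((a :: A).reverse ++ m :: b :: B) →
        Reduced adj (m :: a :: A) ∧ Reduced adj (m :: b :: B) ∧ a ≠ b := by
      intro a b A B h
      have e : (a :: A).reverse ++ m :: b :: B = A.reverse ++ a :: m :: b :: B := by simp
      rw [e] at h
      have h4 := (reduced_append.1 h)
      have h5 := h4.1.reverse T.symm
      exact ⟨by simpa using h5, h4.2.2.2, h4.2.2.1 b (by simp)⟩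
    obtain ⟨ra, rb, hab⟩ := key h1.1
    obtain ⟨-, rc, hbd⟩ := key h2.1
    obtain ⟨-, -, hda⟩ := key h3'.1
    rw [turnList_branches T.symm hp h1.1, turnLetter_some hm] at hu'
    rw [turnList_branches T.symm hp h2.1, turnLetter_some hm] at hv'
    rw [turnList_branches T.symm hp h3'.1, turnLetter_some hm] at hw'
    have alt : ∀ {a : N} {A : List N}, Reduced adj (m :: a :: A) →
        ∃ c : FreeGroup Bool, IsAlternating c ∧
          turnList (turnLetter color pos) (m :: a :: A) = c.toWord ∧
          FreeGroup.invRev (turnList (turnLetter color pos) (m :: a :: A)) = c⁻¹.toWord := by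
      intro a A h
      have h6 := isChain_turnList (pos := pos) hc h
      have h7 := toWord_mk_of_isChain h6
      exact ⟨FreeGroup.mk _, by rw [IsAlternating, h7]; exact h6, h7.symm,
        by rw [FreeGroup.toWord_inv, h7]⟩
    obtain ⟨ca, ha1, ha2, ha3⟩ := alt ra
    obtain ⟨cb, hb1, hb2, hb3⟩ := alt rb
    obtain ⟨cd, hd1, hd2, hd3⟩ := alt rc
    rw [ha3, hb2] at hu'
    rw [hb3, hd2] at hv'
    rw [hd3, ha2] at hw'
    simp only [List.append_assoc, List.singleton_append] at hu' hv' hw'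
    have hcyc := hp.cyc a m b d (T.symm _ _ ra.1) rb.1 rc.1 hab hbd hda
    have hor : (pos a m b = pos b m d ∧ pos d m a = !pos a m b) ∨
        (pos b m d = pos d m a ∧ pos a m b = !pos b m d) ∨
        (pos d m a = pos a m b ∧ pos b m d = !pos d m a) := by
      revert hcyc
      cases pos a m b <;> cases pos b m d <;> cases pos d m a <;> simp
    rcases hor with ⟨e1, e2⟩ | ⟨e1, e2⟩ | ⟨e1, e2⟩
    · left
      exact ⟨ca, cb, cd, ha1, hb1, hd1, (c, pos a m b), hu', by rw [hv', e1], by rw [hw', e2]⟩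
    · right; left
      exact ⟨cb, cd, ca, hb1, hd1, ha1, (c, pos b m d), hv', by rw [hw', e1], by rw [hu', e2]⟩
    · right; right
      exact ⟨cd, ca, cb, hd1, ha1, hb1, (c, pos d m a), hw', by rw [hu', e1], by rw [hv', e2]⟩

/-- The word of the path from `o` to its image under `g` is a letter-quasimorphism, for a group that
acts on a tree with an alternating colouring and orders on the links. -/
theorem isLetterQuasimorphism_pathWord {G : Type*} [Group G] [MulAction G N]
    (T : IsTreeAdj adj) (hp : IsLinkOrder adj pos) (hc : IsAlternatingColoring adj color)
    (hadj : ∀ (g : G) x y, adj x y → adj (g • x) (g • y))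
    (hcol : ∀ (g : G) x, color (g • x) = color x)
    (hpos : ∀ (g : G) x m y, pos (g • x) (g • m) (g • y) = pos x m y) {o : N}
    (ho : color o = none) :
    IsLetterQuasimorphism fun g : G => FreeGroup.mk (pathWord T color pos o (g • o)) := by
  have hmap : ∀ (g : G) x y, pathWord T color pos (g • x) (g • y) = pathWord T color pos x y :=
    fun g => pathWord_map T (MulAction.injective g) (hadj g) (hcol g) (hpos g)
  refine ⟨fun g => ?_, fun g h => ?_⟩
  · have := hmap g o (g⁻¹ • o)
    rw [smul_inv_smul] at this
    simp only
    rw [← this, pathWord_swap T hp, ← FreeGroup.inv_mk]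
  · have h1 := hmap g o (h • o)
    rw [← mul_smul] at h1
    have h2 : (FreeGroup.mk (pathWord T color pos o ((g * h) • o)))⁻¹ =
        FreeGroup.mk (pathWord T color pos ((g * h) • o) o) := by
      rw [pathWord_swap T hp o, ← FreeGroup.inv_mk]
    have := pathWord_tripod T hp hc ho (y := g • o) (by rw [hcol, ho]) (by rw [hcol, ho]) rfl
      (v := FreeGroup.mk (pathWord T color pos o (h • o))) (by rw [h1]) h2
    rw [inv_inv] at this
    exact this

/-! ### The order on the ends of a tree with ordered links -/

/-- The exponent sum of a word. -/
def exponentSum (l : List (Bool × Bool)) : ℤ := (l.map fun y => if y.2 then (1 : ℤ) else -1).sum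

theorem exponentSum_append (l l' : List (Bool × Bool)) :
    exponentSum (l ++ l') = exponentSum l + exponentSum l' := by simp [exponentSum]

theorem exponentSum_invRev (l : List (Bool × Bool)) :
    exponentSum (FreeGroup.invRev l) = - exponentSum l := by
  induction l with
  | nil => rfl
  | cons y l ih =>
    have : y :: l = [y] ++ l := rfl
    rw [this, invRev_append, exponentSum_append, exponentSum_append, ih]
    obtain ⟨a, b⟩ := y
    cases b <;> simp [exponentSum, FreeGroup.invRev]

theorem exponentSum_emod_two (l : List (Bool × Bool)) :
    exponentSum l % 2 = (l.length : ℤ) % 2 := by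
  induction l with
  | nil => rfl
  | cons y l ih =>
    have : y :: l = [y] ++ l := rfl
    rw [this, exponentSum_append, List.length_append, Int.add_emod, ih]
    obtain ⟨a, b⟩ := y
    cases b <;> simp [exponentSum, Int.add_emod]

/-- The number of positive turns minus the number of negative turns of the path from `x` to `y`. -/
noncomputable def turnCount (T : IsTreeAdj adj) (pos : N → N → N → Bool) (x y : N) : ℤ :=
  exponentSum (pathWord T (fun _ => some false) pos x y)

theorem turnCount_swap (T : IsTreeAdj adj) (hp : IsLinkOrder adj pos) (x y : N) :
    turnCount T pos y x = - turnCount T pos x y := by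
  rw [turnCount, pathWord_swap T hp, exponentSum_invRev, turnCount]

theorem turnCount_add (T : IsTreeAdj adj) (hp : IsLinkOrder adj pos) (x y z : N) :
    turnCount T pos x y + turnCount T pos y z ≤ turnCount T pos x z + 1 := by
  obtain ⟨A, B, C, m, h1, h2, h3⟩ := T.exists_tripod x y z
  rw [turnCount, turnCount, turnCount, pathWord_eq T h1, pathWord_eq T h2, pathWord_eq T h3]
  set f := turnLetter (fun _ : N => some false) pos
  have hes : ∀ p q, exponentSum (f p m q) = if pos p m q then 1 else -1 := by
    intro p q
    simp [f, turnLetter, exponentSum]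
  have hm0 : exponentSum (turnList f [m]) = 0 := rfl
  have key : ∀ {A B : List N}, Reduced adj (A.reverse ++ m :: B) →
      exponentSum (turnList f (A.reverse ++ m :: B)) = - exponentSum (turnList f (m :: A)) +
        exponentSum (turnList f (m :: B)) +
        match A.head?, B.head? with
        | some a, some b => if pos a m b then 1 else -1
        | _, _ => 0 := by
    intro A B h
    rcases A with _ | ⟨a, A⟩
    · simp [exponentSum]
    · rcases B with _ | ⟨b, B⟩
      · rw [← List.reverse_cons, turnList_reverse T.symm hp, exponentSum_invRev]
        · rw [hm0]; simp [f]
        · have := h.reverse T.symm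
          simpa using this
      · rw [turnList_branches T.symm hp h, exponentSum_append, exponentSum_append,
          exponentSum_invRev, hes]
        simp only [List.head?_cons]
        ring
  rw [key h1.1, key h2.1, key h3.1]
  rcases A with _ | ⟨a, A⟩ <;> rcases B with _ | ⟨b, B⟩ <;> rcases C with _ | ⟨c, C⟩ <;>
    simp only [List.head?_nil, List.head?_cons] <;>
    try first | omega | (split_ifs <;> omega)
  have key2 : ∀ {a b : N} {A B : List N}, Reduced adj ((a :: A).reverse ++ m :: b :: B) →
      adj a m ∧ adj m b ∧ a ≠ b := by
    intro a b A B h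
    have e : (a :: A).reverse ++ m :: b :: B = A.reverse ++ a :: m :: b :: B := by simp
    rw [e] at h
    have h4 := (reduced_append.1 h).2
    exact ⟨h4.1, h4.2.2.1, h4.2.1 b (by simp)⟩
  obtain ⟨ha, hb, hab⟩ := key2 h1.1
  obtain ⟨-, hc, hbc⟩ := key2 h2.1
  obtain ⟨-, -, hac⟩ := key2 h3.1
  have h5 := hp.cyc a m b c ha hb hc hab hbc hac.symm
  have h6 := hp.anti a m c ha hc hac
  revert h5 h6
  cases pos a m b <;> cases pos b m c <;> cases pos c m a <;> cases pos a m c <;> simp <;> omega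

theorem turnCount_map (T : IsTreeAdj adj) {g : N → N} (hinj : Function.Injective g)
    (hadj : ∀ x y, adj x y → adj (g x) (g y)) (hpos : ∀ x m y, pos (g x) (g m) (g y) = pos x m y)
    (x y : N) : turnCount T pos (g x) (g y) = turnCount T pos x y := by
  rw [turnCount, pathWord_map T hinj hadj (fun _ => rfl) hpos, turnCount]

/-- Between nodes of the same class of a bipartite tree, the number of turns is odd. -/
theorem turnCount_ne_zero (T : IsTreeAdj adj) (par : N → Bool)
    (hpar : ∀ x y, adj x y → par x = !par y) {x y : N} (hxy : par x = par y) (hne : x ≠ y) :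
    turnCount T pos x y ≠ 0 := by
  obtain ⟨L, hL, h2, h3⟩ := T.exists_isPath x y
  rw [turnCount, pathWord_eq T ⟨hL, h2, h3⟩]
  have hlen : ∀ (l : List N) (x : N), (turnList (turnLetter (fun _ : N => some false) pos)
      (x :: l)).length = l.length - 1 := by
    intro l
    induction l with
    | nil => intro x; rfl
    | cons y l ih =>
      intro x
      rcases l with _ | ⟨z, l⟩
      · rfl
      · rw [turnList_cons, List.length_append, ih]
        simp only [turnLetter, List.length_cons, List.length_nil]
        omega
  have hodd : ∀ (l : List N) (x y : N), (x :: l).IsChain adj → (x :: l).getLast? = some y →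
      par y = (par x ^^ decide (l.length % 2 = 1)) := by
    intro l
    induction l with
    | nil => intro x y _ h; simp at h; simp [h]
    | cons z l ih =>
      intro x y h h'
      rw [List.isChain_cons_cons] at h
      rw [ih z y h.2 (by rwa [List.getLast?_cons_cons] at h'), hpar x z h.1, List.length_cons]
      rcases Nat.mod_two_eq_zero_or_one l.length with e | e <;> simp [Nat.add_mod, e]
  rcases L with _ | ⟨x', l⟩
  · simp at h2
  obtain rfl : x' = x := by simpa using h2
  have h4 := hodd l x' y hL.isChain h3
  rw [hxy] at h4
  have h5 : l.length % 2 = 0 := by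
    rcases Nat.mod_two_eq_zero_or_one l.length with e | e
    · exact e
    · rw [e] at h4; revert h4; cases par y <;> simp
  have h6 : l.length ≠ 0 := by
    intro e
    rw [List.length_eq_zero_iff] at e
    subst e
    simp at h3
    exact hne h3
  intro h0
  have h7 := exponentSum_emod_two
    (turnList (turnLetter (fun _ : N => some false) pos) (x' :: l))
  rw [h0, hlen] at h7
  omega

end Letters

/-! ### Oriented trees -/

/-- An oriented tree with vertices `P` and edges `Q`. Acyclicity is encoded by a potential: `pot p q`
increases by one across the edge `q` and is constant across all other edges. -/
structure OrientedTree (P Q : Type*) where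
  /-- The origin of an edge. -/
  src : Q → P
  /-- The end of an edge. -/
  tgt : Q → P
  /-- The side of the edge on which the vertex lies, up to a constant. -/
  pot : P → Q → ℤ
  pot_tgt_self : ∀ q, pot (tgt q) q = pot (src q) q + 1
  pot_tgt_of_ne : ∀ q q', q ≠ q' → pot (tgt q) q' = pot (src q) q'
  conn : ∀ p p', Relation.EqvGen (fun a b => ∃ q, src q = a ∧ tgt q = b) p p'

/-- The nodes of the barycentric subdivision of a tree, with a leaf attached to every vertex. -/
inductive TreeNode (P Q : Type*)
  | vert (p : P)
  | edge (q : Q)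
  | leaf (p : P)

namespace TreeNode

variable {P Q G : Type*} [Group G] [MulAction G P] [MulAction G Q]

instance : SMul G (TreeNode P Q) where
  smul g n := match n with
    | vert p => vert (g • p)
    | edge q => edge (g • q)
    | leaf p => leaf (g • p)

@[simp] theorem smul_vert (g : G) (p : P) : g • (vert p : TreeNode P Q) = vert (g • p) := rfl
@[simp] theorem smul_edge (g : G) (q : Q) : g • (edge q : TreeNode P Q) = edge (g • q) := rfl
@[simp] theorem smul_leaf (g : G) (p : P) : g • (leaf p : TreeNode P Q) = leaf (g • p) := rfl

instance : MulAction G (TreeNode P Q) where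
  one_smul n := by cases n <;> simp
  mul_smul g h n := by cases n <;> simp [mul_smul]

end TreeNode

namespace OrientedTree

open TreeNode

variable {P Q : Type*} (Γ : OrientedTree P Q)

/-- Adjacency in the subdivided tree with leaves. -/
def Adj : TreeNode P Q → TreeNode P Q → Prop
  | vert p, edge q => p = Γ.src q ∨ p = Γ.tgt q
  | edge q, vert p => p = Γ.src q ∨ p = Γ.tgt q
  | vert p, leaf p' => p = p'
  | leaf p', vert p => p = p'
  | _, _ => False

theorem adj_symm : ∀ x y, Γ.Adj x y → Γ.Adj y x := by
  rintro (_ | _ | _) (_ | _ | _) h <;> exact h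

@[simp] theorem adj_vert_edge {p : P} {q : Q} :
    Γ.Adj (vert p) (edge q) ↔ p = Γ.src q ∨ p = Γ.tgt q := Iff.rfl
@[simp] theorem adj_edge_vert {p : P} {q : Q} :
    Γ.Adj (edge q) (vert p) ↔ p = Γ.src q ∨ p = Γ.tgt q := Iff.rfl
@[simp] theorem adj_vert_leaf {p p' : P} : Γ.Adj (vert p) (leaf p') ↔ p = p' := Iff.rfl
@[simp] theorem adj_leaf_vert {p p' : P} : Γ.Adj (leaf p') (vert p) ↔ p = p' := Iff.rfl
@[simp] theorem not_adj_vert_vert {p p' : P} : ¬ Γ.Adj (vert p) (vert p') := id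
@[simp] theorem not_adj_edge_edge {q q' : Q} : ¬ Γ.Adj (edge q) (edge q') := id
@[simp] theorem not_adj_leaf_leaf {p p' : P} : ¬ Γ.Adj (leaf p) (leaf p') := id
@[simp] theorem not_adj_edge_leaf {p : P} {q : Q} : ¬ Γ.Adj (edge q) (leaf p) := id
@[simp] theorem not_adj_leaf_edge {p : P} {q : Q} : ¬ Γ.Adj (leaf p) (edge q) := id

theorem src_ne_tgt (q : Q) : Γ.src q ≠ Γ.tgt q := fun h => by
  have := Γ.pot_tgt_self q
  rw [h] at this
  omega

open Classical in
/-- The potential of the edge `q₀`, extended to all nodes; `c` is its value at the node of `q₀`. -/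
noncomputable def nodePot (q₀ : Q) (c : ℤ) : TreeNode P Q → ℤ
  | vert p => Γ.pot p q₀
  | leaf p => Γ.pot p q₀
  | edge q => if q = q₀ then c else Γ.pot (Γ.src q) q₀

/-- The potential is constant across all pairs of adjacent nodes that avoid the edge. -/
theorem nodePot_eq_of_adj {q₀ : Q} {c : ℤ} : ∀ {x y : TreeNode P Q}, Γ.Adj x y → x ≠ edge q₀ →
    y ≠ edge q₀ → Γ.nodePot q₀ c x = Γ.nodePot q₀ c y := by
  have key : ∀ {p : P} {q : Q}, Γ.Adj (vert p) (edge q) → edge q ≠ (edge q₀ : TreeNode P Q) →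
      Γ.nodePot q₀ c (vert p) = Γ.nodePot q₀ c (edge q) := by
    intro p q h hq
    have hq' : q ≠ q₀ := fun e => hq (by rw [e])
    simp only [nodePot, if_neg hq']
    rcases h with rfl | rfl
    · rfl
    · exact Γ.pot_tgt_of_ne q q₀ hq'
  rintro (p | q | p) (p' | q' | p') h hx hy
  · exact h.elim
  · exact key h hy
  · obtain rfl : p = p' := h; rfl
  · exact (key (Γ.adj_symm _ _ h) hx).symm
  · exact h.elim
  · exact h.elim
  · obtain rfl : p' = p := h; rfl
  · exact h.elim
  · exact h.elim

theorem isTreeAdj : IsTreeAdj Γ.Adj where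
  symm := Γ.adj_symm
  conn := by
    have hsymm : ∀ {x y}, Relation.ReflTransGen Γ.Adj x y → Relation.ReflTransGen Γ.Adj y x :=
      fun h => Relation.ReflTransGen.mono (fun _ _ h' => Γ.adj_symm _ _ h') _ _ h.swap
    have hvert : ∀ p p', Relation.ReflTransGen Γ.Adj (vert p) (vert p') := by
      intro p p'
      induction Γ.conn p p' with
      | rel a b h =>
        obtain ⟨q, rfl, rfl⟩ := h
        exact (Relation.ReflTransGen.single (b := edge q) (Or.inl rfl)).tail (Or.inr rfl)
      | refl => exact .refl
      | symm _ _ _ ih => exact hsymm ih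
      | trans _ _ _ _ _ h1 h2 => exact h1.trans h2
    have hto : ∀ x : TreeNode P Q, ∃ p, Relation.ReflTransGen Γ.Adj x (vert p) := by
      rintro (p | q | p)
      · exact ⟨p, .refl⟩
      · exact ⟨Γ.src q, .single (Or.inl rfl)⟩
      · exact ⟨p, .single rfl⟩
    intro x y
    obtain ⟨p, hp⟩ := hto x
    obtain ⟨p', hp'⟩ := hto y
    exact (hp.trans (hvert p p')).trans (hsymm hp')
  sep := by
    have key : ∀ p q, Γ.Adj (vert p) (edge q) → ∃ H : TreeNode P Q → ℤ,
        H (vert p) ≠ H (edge q) ∧ ∀ u v, Γ.Adj u v → H u ≠ H v →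
          (u = vert p ∧ v = edge q) ∨ (u = edge q ∧ v = vert p) := by
      intro p q h
      -- the node of `q` gets the potential of the endpoint of `q` other than `p`
      refine ⟨Γ.nodePot q (Γ.pot (Γ.src q) q + Γ.pot (Γ.tgt q) q - Γ.pot p q), ?_, ?_⟩
      · simp only [nodePot, if_true]
        have := Γ.pot_tgt_self q
        rcases h with rfl | rfl <;> omega
      · have aux : ∀ p', Γ.Adj (vert p') (edge q) →
            Γ.nodePot q (Γ.pot (Γ.src q) q + Γ.pot (Γ.tgt q) q - Γ.pot p q) (vert p') ≠
            Γ.nodePot q (Γ.pot (Γ.src q) q + Γ.pot (Γ.tgt q) q - Γ.pot p q) (edge q) → p' = p := by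
          intro p' h' hne
          simp only [nodePot, if_true] at hne
          rcases h with rfl | rfl <;> rcases h' with rfl | rfl
          · rfl
          · exact absurd (by omega) hne
          · exact absurd (by omega) hne
          · rfl
        intro u v huv hne
        by_cases hu : u = edge q
        · subst hu
          rcases v with p' | q' | p'
          · right
            exact ⟨rfl, by rw [aux p' (Γ.adj_symm _ _ huv) hne.symm]⟩
          · exact huv.elim
          · exact huv.elim
        · by_cases hv : v = edge q
          · subst hv
            rcases u with p' | q' | p'
            · left
              exact ⟨by rw [aux p' huv hne], rfl⟩
            · exact huv.elim
            · exact huv.elim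
          · exact absurd (Γ.nodePot_eq_of_adj huv hu hv) hne
    have keyleaf : ∀ p, ∃ H : TreeNode P Q → ℤ,
        H (vert p) ≠ H (leaf p) ∧ ∀ u v, Γ.Adj u v → H u ≠ H v →
          (u = vert p ∧ v = leaf p) ∨ (u = leaf p ∧ v = vert p) := by
      classical
      intro p
      refine ⟨fun x => if x = leaf p then 1 else 0, by simp, ?_⟩
      intro u v huv hne
      by_cases hu : u = leaf p
      · subst hu
        rcases v with p' | q' | p'
        · right; exact ⟨rfl, by rw [show p' = p from huv]⟩
        · exact huv.elim
        · exact huv.elim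
      · by_cases hv : v = leaf p
        · subst hv
          rcases u with p' | q' | p'
          · left; exact ⟨by rw [show p' = p from huv], rfl⟩
          · exact huv.elim
          · exact huv.elim
        · simp [hu, hv] at hne
    have hswap : ∀ x y, (∃ H : TreeNode P Q → ℤ, H x ≠ H y ∧ ∀ u v, Γ.Adj u v → H u ≠ H v →
        (u = x ∧ v = y) ∨ (u = y ∧ v = x)) → ∃ H : TreeNode P Q → ℤ, H y ≠ H x ∧
        ∀ u v, Γ.Adj u v → H u ≠ H v → (u = y ∧ v = x) ∨ (u = x ∧ v = y) := by
      rintro x y ⟨H, h1, h2⟩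
      exact ⟨H, h1.symm, fun u v h h' => (h2 u v h h').symm⟩
    rintro (p | q | p) (p' | q' | p') h
    · exact h.elim
    · exact key p q' h
    · obtain rfl : p = p' := h; exact keyleaf p
    · exact hswap _ _ (key p' q (Γ.adj_symm _ _ h))
    · exact h.elim
    · exact h.elim
    · obtain rfl : p' = p := h; exact hswap _ _ (keyleaf p')
    · exact h.elim
    · exact h.elim

/-- A path that avoids an edge has constant potential for this edge. -/
theorem nodePot_eq_of_isChain {q₀ : Q} {c : ℤ} {l : List (TreeNode P Q)} :
    ∀ {x y : TreeNode P Q}, (x :: l).IsChain Γ.Adj → (x :: l).getLast? = some y →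
      edge q₀ ∉ x :: l → Γ.nodePot q₀ c x = Γ.nodePot q₀ c y := by
  induction l with
  | nil =>
    intro x y _ h _
    simp at h
    rw [h]
  | cons z l ih =>
    intro x y h h' hn
    rw [List.isChain_cons_cons] at h
    rw [List.getLast?_cons_cons] at h'
    simp only [List.mem_cons, not_or] at hn
    rw [← ih h.2 h' (by simpa using hn.2)]
    exact Γ.nodePot_eq_of_adj h.1 (Ne.symm hn.1) (Ne.symm hn.2.1)

/-- A total order on the edges at each vertex. -/
structure IsVertexOrder (lt : P → Q → Q → Prop) : Prop where
  asymm : ∀ p q q', (p = Γ.src q ∨ p = Γ.tgt q) → (p = Γ.src q' ∨ p = Γ.tgt q') → q ≠ q' →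
    (lt p q q' ↔ ¬ lt p q' q)
  trans : ∀ p q q' q'', (p = Γ.src q ∨ p = Γ.tgt q) → (p = Γ.src q' ∨ p = Γ.tgt q') →
    (p = Γ.src q'' ∨ p = Γ.tgt q'') → lt p q q' → lt p q' q'' → lt p q q''

open Classical in
/-- The order on the links of the subdivided tree: at a vertex, the leaf comes first, then the edges
in the given order; at an edge, the origin comes before the end. -/
noncomputable def linkPos (lt : P → Q → Q → Prop) :
    TreeNode P Q → TreeNode P Q → TreeNode P Q → Bool
  | leaf _, vert _, edge _ => true
  | edge q, vert p, edge q' => decide (lt p q q')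
  | vert p, edge q, vert _ => decide (p = Γ.src q)
  | _, _, _ => false

variable {Γ} in
theorem IsVertexOrder.isLinkOrder {lt : P → Q → Q → Prop} (h : Γ.IsVertexOrder lt) :
    IsLinkOrder Γ.Adj (Γ.linkPos lt) where
  anti := by
    rintro (p | q | p) (p' | q' | p') (p'' | q'' | p'') h1 h2 h3 <;>
      simp only [adj_vert_edge, adj_edge_vert, adj_vert_leaf, adj_leaf_vert, not_adj_vert_vert,
        not_adj_edge_edge, not_adj_leaf_leaf, not_adj_edge_leaf, not_adj_leaf_edge] at h1 h2
    · -- two vertices at an edge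
      have hs := Γ.src_ne_tgt q'
      simp only [linkPos]
      rcases h1 with rfl | rfl <;> rcases h2 with rfl | rfl
      · exact absurd rfl h3
      · simp [hs.symm]
      · simp [hs.symm]
      · exact absurd rfl h3
    · subst h1 h2; exact absurd rfl h3
    · have := h.asymm p' q q'' h1 h2 (fun e => h3 (by rw [e]))
      simp only [linkPos]
      by_cases hlt : lt p' q'' q <;> simp [this, hlt]
    · rfl
    · rfl
    · subst h1 h2; exact absurd rfl h3
  cyc := by
    classical
    have key : ∀ {p : P} {q q' q'' : Q}, (p = Γ.src q ∨ p = Γ.tgt q) →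
        (p = Γ.src q' ∨ p = Γ.tgt q') → (p = Γ.src q'' ∨ p = Γ.tgt q'') → q ≠ q' → q' ≠ q'' →
        q'' ≠ q → ¬ (decide (lt p q q') = decide (lt p q' q'') ∧
          decide (lt p q' q'') = decide (lt p q'' q)) := by
      rintro p q q' q'' h1 h2 h3 n1 n2 n3 ⟨e1, e2⟩
      have a1 := h.asymm p q q' h1 h2 n1
      have a2 := h.asymm p q' q'' h2 h3 n2
      have a3 := h.asymm p q'' q h3 h1 n3
      have t1 := h.trans p q q' q'' h1 h2 h3
      have t2 := h.trans p q'' q' q h3 h2 h1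
      rw [decide_eq_decide] at e1 e2
      by_cases ha : lt p q q'
      · exact a3.1 (e2.1 (e1.1 ha)) (t1 ha (e1.1 ha))
      · have hc : ¬ lt p q'' q := fun hc => ha (e1.2 (e2.2 hc))
        exact hc (t2 (not_not.1 (a2.not.1 fun hb => ha (e1.2 hb))) (not_not.1 (a1.not.1 ha)))
    have two : ∀ {p p' p'' : P} {q : Q}, (p = Γ.src q ∨ p = Γ.tgt q) →
        (p' = Γ.src q ∨ p' = Γ.tgt q) → (p'' = Γ.src q ∨ p'' = Γ.tgt q) → p ≠ p' → p' ≠ p'' →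
        p'' ≠ p → False := by
      intro p p' p'' q h1 h2 h3 n1 n2 n3
      rcases h1 with h1 | h1 <;> rcases h2 with h2 | h2 <;> rcases h3 with h3 | h3 <;>
        first
          | exact n1 (h1.trans h2.symm)
          | exact n2 (h2.trans h3.symm)
          | exact n3 (h3.trans h1.symm)
    intro x m y z h1 h2 h3 n1 n2 n3
    rcases m with p | q | p
    · rcases x with a | a | a
      · exact h1.elim
      · rcases y with b | b | b
        · exact h2.elim
        · rcases z with c | c | c
          · exact h3.elim
          · exact key h1 h2 h3 (fun e => n1 (by rw [e])) (fun e => n2 (by rw [e]))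
              (fun e => n3 (by rw [e]))
          · simp [linkPos]
        · rcases z with c | c | c
          · exact h3.elim
          · simp [linkPos]
          · exact absurd (by rw [← show p = b from h2, show p = c from h3]) n2
      · rcases y with b | b | b
        · exact h2.elim
        · rcases z with c | c | c
          · exact h3.elim
          · simp [linkPos]
          · exact absurd (by rw [← show p = a from h1, show p = c from h3]) n3
        · exact absurd (by rw [← show p = b from h2, show p = a from h1]) n1
    · rcases x with a | a | a
      · rcases y with b | b | b
        · rcases z with c | c | c
          · exact (two h1 h2 h3 (fun e => n1 (by rw [e])) (fun e => n2 (by rw [e]))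
              (fun e => n3 (by rw [e]))).elim
          · exact h3.elim
          · exact h3.elim
        · exact h2.elim
        · exact h2.elim
      · exact h1.elim
      · exact h1.elim
    · rcases x with a | a | a
      · rcases y with b | b | b
        · exact absurd (by rw [show a = p from h1, show b = p from h2]) n1
        · exact h2.elim
        · exact h2.elim
      · exact h1.elim
      · exact h1.elim

/-- Equivariance of the incidence maps. -/
structure IsEquivariant (G : Type*) [Group G] [MulAction G P] [MulAction G Q] : Prop where
  src_smul : ∀ (g : G) q, Γ.src (g • q) = g • Γ.src q
  tgt_smul : ∀ (g : G) q, Γ.tgt (g • q) = g • Γ.tgt q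

section Action

variable {Γ} {G : Type*} [Group G] [MulAction G P] [MulAction G Q]

theorem IsEquivariant.adj_smul (hΓ : Γ.IsEquivariant G) (g : G) :
    ∀ x y, Γ.Adj x y → Γ.Adj (g • x) (g • y) := by
  rintro (p | q | p) (p' | q' | p') h <;>
    simp only [adj_vert_edge, adj_edge_vert, adj_vert_leaf, adj_leaf_vert, not_adj_vert_vert,
        not_adj_edge_edge, not_adj_leaf_leaf, not_adj_edge_leaf, not_adj_leaf_edge, smul_vert,
        smul_edge, smul_leaf, hΓ.src_smul, hΓ.tgt_smul, smul_left_cancel_iff] at h ⊢ <;> exact h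

theorem IsEquivariant.linkPos_smul (hΓ : Γ.IsEquivariant G) {lt : P → Q → Q → Prop}
    (hlt : ∀ (g : G) p q q', lt (g • p) (g • q) (g • q') ↔ lt p q q') (g : G) (x m y) :
    Γ.linkPos lt (g • x) (g • m) (g • y) = Γ.linkPos lt x m y := by
  rcases x with p | q | p <;> rcases m with p' | q' | p' <;> rcases y with p'' | q'' | p'' <;>
    simp [linkPos, hΓ.src_smul, hlt]

/-- For a group acting on an oriented tree with invariant orders on the edges at each vertex, there
is an invariant total order on all edges: `q` comes before `q'` if the path from `q` to `q'` has
more positive than negative turns. This number is odd, and it is additive up to an error of `1`. -/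
theorem IsEquivariant.exists_edgeOrder (hΓ : Γ.IsEquivariant G) {lt : P → Q → Q → Prop}
    (h : Γ.IsVertexOrder lt)
    (hlt : ∀ (g : G) p q q', lt (g • p) (g • q) (g • q') ↔ lt p q q') :
    ∃ r : Q → Q → Prop, IsStrictTotalOrder Q r ∧ ∀ (g : G) q q', r (g • q) (g • q') ↔ r q q' := by
  have hp := h.isLinkOrder
  let c : Q → Q → ℤ := fun q q' => turnCount Γ.isTreeAdj (Γ.linkPos lt) (edge q) (edge q')
  have hswap : ∀ q q', c q' q = - c q q' := fun q q' => turnCount_swap _ hp _ _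
  have hadd : ∀ q q' q'', c q q' + c q' q'' ≤ c q q'' + 1 :=
    fun q q' q'' => turnCount_add _ hp _ _ _
  have hne : ∀ q q', q ≠ q' → c q q' ≠ 0 := by
    intro q q' hqq'
    refine turnCount_ne_zero _ (fun n => match n with | vert _ => true | _ => false) ?_ rfl
      (fun e => hqq' (by injection e))
    rintro (p | q | p) (p' | q' | p') h <;> first | rfl | exact h.elim
  refine ⟨fun q q' => 0 < c q q', { trichotomous := ?_, irrefl := ?_, trans := ?_ }, ?_⟩
  · intro q q' h1 h2
    by_contra hqq'
    have := hswap q q'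
    have := hne q q' hqq'
    omega
  · intro q
    have := hswap q q
    omega
  · intro q q' q'' h1 h2
    have := hadd q q' q''
    omega
  · intro g q q'
    have : c (g • q) (g • q') = c q q' :=
      turnCount_map Γ.isTreeAdj (g := fun n : TreeNode P Q => g • n) (MulAction.injective g)
        (hΓ.adj_smul g) (hΓ.linkPos_smul hlt g) (edge q) (edge q')
    simp only [this]

end Action

end OrientedTree

/-! ### Powers of an element translating along an axis -/

section Axis

variable {N : Type*} {adj : N → N → Prop} {color : N → Option Bool} {pos : N → N → N → Bool}
variable {G : Type*} [Group G] [MulAction G N]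

/-- A path that is continued by its own translate under `g` is continued by all its translates; the
letters of the resulting path are periodic. -/
theorem exists_periodic_path {α : Type*} {f : N → N → N → List α}
    (hadj : ∀ (g : G) x y, adj x y → adj (g • x) (g • y))
    (hf : ∀ (g : G) x m y, f (g • x) (g • m) (g • y) = f x m y)
    {g : G} {x y : N} {D A B : List N} (hD : Reduced adj (x :: y :: D ++ [g • x, g • y]))
    (hA : Reduced adj (A ++ [x, y])) (hB : Reduced adj (x :: y :: B)) (n : ℕ) :
    ∃ L, Reduced adj L ∧ L.head? = (A ++ [x]).head? ∧
      L.getLast? = ((x :: y :: B).map fun z => g ^ n • z).getLast? ∧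
      turnList f L = turnList f (A ++ [x, y]) ++
        (List.replicate n (turnList f (x :: y :: D ++ [g • x, g • y]))).flatten ++
        turnList f (x :: y :: B) := by
  have hmap : ∀ (g : G) {L : List N}, Reduced adj L → Reduced adj (L.map fun z => g • z) :=
    fun g L h => h.map (MulAction.injective g) (hadj g)
  have key : ∀ n : ℕ, ∃ E, Reduced adj (A ++ E ++ [g ^ n • x, g ^ n • y]) ∧
      (A ++ E ++ [g ^ n • x]).head? = (A ++ [x]).head? ∧
      turnList f (A ++ E ++ [g ^ n • x, g ^ n • y]) = turnList f (A ++ [x, y]) ++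
        (List.replicate n (turnList f (x :: y :: D ++ [g • x, g • y]))).flatten := by
    intro n
    induction n with
    | zero => exact ⟨[], by simpa using hA, by simp, by simp⟩
    | succ n ih =>
      obtain ⟨E, h1, h2, h3⟩ := ih
      have h4 := hmap (g ^ n) hD
      have h5 : (x :: y :: D ++ [g • x, g • y]).map (fun z => g ^ n • z) =
          g ^ n • x :: g ^ n • y :: (D.map (fun z => g ^ n • z) ++
            [g ^ (n + 1) • x, g ^ (n + 1) • y]) := by
        simp [smul_smul, pow_succ]
      rw [h5] at h4
      have h6 := turnList_map (f := f) (g := fun z => g ^ n • z) (hf (g ^ n))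
        (x :: y :: D ++ [g • x, g • y])
      rw [h5] at h6
      have e : A ++ (E ++ (g ^ n • x :: g ^ n • y :: D.map (fun z => g ^ n • z))) ++
          [g ^ (n + 1) • x, g ^ (n + 1) • y] = (A ++ E) ++ g ^ n • x :: g ^ n • y ::
            (D.map (fun z => g ^ n • z) ++ [g ^ (n + 1) • x, g ^ (n + 1) • y]) := by simp
      refine ⟨E ++ (g ^ n • x :: g ^ n • y :: D.map fun z => g ^ n • z), ?_, ?_, ?_⟩
      · rw [e, reduced_append]
        exact ⟨h1, h4⟩
      · rw [← h2]
        cases A <;> cases E <;> simp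
      · rw [e, turnList_append, h3, h6, List.replicate_succ', List.flatten_append]
        simp
  obtain ⟨E, h1, h2, h3⟩ := key n
  have h4 := hmap (g ^ n) hB
  have h6 := turnList_map (f := f) (g := fun z => g ^ n • z) (hf (g ^ n)) (x :: y :: B)
  simp only [List.map_cons] at h4 h6 ⊢
  refine ⟨A ++ E ++ g ^ n • x :: g ^ n • y :: B.map fun z => g ^ n • z, ?_, ?_, ?_, ?_⟩
  · rw [reduced_append]; exact ⟨h1, h4⟩
  · rw [← h2]
    cases A <;> cases E <;> simp
  · rw [List.getLast?_append_cons]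
  · rw [turnList_append, h3, h6]

/-- An element with an axis in a tree with alternating coloring, such that the axis and the orbit of
`o` are joined by paths without backtracking, is detected by a homogeneous quasimorphism. -/
theorem exists_homogeneous_of_axis (T : IsTreeAdj adj) (hp : IsLinkOrder adj pos)
    (hc : IsAlternatingColoring adj color)
    (hadj : ∀ (g : G) x y, adj x y → adj (g • x) (g • y))
    (hcol : ∀ (g : G) x, color (g • x) = color x)
    (hpos : ∀ (g : G) x m y, pos (g • x) (g • m) (g • y) = pos x m y) {o : N}
    (ho : color o = none)
    {g : G} {x y : N} {D A B : List N} (hD : Reduced adj (x :: y :: D ++ [g • x, g • y]))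
    (hA : Reduced adj (A ++ [x, y])) (hB : Reduced adj (x :: y :: B)) {c : Bool}
    (hy : color y = some c) (hAo : (A ++ [x]).head? = some o)
    (hBo : (x :: y :: B).getLast? = some (g • o)) {Φ : G → FreeGroup Bool}
    (hΦ : Φ = fun g => FreeGroup.mk (pathWord T color pos o (g • o))) :
    ∃ φ : G → ℝ, IsHomogeneousQuasimorphism φ ∧ 1 ≤ φ g ∧ defect φ ≤ 1 ∧ 1 / 2 ≤ scl g ∧
      ∃ (b : FreeGroup Bool) (rot : FreeGroup Bool → ℝ),
        IsAlternating b ∧ Even b.toWord.length ∧ 0 < b.toWord.length ∧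
        IsCircleQuasimorphism b rot ∧
        ∀ h : G, Tendsto (fun n : ℕ => rot (Φ (h ^ n)) / (n * b.toWord.length)) atTop
          (𝓝 (φ h)) := by
  have hf : ∀ (g : G) x m y, turnLetter color pos (g • x) (g • m) (g • y) =
      turnLetter color pos x m y := fun g x m y => by simp only [turnLetter, hcol, hpos]
  have hper := exists_periodic_path hadj hf hD hA hB
  have hΦq : IsLetterQuasimorphism Φ := by
    rw [hΦ]; exact isLetterQuasimorphism_pathWord T hp hc hadj hcol hpos ho
  refine hΦq.exists_homogeneous g (p := turnList (turnLetter color pos) (A ++ [x, y]))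
    (w := turnList (turnLetter color pos) (x :: y :: D ++ [g • x, g • y]))
    (s := turnList (turnLetter color pos) (x :: y :: B)) ?_ ?_ ?_
  · rcases D with _ | ⟨z, D⟩
    · simp [turnList_cons, turnLetter_some hy]
    · simp [turnList_cons, turnLetter_some hy]
  · obtain ⟨L, h1, -, -, h4⟩ := hper 2
    have h5 := isChain_turnList (pos := pos) hc h1
    rw [h4] at h5
    have h6 := h5.left_of_append.right_of_append
    simpa [List.replicate_succ] using h6
  · intro n
    obtain ⟨L, h1, h2, h3, h4⟩ := hper n
    have hL : IsPath adj o (g ^ (n + 1) • o) L := by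
      refine ⟨h1, by rw [h2, hAo], ?_⟩
      rw [h3, List.getLast?_map, hBo, pow_succ, mul_smul]
      rfl
    rw [hΦ]
    simp only
    rw [toWord_mk_of_isChain (pathWord_isChain T hc _ _), pathWord_eq T hL, h4]

end Axis

/-! ### Orders on cosets -/

theorem FreeGroup.mk_singleton (c ε : Bool) :
    FreeGroup.mk [(c, ε)] = FreeGroup.of c ^ (if ε then (1 : ℤ) else -1) := by
  cases ε
  · simp [FreeGroup.of, FreeGroup.inv_mk, FreeGroup.invRev]
  · simp [FreeGroup.of]

/-- An invariant total order on a set with an action induces one on the cosets of a stabilizer. -/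
theorem exists_cosetOrder {G Q : Type*} [Group G] [MulAction G Q] {H : Subgroup G} {q₀ : Q}
    (hH : ∀ g : G, g ∈ H ↔ g • q₀ = q₀) {r : Q → Q → Prop} (hr : IsStrictTotalOrder Q r)
    (hinv : ∀ (g : G) q q', r (g • q) (g • q') ↔ r q q') :
    ∃ r' : G ⧸ H → G ⧸ H → Prop, IsInvariantCosetOrder H r' ∧
      (∀ g : G, r' ((1 : G) : G ⧸ H) (g : G ⧸ H) ↔ r q₀ (g • q₀)) ∧
      ∀ g : G, g ∉ H → ∀ [Decidable (r q₀ (g • q₀))],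
        cosetSign r' g = if decide (r q₀ (g • q₀)) then 1 else -1 := by
  have hwd : ∀ a b : G, a⁻¹ * b ∈ H ↔ a • q₀ = b • q₀ := by
    intro a b
    rw [hH, mul_smul, inv_smul_eq_iff, eq_comm]
  let F : G ⧸ H → Q := Quotient.lift (fun g : G => g • q₀) fun a b h =>
    (hwd a b).1 (QuotientGroup.leftRel_apply.1 h)
  have hF : ∀ g : G, F (g : G ⧸ H) = g • q₀ := fun g => rfl
  have hFinj : Function.Injective F := by
    intro a b
    induction a using QuotientGroup.induction_on with | _ a => ?_
    induction b using QuotientGroup.induction_on with | _ b => ?_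
    intro h
    exact QuotientGroup.eq.2 ((hwd a b).2 h)
  have htri := hr.trichotomous
  have hirr := hr.irrefl
  have htrans := hr.trans
  have e : ∀ g : G, r (F ((1 : G) : G ⧸ H)) (F (g : G ⧸ H)) ↔ r q₀ (g • q₀) := by
    intro g; rw [hF, hF, one_smul]
  refine ⟨fun a b => r (F a) (F b), ⟨{ trichotomous := ?_, irrefl := ?_, trans := ?_ }, ?_⟩, e, ?_⟩
  · intro a b h1 h2
    exact hFinj (htri _ _ h1 h2)
  · exact fun a => hirr _
  · exact fun a b c => htrans _ _ _
  · intro g a b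
    induction a using QuotientGroup.induction_on with | _ a => ?_
    induction b using QuotientGroup.induction_on with | _ b => ?_
    intro h
    have h' := (hinv g _ _).2 h
    rw [hF, hF] at h'
    change r (F ((g * a : G) : G ⧸ H)) (F ((g * b : G) : G ⧸ H))
    rw [hF, hF, mul_smul, mul_smul]
    exact h'
  · intro g hg _
    unfold cosetSign
    by_cases h : r q₀ (g • q₀)
    · rw [if_pos ((e g).2 h)]; simp [h]
    · rw [if_neg (fun h' => h ((e g).1 h')), if_pos]
      · simp [h]
      · by_contra h2
        simp only [hF, one_smul] at h2
        exact hg ((hH g).2 (htri _ _ h2 h))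

/-! ### Amalgams -/

namespace OrientedTree

open TreeNode

variable {P Q : Type*} {Γ : OrientedTree P Q} {G : Type*} [Group G] [MulAction G P]

theorem IsVertexOrder.of_total {r : Q → Q → Prop} (hr : IsStrictTotalOrder Q r) :
    Γ.IsVertexOrder fun _ => r where
  asymm _ q q' _ _ hne := by
    constructor
    · intro h h'
      exact hr.irrefl _ (hr.trans _ _ _ h h')
    · intro h
      by_contra h'
      exact hne (hr.trichotomous _ _ h' h)
  trans _ _ _ _ _ _ _ := hr.trans _ _ _

open Classical in
/-- The colours for an amalgam: the vertices in the orbit of the origin of `q₀` have colour `false`,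
all other vertices have colour `true`, and edges and leaves are uncoloured. -/
noncomputable def amalgamColor (Γ : OrientedTree P Q) (G : Type*) [Group G] [MulAction G P]
    (q₀ : Q) : TreeNode P Q → Option Bool
  | vert p => some (decide (¬ ∃ h : G, p = h • Γ.src q₀))
  | _ => none

/-- The endpoints of `q₀`, indexed like the factors of the amalgam. -/
def endpoint (Γ : OrientedTree P Q) (q₀ : Q) (i : Bool) : P := cond i (Γ.tgt q₀) (Γ.src q₀)

variable {q₀ : Q}

theorem amalgamColor_vert (hno : ∀ h : G, h • Γ.src q₀ ≠ Γ.tgt q₀) (x : G) (i : Bool) :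
    Γ.amalgamColor G q₀ (vert (x • Γ.endpoint q₀ i)) = some i := by
  cases i
  · simp only [amalgamColor, endpoint, cond_false, Option.some.injEq]
    exact @decide_eq_false _ (_) (not_not.2 ⟨x, rfl⟩)
  · simp only [amalgamColor, endpoint, cond_true, Option.some.injEq]
    refine @decide_eq_true _ (_) ?_
    rintro ⟨h, e⟩
    exact hno (x⁻¹ * h) (by rw [mul_smul, ← e, inv_smul_smul])

variable [MulAction G Q]

theorem adj_endpoint (hΓ : Γ.IsEquivariant G) (x : G) (i : Bool) :
    Γ.Adj (edge (x • q₀)) (vert (x • Γ.endpoint q₀ i)) := by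
  cases i
  · exact Or.inl (hΓ.src_smul x q₀).symm
  · exact Or.inr (hΓ.tgt_smul x q₀).symm

theorem isAlternatingColoring_amalgam (hΓ : Γ.IsEquivariant G)
    (htrans : ∀ q, ∃ g : G, q = g • q₀) (hno : ∀ h : G, h • Γ.src q₀ ≠ Γ.tgt q₀) :
    IsAlternatingColoring Γ.Adj (Γ.amalgamColor G q₀) where
  ne_of_adj := by
    rintro (p | q | p) (p' | q' | p') c d h h1 h2
    · exact h.elim
    all_goals simp [amalgamColor] at h1 h2
  of_none := by
    rintro (p | q | p) (p' | q' | p') (p'' | q'' | p'') h1 h2 hne hm <;>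
      first
        | exact h1.elim
        | exact h2.elim
        | (refine absurd hm ?_; simp only [amalgamColor]; exact Option.some_ne_none _)
        | skip
    · obtain ⟨g, rfl⟩ := htrans q'
      have hs := amalgamColor_vert hno g false
      have ht := amalgamColor_vert hno g true
      simp only [endpoint, cond_false, cond_true] at hs ht
      rw [adj_vert_edge, hΓ.src_smul, hΓ.tgt_smul] at h1
      rw [adj_edge_vert, hΓ.src_smul, hΓ.tgt_smul] at h2
      rcases h1 with rfl | rfl <;> rcases h2 with rfl | rfl
      · exact absurd rfl hne
      · exact ⟨false, hs, ht⟩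
      · exact ⟨true, ht, hs⟩
      · exact absurd rfl hne
    · obtain rfl : p = p' := h1
      obtain rfl : p'' = p := h2
      exact absurd rfl hne

/-- The path of a product of elements taken alternately from the stabilizers of the two endpoints. -/
def amalgamPath (Γ : OrientedTree P Q) (q₀ : Q) (x : G) :
    List (Σ i, MulAction.stabilizer G (Γ.endpoint q₀ i)) → List (TreeNode P Q)
  | [] => [edge (x • q₀)]
  | p :: L => edge (x • q₀) :: vert (x • Γ.endpoint q₀ p.1) :: amalgamPath Γ q₀ (x * p.2) L

open Classical in
/-- The path of an alternating product does not backtrack, and its letters are the signs of the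
factors. -/
theorem amalgamPath_spec (hΓ : Γ.IsEquivariant G) (hno : ∀ h : G, h • Γ.src q₀ ≠ Γ.tgt q₀)
    {r : Q → Q → Prop} (hinv : ∀ (g : G) q q', r (g • q) (g • q') ↔ r q q')
    (L : List (Σ i, MulAction.stabilizer G (Γ.endpoint q₀ i))) :
    L.IsChain (fun p q => p.1 ≠ q.1) → (∀ p ∈ L, (p.2 : G) ∉ MulAction.stabilizer G q₀) →
    ∀ x : G, IsPath Γ.Adj (edge (x • q₀)) (edge ((x * (L.map fun p => (p.2 : G)).prod) • q₀))
      (amalgamPath Γ q₀ x L) ∧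
      turnList (turnLetter (Γ.amalgamColor G q₀) (Γ.linkPos fun _ => r)) (amalgamPath Γ q₀ x L) =
        L.map fun p => (p.1, decide (r q₀ ((p.2 : G) • q₀))) := by
  induction L with
  | nil => intro _ _ x; exact ⟨⟨trivial, rfl, by simp [amalgamPath]⟩, rfl⟩
  | cons p L ih =>
    intro hch hC x
    obtain ⟨h1, h2⟩ := ih hch.tail (fun q hq => hC q (List.mem_cons_of_mem _ hq)) (x * p.2)
    have hpC := hC p List.mem_cons_self
    rw [MulAction.mem_stabilizer_iff] at hpC
    have hpS : (p.2 : G) • Γ.endpoint q₀ p.1 = Γ.endpoint q₀ p.1 := p.2.2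
    have hpS' : (x * p.2) • Γ.endpoint q₀ p.1 = x • Γ.endpoint q₀ p.1 := by
      rw [mul_smul, hpS]
    have hne : (edge (x • q₀) : TreeNode P Q) ≠ edge ((x * (p.2 : G)) • q₀) := by
      intro e
      rw [mul_smul] at e
      injection e with e
      exact hpC (smul_left_cancel x e).symm
    have hadj2 := adj_endpoint (q₀ := q₀) hΓ (x * p.2) p.1
    rw [hpS'] at hadj2
    have hlet : turnLetter (Γ.amalgamColor G q₀) (Γ.linkPos fun _ => r) (edge (x • q₀))
        (vert (x • Γ.endpoint q₀ p.1)) (edge ((x * (p.2 : G)) • q₀)) =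
        [(p.1, decide (r q₀ ((p.2 : G) • q₀)))] := by
      rw [turnLetter_some (amalgamColor_vert hno x p.1)]
      simp only [linkPos, mul_smul, hinv]
    have hlast : (amalgamPath Γ q₀ x (p :: L)).getLast? =
        some (edge ((x * ((p :: L).map fun p => (p.2 : G)).prod) • q₀)) := by
      rw [List.map_cons, List.prod_cons, ← mul_assoc, ← h1.2.2]
      rw [amalgamPath]
      cases L <;> simp [amalgamPath]
    rcases L with _ | ⟨p', L⟩
    · refine ⟨⟨?_, rfl, hlast⟩, ?_⟩
      · rw [amalgamPath, amalgamPath, reduced_triple]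
        exact ⟨adj_endpoint hΓ x p.1, hne, Γ.adj_symm _ _ hadj2⟩
      · rw [amalgamPath, amalgamPath, turnList_cons, hlet]
        simp
    · have hpp : p.1 ≠ p'.1 := (List.isChain_cons_cons.1 hch).1
      have hne2 : Γ.endpoint q₀ p.1 ≠ Γ.endpoint q₀ p'.1 := by
        intro e
        have a := amalgamColor_vert hno (1 : G) p.1
        rw [e, amalgamColor_vert hno (1 : G) p'.1] at a
        exact hpp (Option.some.inj a).symm
      refine ⟨⟨?_, rfl, hlast⟩, ?_⟩
      · have h3 := h1.1
        rw [amalgamPath] at h3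
        rw [amalgamPath, amalgamPath, reduced_cons_cons, reduced_cons_cons]
        refine ⟨adj_endpoint hΓ x p.1, by simpa using hne, Γ.adj_symm _ _ hadj2, ?_, h3⟩
        intro z hz
        simp only [List.head?_cons, Option.mem_def, Option.some.injEq] at hz
        rw [← hz, ← hpS']
        intro e
        injection e with e
        exact hne2 (smul_left_cancel _ e)
      · rw [amalgamPath] at h2
        rw [amalgamPath, amalgamPath, turnList_cons, hlet]
        have h4 : turnList (turnLetter (Γ.amalgamColor G q₀) (Γ.linkPos fun _ => r))
            (vert (x • Γ.endpoint q₀ p.1) :: edge ((x * (p.2 : G)) • q₀) ::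
              vert ((x * (p.2 : G)) • Γ.endpoint q₀ p'.1) ::
              amalgamPath Γ q₀ (x * p.2 * p'.2) L) =
            turnList (turnLetter (Γ.amalgamColor G q₀) (Γ.linkPos fun _ => r))
              (edge ((x * (p.2 : G)) • q₀) ::
              vert ((x * (p.2 : G)) • Γ.endpoint q₀ p'.1) ::
              amalgamPath Γ q₀ (x * p.2 * p'.2) L) := by
          rw [turnList_cons, turnLetter_none rfl, List.nil_append]
        rw [h4, h2]
        simp

/-- If the endpoints of `q₀` lie in different orbits, and all edges in the orbit of `q₀`, the group
is the amalgam of the stabilizers of the endpoints. -/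
theorem bijective_pushout_lift (hΓ : Γ.IsEquivariant G)
    (htrans : ∀ q, ∃ g : G, q = g • q₀) (hno : ∀ h : G, h • Γ.src q₀ ≠ Γ.tgt q₀)
    (hC : ∀ i, MulAction.stabilizer G q₀ ≤ MulAction.stabilizer G (Γ.endpoint q₀ i))
    (hf : ∀ i, ((MulAction.stabilizer G (Γ.endpoint q₀ i)).subtype).comp
      (Subgroup.inclusion (hC i)) = (MulAction.stabilizer G q₀).subtype) :
    Function.Bijective
      (Monoid.PushoutI.lift (φ := fun i => Subgroup.inclusion (hC i))
        (fun i => (MulAction.stabilizer G (Γ.endpoint q₀ i)).subtype)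
        (MulAction.stabilizer G q₀).subtype hf) := by
  classical
  constructor
  · rw [injective_iff_map_eq_one]
    intro x hx
    obtain ⟨d⟩ := Monoid.PushoutI.NormalWord.transversal_nonempty
      (fun i => Subgroup.inclusion (hC i)) (fun i => Subgroup.inclusion_injective (hC i))
    obtain ⟨w, rfl⟩ : ∃ w : Monoid.PushoutI.NormalWord d, w.prod = x :=
      ⟨_, Monoid.PushoutI.NormalWord.equiv.symm_apply_apply x⟩
    have hprod : Monoid.PushoutI.lift (φ := fun i => Subgroup.inclusion (hC i))
        (fun i => (MulAction.stabilizer G (Γ.endpoint q₀ i)).subtype)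
        (MulAction.stabilizer G q₀).subtype hf w.prod =
        (w.head : G) * (w.toList.map fun p => (p.2 : G)).prod := by
      rw [Monoid.PushoutI.NormalWord.prod, map_mul, Monoid.PushoutI.lift_base,
        Monoid.CoprodI.Word.prod, map_list_prod, map_list_prod, List.map_map, List.map_map]
      congr 2
    rw [hprod] at hx
    have hnot : ∀ p ∈ w.toList, (p.2 : G) ∉ MulAction.stabilizer G q₀ := by
      rintro ⟨i, s⟩ hp hs
      have h1 := w.normalized i s hp
      have h2 : s ∈ (Subgroup.inclusion (hC i)).range := ⟨⟨s, hs⟩, rfl⟩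
      have h3 := (d.compl i).1
      have h4 : ((⟨s, h2⟩, ⟨1, d.one_mem i⟩) :
          ((Subgroup.inclusion (hC i)).range : Set _) × d.set i) = (⟨1, one_mem _⟩, ⟨s, h1⟩) := by
        apply h3
        simp
      exact w.ne_one _ hp (congrArg Subtype.val (congrArg Prod.fst h4))
    by_cases hL : w.toList = []
    · rw [hL] at hx
      simp only [List.map_nil, List.prod_nil, mul_one, OneMemClass.coe_eq_one] at hx
      have : w = Monoid.PushoutI.NormalWord.empty :=
        Monoid.PushoutI.NormalWord.ext hx (by rw [hL]; rfl)
      rw [this, Monoid.PushoutI.NormalWord.prod_empty]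
    · exfalso
      -- the path of a nonempty reduced word moves `q₀`
      obtain ⟨h1, -⟩ := amalgamPath_spec hΓ hno (r := fun _ _ => False) (by simp) w.toList
        w.chain_ne hnot (1 : G)
      have h2 : ((w.toList.map fun p => (p.2 : G)).prod) • q₀ = q₀ := by
        have : (w.toList.map fun p => (p.2 : G)).prod = (w.head : G)⁻¹ :=
          (inv_eq_of_mul_eq_one_right hx).symm
        rw [this, inv_smul_eq_iff]
        exact w.head.2.symm
      rw [one_mul, h2, one_smul] at h1
      obtain ⟨p, L, hpL⟩ := List.exists_cons_of_ne_nil hL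
      have h3 := Γ.isTreeAdj.isPath_unique h1 (L' := [edge q₀]) ⟨trivial, rfl, rfl⟩
      rw [hpL, amalgamPath] at h3
      simp at h3
  · set F := Monoid.PushoutI.lift (φ := fun i => Subgroup.inclusion (hC i))
        (fun i => (MulAction.stabilizer G (Γ.endpoint q₀ i)).subtype)
        (MulAction.stabilizer G q₀).subtype hf with hF
    have hS : ∀ i (s : G), s • Γ.endpoint q₀ i = Γ.endpoint q₀ i → s ∈ F.range := by
      intro i s hs
      exact ⟨Monoid.PushoutI.of i ⟨s, hs⟩, by rw [hF, Monoid.PushoutI.lift_of]; rfl⟩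
    -- translates of an endpoint by the same edge translate
    have hstep : ∀ (h x : G) (i j : Bool), x ∈ F.range →
        h • Γ.endpoint q₀ i = x • Γ.endpoint q₀ j → h ∈ F.range := by
      intro h x i j hx e
      have hij : i = j := by
        have a := amalgamColor_vert hno h i
        rw [e, amalgamColor_vert hno x j] at a
        exact (Option.some.inj a).symm
      subst hij
      have := hS i (x⁻¹ * h) (by rw [mul_smul, e, inv_smul_smul])
      simpa using mul_mem hx this
    have hiff : ∀ p p', Relation.EqvGen (fun a b => ∃ q, Γ.src q = a ∧ Γ.tgt q = b) p p' →
        ((∃ x ∈ F.range, ∃ i, p = x • Γ.endpoint q₀ i) ↔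
          (∃ x ∈ F.range, ∃ i, p' = x • Γ.endpoint q₀ i)) := by
      intro p p' h
      induction h with
      | rel a b h =>
        obtain ⟨q, rfl, rfl⟩ := h
        obtain ⟨h, rfl⟩ := htrans q
        rw [hΓ.src_smul, hΓ.tgt_smul]
        constructor
        · rintro ⟨x, hx, i, e⟩
          exact ⟨h, hstep h x false i hx e, true, rfl⟩
        · rintro ⟨x, hx, i, e⟩
          exact ⟨h, hstep h x true i hx e, false, rfl⟩
      | refl => rfl
      | symm _ _ _ ih => exact ih.symm
      | trans _ _ _ _ _ h1 h2 => exact h1.trans h2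
    intro g
    obtain ⟨x, hx, i, e⟩ := (hiff _ (g • Γ.endpoint q₀ true) (Γ.conn _ _)).1
      ⟨1, one_mem _, true, (one_smul G (Γ.endpoint q₀ true)).symm⟩
    exact hstep g x true i hx e

/-- The letter-quasimorphism of the path words is the map of the amalgam. -/
theorem isAmalgamLetterMap (hΓ : Γ.IsEquivariant G)
    (htrans : ∀ q, ∃ g : G, q = g • q₀) (hno : ∀ h : G, h • Γ.src q₀ ≠ Γ.tgt q₀)
    {r : Q → Q → Prop} (hr : IsStrictTotalOrder Q r)
    (hinv : ∀ (g : G) q q', r (g • q) (g • q') ↔ r q q') :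
    IsAmalgamLetterMap (MulAction.stabilizer G q₀) fun g : G => FreeGroup.mk
      (pathWord Γ.isTreeAdj (Γ.amalgamColor G q₀) (Γ.linkPos fun _ => r) (edge q₀)
        (g • edge q₀)) := by
  classical
  have hC : ∀ i, MulAction.stabilizer G q₀ ≤ MulAction.stabilizer G (Γ.endpoint q₀ i) := by
    intro i g hg
    rw [MulAction.mem_stabilizer_iff] at hg ⊢
    cases i
    · simp only [endpoint, cond_false, ← hΓ.src_smul, hg]
    · simp only [endpoint, cond_true, ← hΓ.tgt_smul, hg]
  have hord : ∀ i, _ := fun i => exists_cosetOrder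
    (H := (MulAction.stabilizer G q₀).subgroupOf (MulAction.stabilizer G (Γ.endpoint q₀ i)))
    (q₀ := q₀) (fun g => by
      rw [Subgroup.mem_subgroupOf, MulAction.mem_stabilizer_iff]; rfl) hr (fun g => hinv g)
  choose r' hr' _ hsign using hord
  refine ⟨fun i => MulAction.stabilizer G (Γ.endpoint q₀ i), hC,
    bijective_pushout_lift hΓ htrans hno hC _, r', hr', ?_, ?_⟩
  · intro c hc
    have : (c • edge q₀ : TreeNode P Q) = edge q₀ := by
      rw [smul_edge, MulAction.mem_stabilizer_iff.1 hc]
    simp only [this]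
    have hpath : IsPath Γ.Adj (edge q₀) (edge q₀) [edge q₀] := ⟨trivial, rfl, rfl⟩
    rw [pathWord_eq Γ.isTreeAdj hpath]
    rfl
  · intro L hch hL
    obtain ⟨h1, h2⟩ := amalgamPath_spec hΓ hno hinv L hch hL (1 : G)
    rw [one_mul, one_smul] at h1
    simp only [smul_edge]
    rw [pathWord_eq Γ.isTreeAdj h1, h2]
    clear h1 h2 hch
    induction L with
    | nil => rfl
    | cons p L ih =>
      rw [List.map_cons, List.map_cons, List.prod_cons,
        ← ih fun q hq => hL q (List.mem_cons_of_mem _ hq)]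
      rw [← List.singleton_append, ← FreeGroup.mul_mk, FreeGroup.mk_singleton]
      congr 2
      have := hL p List.mem_cons_self
      rw [hsign p.1 p.2 (fun h => this (Subgroup.mem_subgroupOf.1 h))]
      rfl

end OrientedTree

/-! ### HNN extensions -/

namespace OrientedTree

open TreeNode

section HNN

variable {P Q : Type*} {Γ : OrientedTree P Q} {G : Type*} [Group G] [MulAction G P] [MulAction G Q]
variable {q₀ : Q} {t : G}

/-- The colours for an HNN extension: vertices have colour `false`, edges have colour `true`, and
leaves are uncoloured. -/
def hnnColor : TreeNode P Q → Option Bool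
  | vert _ => some false
  | edge _ => some true
  | leaf _ => none

theorem hnnColor_vert (p : P) : hnnColor (vert p : TreeNode P Q) = some false := rfl

theorem hnnColor_edge (q : Q) : hnnColor (edge q : TreeNode P Q) = some true := rfl

theorem hnnColor_smul (g : G) (x : TreeNode P Q) : hnnColor (g • x) = hnnColor x := by
  cases x <;> rfl

theorem isAlternatingColoring_hnn : IsAlternatingColoring Γ.Adj hnnColor where
  ne_of_adj := by
    rintro (p | q | p) (p' | q' | p') c d h h1 h2 <;> simp [hnnColor] at h h1 h2 <;>
      simp [h1, h2]
  of_none := by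
    rintro (p | q | p) (p' | q' | p') (p'' | q'' | p'') h1 h2 hne hm <;>
      simp_all [hnnColor]

/-- The path of a word `h t ^ ε₀ v₁ ⋯`, which starts at the translate by `h` of the end of `q₀`. The
edge that belongs to `t ^ ε` leads from this end `k` to `t ^ ε k`: it is `t q₀` if `ε = 1`, and `q₀`
traversed backwards if `ε = -1`. -/
def hnnPath (Γ : OrientedTree P Q) (q₀ : Q) (t : G) (h : G) : List (ℤˣ × G) → List (TreeNode P Q)
  | [] => [vert (h • Γ.tgt q₀), leaf (h • Γ.tgt q₀)]
  | p :: L => vert (h • Γ.tgt q₀) :: edge ((h * if p.1 = 1 then t else 1) • q₀) ::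
      hnnPath Γ q₀ t (h * t ^ (p.1 : ℤ) * p.2) L

/-- The condition that the two edges that belong to `t ^ ε` and `t ^ ε'` in `t ^ ε v t ^ ε'` differ. -/
def HNNTurn (q₀ : Q) (t : G) (p q : ℤˣ × G) : Prop :=
  ((if p.1 = -1 then t⁻¹ else 1) * p.2 * (if q.1 = 1 then t else 1)) • q₀ ≠ q₀

theorem exists_hnnPath_eq_cons (h : G) (L : List (ℤˣ × G)) :
    ∃ l, hnnPath Γ q₀ t h L = vert (h • Γ.tgt q₀) :: l ∧ l ≠ [] := by
  cases L <;> exact ⟨_, rfl, by simp⟩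

theorem getLast?_hnnPath (L : List (ℤˣ × G)) : (∀ p ∈ L, p.2 • Γ.tgt q₀ = Γ.tgt q₀) → ∀ h : G,
    (hnnPath Γ q₀ t h L).getLast? =
      some (leaf ((h * (L.map fun p => t ^ (p.1 : ℤ) * p.2).prod) • Γ.tgt q₀)) := by
  induction L with
  | nil => intro _ h; simp [hnnPath]
  | cons p L ih =>
    intro hL h
    have := ih (fun q hq => hL q (List.mem_cons_of_mem _ hq)) (h * t ^ (p.1 : ℤ) * p.2)
    obtain ⟨l, hl, hne⟩ := exists_hnnPath_eq_cons (Γ := Γ) (q₀ := q₀) (t := t)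
      (h * t ^ (p.1 : ℤ) * p.2) L
    rw [hnnPath]
    rw [hl] at this ⊢
    rw [List.getLast?_cons_cons, List.getLast?_cons_cons, this]
    simp [mul_assoc]

open Classical in
/-- The path of a reduced word does not backtrack, and its letters alternate between the exponents of
the stable letter, at the edges, and the signs of the elements in between, at the vertices. The letter
`a⁻¹` at the end is the turn into the final leaf. -/
theorem hnnPath_spec (hΓ : Γ.IsEquivariant G) (ht : t • Γ.src q₀ = Γ.tgt q₀)
    {r : Q → Q → Prop} (hinv : ∀ (g : G) q q', r (g • q) (g • q') ↔ r q q') {s : G → ℤ}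
    (hs : ∀ g : G, g • q₀ ≠ q₀ → s g = if decide (r q₀ (g • q₀)) then 1 else -1)
    (L : List (ℤˣ × G)) :
    L.IsChain (HNNTurn q₀ t) → (∀ p ∈ L, p.2 • Γ.tgt q₀ = Γ.tgt q₀) → L ≠ [] →
    ∀ h : G, Reduced Γ.Adj (hnnPath Γ q₀ t h L) ∧
      FreeGroup.mk (turnList (turnLetter hnnColor (Γ.linkPos fun _ => r)) (hnnPath Γ q₀ t h L)) =
        hnnLetters t s L * (FreeGroup.of false)⁻¹ := by
  have hst : Γ.src q₀ = t⁻¹ • Γ.tgt q₀ := by rw [← ht, inv_smul_smul]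
  have hsrc : ∀ (h : G) (ε : ℤˣ), h • Γ.tgt q₀ = Γ.src ((h * if ε = 1 then t else 1) • q₀) ↔
      ε = 1 := by
    intro h ε
    rw [hΓ.src_smul, mul_smul]
    rcases Int.units_eq_one_or ε with rfl | rfl
    · simp [ht]
    · simpa [eq_comm] using Γ.src_ne_tgt q₀
  have hadj1 : ∀ (h : G) (ε : ℤˣ), Γ.Adj (vert (h • Γ.tgt q₀))
      (edge ((h * if ε = 1 then t else 1) • q₀)) := by
    intro h ε
    rw [adj_vert_edge, hΓ.src_smul, hΓ.tgt_smul, mul_smul, mul_smul]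
    rcases Int.units_eq_one_or ε with rfl | rfl
    · left; simp [ht]
    · right; simp
  have hadj2 : ∀ (h : G) (ε : ℤˣ), Γ.Adj (edge ((h * if ε = 1 then t else 1) • q₀))
      (vert ((h * t ^ (ε : ℤ)) • Γ.tgt q₀)) := by
    intro h ε
    rw [adj_edge_vert, hΓ.src_smul, hΓ.tgt_smul, mul_smul, mul_smul, mul_smul]
    rcases Int.units_eq_one_or ε with rfl | rfl
    · right; simp
    · left; simp [hst]
  have hne1 : ∀ (h : G) (ε : ℤˣ), h • Γ.tgt q₀ ≠ (h * t ^ (ε : ℤ)) • Γ.tgt q₀ := by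
    intro h ε e
    rw [mul_smul] at e
    have e := smul_left_cancel h e
    rcases Int.units_eq_one_or ε with rfl | rfl
    · rw [Units.val_one, zpow_one] at e
      nth_rewrite 1 [← ht] at e
      exact Γ.src_ne_tgt q₀ (smul_left_cancel t e)
    · rw [Units.val_neg, Units.val_one, zpow_neg_one, ← hst] at e
      exact Γ.src_ne_tgt q₀ e.symm
  have hback : ∀ (h : G) (p q : ℤˣ × G), 
      ∃ x : G, (h * if p.1 = 1 then t else 1) • q₀ = x • q₀ ∧
      (h * t ^ (p.1 : ℤ) * p.2 * if q.1 = 1 then t else 1) • q₀ =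
        x • ((if p.1 = -1 then t⁻¹ else 1) * p.2 * (if q.1 = 1 then t else 1)) • q₀ := by
    intro h p q
    refine ⟨_, rfl, ?_⟩
    rw [smul_smul]
    congr 1
    obtain ⟨ε, v⟩ := p
    rcases Int.units_eq_one_or ε with rfl | rfl
    · simp [mul_assoc]
    · have : ((-1 : ℤˣ) = 1) = False := by decide
      simp [mul_assoc, this]
  have hb : ∀ (h : G) (ε : ℤˣ) (p' : P), FreeGroup.mk (turnLetter hnnColor (Γ.linkPos fun _ => r)
      (vert (h • Γ.tgt q₀)) (edge ((h * if ε = 1 then t else 1) • q₀)) (vert p')) =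
      FreeGroup.of true ^ (ε : ℤ) := by
    intro h ε p'
    rw [turnLetter_some (hnnColor_edge _), FreeGroup.mk_singleton]
    simp only [linkPos, hsrc]
    rcases Int.units_eq_one_or ε with rfl | rfl <;> simp
  induction L with
  | nil => intro _ _ h; exact absurd rfl h
  | cons p L ih =>
    intro hch hL _ h
    have hp := hL p List.mem_cons_self
    have hpk : (h * t ^ (p.1 : ℤ) * p.2) • Γ.tgt q₀ = (h * t ^ (p.1 : ℤ)) • Γ.tgt q₀ := by
      rw [mul_smul _ p.2, hp]
    have hn1 : (vert (h • Γ.tgt q₀) : TreeNode P Q) ≠ vert ((h * t ^ (p.1 : ℤ)) • Γ.tgt q₀) :=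
      fun e => hne1 h p.1 (by injection e)
    rcases L with _ | ⟨q, L⟩
    · rw [hnnPath, hnnPath, hpk]
      refine ⟨?_, ?_⟩
      · rw [reduced_cons_cons, reduced_cons_cons]
        refine ⟨hadj1 h p.1, by simpa using hn1, hadj2 h p.1, by simp, ?_⟩
        rw [reduced_pair]
        rfl
      · rw [turnList_cons, turnList_cons, ← FreeGroup.mul_mk, hb, turnLetter_some (hnnColor_vert _)]
        simp [linkPos, hnnLetters, FreeGroup.mk_singleton]
    · obtain ⟨h1, h2⟩ := ih hch.tail (fun q hq => hL q (List.mem_cons_of_mem _ hq)) (by simp)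
        (h * t ^ (p.1 : ℤ) * p.2)
      have hturn : HNNTurn q₀ t p q := (List.isChain_cons_cons.1 hch).1
      obtain ⟨x, hx1, hx2⟩ := hback h p q
      rw [hnnPath, hnnPath]
      rw [hnnPath] at h1 h2
      obtain ⟨l, hl, -⟩ := exists_hnnPath_eq_cons (Γ := Γ) (q₀ := q₀) (t := t)
        (h * t ^ (p.1 : ℤ) * p.2 * t ^ (q.1 : ℤ) * q.2) L
      rw [hl] at h1 h2 ⊢
      refine ⟨?_, ?_⟩
      · rw [reduced_cons_cons, reduced_cons_cons]
        refine ⟨hadj1 h p.1, ?_, ?_, ?_, h1⟩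
        · simpa [hpk] using hn1
        · rw [hpk]; exact hadj2 h p.1
        · simp only [List.head?_cons, Option.mem_def, Option.some.injEq, forall_eq', hx1, hx2]
          intro e
          injection e with e
          exact hturn (smul_left_cancel x e).symm
      · rw [turnList_cons, turnList_cons, ← FreeGroup.mul_mk, ← FreeGroup.mul_mk, hb, h2]
        rw [hnnLetters, turnLetter_some (hnnColor_vert _), FreeGroup.mk_singleton, hs _ hturn]
        simp only [linkPos, hx1, hx2, hinv]
        simp only [mul_assoc]

/-- The path of a nonempty reduced word, from the leaf at the end `k` of `q₀` to its translate. -/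
theorem isPath_hnnPath (hΓ : Γ.IsEquivariant G) (ht : t • Γ.src q₀ = Γ.tgt q₀) {v : G}
    (hv : v • Γ.tgt q₀ = Γ.tgt q₀) {L : List (ℤˣ × G)} (hch : L.IsChain (HNNTurn q₀ t))
    (hL : ∀ p ∈ L, p.2 • Γ.tgt q₀ = Γ.tgt q₀) (hne : L ≠ []) :
    IsPath Γ.Adj (leaf (Γ.tgt q₀))
      (leaf ((v * (L.map fun p => t ^ (p.1 : ℤ) * p.2).prod) • Γ.tgt q₀))
      (leaf (Γ.tgt q₀) :: hnnPath Γ q₀ t v L) := by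
  classical
  obtain ⟨h1, -⟩ := hnnPath_spec hΓ ht (r := fun _ _ => False) (by simp) (s := fun _ => -1)
    (by simp) L hch hL hne v
  have h2 := getLast?_hnnPath (t := t) L hL v
  rcases L with _ | ⟨p, L⟩
  · exact absurd rfl hne
  · rw [hnnPath] at h1 h2 ⊢
    refine ⟨?_, rfl, ?_⟩
    · rw [reduced_cons_cons]
      exact ⟨hv, by simp, h1⟩
    · rw [List.getLast?_cons_cons, h2]

theorem lift_reducedWord_prod {V G : Type*} [Group V] [Group G] {A₀ B₀ : Subgroup V}
    {f : A₀ ≃* B₀} {j : V →* G} {t : G} (ht : ∀ x : A₀, t * j x = j (f x : V) * t)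
    (w : HNNExtension.NormalWord.ReducedWord V A₀ B₀) :
    HNNExtension.lift (φ := f) j t ht (w.prod f) =
      j w.head * ((w.toList.map fun p => (p.1, j p.2)).map fun p => t ^ (p.1 : ℤ) * p.2).prod := by
  rw [HNNExtension.NormalWord.ReducedWord.prod, map_mul, HNNExtension.lift_of, map_list_prod,
    List.map_map, List.map_map]
  congr 2
  refine List.map_congr_left fun p _ => ?_
  simp

/-- In a reduced word, the edges of successive stable letters differ, since the stabilizers of `q₀` and
`t q₀` in the vertex group are the two associated subgroups. -/
theorem hnnTurn_of_chain (hΓ : Γ.IsEquivariant G) (ht : t • Γ.src q₀ = Γ.tgt q₀)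
    {A₀ B₀ : Subgroup (MulAction.stabilizer G (Γ.tgt q₀))}
    (hA : ∀ v, v ∈ A₀ ↔ (v : G) • q₀ = q₀) (hB : ∀ v, v ∈ B₀ ↔ (v : G) • t • q₀ = t • q₀)
    (p q : ℤˣ × MulAction.stabilizer G (Γ.tgt q₀))
    (hpq : p.2 ∈ HNNExtension.toSubgroup A₀ B₀ p.1 → p.1 = q.1) :
    HNNTurn q₀ t (p.1, (p.2 : G)) (q.1, (q.2 : G)) := by
  have hst : Γ.src q₀ = t⁻¹ • Γ.tgt q₀ := by rw [← ht, inv_smul_smul]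
  obtain ⟨ε, v⟩ := p
  obtain ⟨ε', v'⟩ := q
  have hv : (v : G) • Γ.tgt q₀ = Γ.tgt q₀ := v.2
  have hv' : (v : G)⁻¹ • Γ.tgt q₀ = Γ.tgt q₀ := by rw [inv_smul_eq_iff, hv]
  have hneg : ((-1 : ℤˣ) = 1) = False := by decide
  have hneg' : ((1 : ℤˣ) = -1) = False := by decide
  intro e
  rcases Int.units_eq_one_or ε with rfl | rfl <;> rcases Int.units_eq_one_or ε' with rfl | rfl <;>
    simp only [hneg, hneg', if_true, if_false, one_mul, mul_one, mul_smul,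
      HNNExtension.toSubgroup_one, HNNExtension.toSubgroup_neg_one, hA, hB] at e hpq
  · have e2 := congrArg Γ.src e
    rw [hΓ.src_smul, hΓ.src_smul, ht, hv] at e2
    exact Γ.src_ne_tgt q₀ e2.symm
  · exact hpq e
  · exact hpq (by rwa [inv_smul_eq_iff] at e)
  · have e2 := congrArg Γ.tgt e
    rw [hΓ.tgt_smul, hΓ.tgt_smul, hv, ← hst] at e2
    exact Γ.src_ne_tgt q₀ e2

/-- If the stable letter moves the origin of `q₀` to its end, and all edges lie in the orbit of
`q₀`, the group is an HNN extension of the stabilizer of the end of `q₀`. -/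
theorem bijective_hnn_lift (hΓ : Γ.IsEquivariant G) (htrans : ∀ q, ∃ g : G, q = g • q₀)
    (ht : t • Γ.src q₀ = Γ.tgt q₀)
    {A₀ B₀ : Subgroup (MulAction.stabilizer G (Γ.tgt q₀))} {f : A₀ ≃* B₀}
    (hA : ∀ v, v ∈ A₀ ↔ (v : G) • q₀ = q₀) (hB : ∀ v, v ∈ B₀ ↔ (v : G) • t • q₀ = t • q₀)
    (hf : ∀ x : A₀, t * (MulAction.stabilizer G (Γ.tgt q₀)).subtype x =
      (MulAction.stabilizer G (Γ.tgt q₀)).subtype (f x : MulAction.stabilizer G (Γ.tgt q₀)) * t) :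
    Function.Bijective
      (HNNExtension.lift (φ := f) (MulAction.stabilizer G (Γ.tgt q₀)).subtype t hf) := by
  constructor
  · rw [injective_iff_map_eq_one]
    intro x hx
    obtain ⟨d⟩ : Nonempty (HNNExtension.NormalWord.TransversalPair
      (MulAction.stabilizer G (Γ.tgt q₀)) A₀ B₀) := inferInstance
    obtain ⟨w, rfl⟩ : ∃ w : HNNExtension.NormalWord d, w.prod f = x :=
      ⟨_, (HNNExtension.NormalWord.equiv f d).symm_apply_apply x⟩
    rw [lift_reducedWord_prod] at hx
    by_cases hL : w.toList = []
    · rw [hL] at hx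
      simp only [List.map_nil, List.prod_nil, mul_one] at hx
      rw [HNNExtension.NormalWord.ReducedWord.prod, hL,
        show w.head = 1 from Subtype.ext (by simpa using hx)]
      simp
    · exfalso
      have h1 := isPath_hnnPath hΓ ht (v := (w.head : G)) w.head.2
        (L := w.toList.map fun p => (p.1, (p.2 : G)))
        (List.isChain_map_of_isChain _ (fun p q h => hnnTurn_of_chain hΓ ht hA hB p q h) w.chain)
        (by
          intro p hp
          obtain ⟨p', -, rfl⟩ := List.mem_map.1 hp
          exact p'.2.2)
        (by simpa using hL)
      simp only [Subgroup.subtype_apply] at hx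
      rw [hx, one_smul] at h1
      have h3 := Γ.isTreeAdj.isPath_unique h1 (L' := [leaf (Γ.tgt q₀)]) ⟨trivial, rfl, rfl⟩
      obtain ⟨l, hl, -⟩ := exists_hnnPath_eq_cons (Γ := Γ) (q₀ := q₀) (t := t) (w.head : G)
        (w.toList.map fun p => (p.1, (p.2 : G)))
      rw [hl] at h3
      simp at h3
  · set F := HNNExtension.lift (φ := f) (MulAction.stabilizer G (Γ.tgt q₀)).subtype t hf with hF
    have hV : ∀ s : G, s • Γ.tgt q₀ = Γ.tgt q₀ → s ∈ F.range := fun s hs =>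
      ⟨HNNExtension.of ⟨s, hs⟩, by rw [hF, HNNExtension.lift_of]; rfl⟩
    have htF : t ∈ F.range := ⟨HNNExtension.t, by rw [hF, HNNExtension.lift_t]⟩
    have hmem : ∀ h : G, (∃ x ∈ F.range, h • Γ.tgt q₀ = x • Γ.tgt q₀) ↔ h ∈ F.range := by
      intro h
      refine ⟨?_, fun hh => ⟨h, hh, rfl⟩⟩
      rintro ⟨x, hx, e⟩
      have := hV (x⁻¹ * h) (by rw [mul_smul, e, inv_smul_smul])
      simpa using mul_mem hx this
    have hiff : ∀ p p', Relation.EqvGen (fun a b => ∃ q, Γ.src q = a ∧ Γ.tgt q = b) p p' →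
        ((∃ x ∈ F.range, p = x • Γ.tgt q₀) ↔ (∃ x ∈ F.range, p' = x • Γ.tgt q₀)) := by
      intro p p' h
      induction h with
      | rel a b h =>
        obtain ⟨q, rfl, rfl⟩ := h
        obtain ⟨h, rfl⟩ := htrans q
        rw [hΓ.src_smul, hΓ.tgt_smul, show Γ.src q₀ = t⁻¹ • Γ.tgt q₀ by rw [← ht, inv_smul_smul],
          smul_smul, hmem, hmem]
        exact ⟨fun h => by simpa using mul_mem h htF, fun h => mul_mem h (inv_mem htF)⟩
      | refl => rfl
      | symm _ _ _ ih => exact ih.symm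
      | trans _ _ _ _ _ h1 h2 => exact h1.trans h2
    intro g
    exact (hmem g).1 ((hiff (Γ.tgt q₀) (g • Γ.tgt q₀) (Γ.conn _ _)).1
      ⟨1, one_mem _, (one_smul G (Γ.tgt q₀)).symm⟩)

/-- The letter-quasimorphism of the path words is the map of the HNN extension. -/
theorem isHNNLetterMap (hΓ : Γ.IsEquivariant G)
    (htrans : ∀ q, ∃ g : G, q = g • q₀) (ht : t • Γ.src q₀ = Γ.tgt q₀)
    {r : Q → Q → Prop} (hr : IsStrictTotalOrder Q r)
    (hinv : ∀ (g : G) q q', r (g • q) (g • q') ↔ r q q') :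
    IsHNNLetterMap (MulAction.stabilizer G q₀) fun g : G => FreeGroup.mk
      (pathWord Γ.isTreeAdj hnnColor (Γ.linkPos fun _ => r) (leaf (Γ.tgt q₀))
        (g • leaf (Γ.tgt q₀))) := by
  classical
  have hC : MulAction.stabilizer G q₀ ≤ MulAction.stabilizer G (Γ.tgt q₀) := by
    intro g hg
    rw [MulAction.mem_stabilizer_iff] at hg ⊢
    rw [← hΓ.tgt_smul, hg]
  have hk : Γ.src (t • q₀) = Γ.tgt q₀ := by rw [hΓ.src_smul, ht]
  have hconj : ∀ g : G, g • q₀ = q₀ → t * g * t⁻¹ ∈ MulAction.stabilizer G (Γ.tgt q₀) := by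
    intro g hg
    rw [MulAction.mem_stabilizer_iff, ← hk, ← hΓ.src_smul]
    simp [mul_smul, hg]
  have hconj' : ∀ g : G, g • t • q₀ = t • q₀ →
      t⁻¹ * g * t ∈ MulAction.stabilizer G (Γ.tgt q₀) := by
    intro g hg
    rw [MulAction.mem_stabilizer_iff, ← hΓ.tgt_smul]
    simp [mul_smul, hg]
  let A₀ : Subgroup (MulAction.stabilizer G (Γ.tgt q₀)) :=
    (MulAction.stabilizer G q₀).subgroupOf _
  let B₀ : Subgroup (MulAction.stabilizer G (Γ.tgt q₀)) :=
    (MulAction.stabilizer G (t • q₀)).subgroupOf _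
  have hA : ∀ v, v ∈ A₀ ↔ (v : G) • q₀ = q₀ := fun v => Iff.rfl
  have hB : ∀ v, v ∈ B₀ ↔ (v : G) • t • q₀ = t • q₀ := fun v => Iff.rfl
  let f : A₀ ≃* B₀ :=
    { toFun := fun x => ⟨⟨t * x * t⁻¹, hconj _ x.2⟩, by
        rw [hB]; simp [mul_smul, (hA _).1 x.2]⟩
      invFun := fun x => ⟨⟨t⁻¹ * x * t, hconj' _ x.2⟩, by
        rw [hA]; simp [mul_smul, (hB _).1 x.2]⟩
      left_inv := fun x => by ext; simp [mul_assoc]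
      right_inv := fun x => by ext; simp [mul_assoc]
      map_mul' := fun x y => by ext; simp [mul_assoc] }
  have hf : ∀ x : A₀, t * (MulAction.stabilizer G (Γ.tgt q₀)).subtype x =
      (MulAction.stabilizer G (Γ.tgt q₀)).subtype
        (f x : MulAction.stabilizer G (Γ.tgt q₀)) * t := by
    intro x
    simp [f]
  obtain ⟨r', hr', -, hsign⟩ := exists_cosetOrder (H := MulAction.stabilizer G q₀)
    (q₀ := q₀) (fun g => Iff.rfl) hr hinv
  refine ⟨_, A₀, B₀, f, t, hf, ?_, bijective_hnn_lift hΓ htrans ht hA hB hf, r', hr', ?_⟩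
  · rw [Subgroup.subgroupOf_map_subtype, inf_eq_left.2 hC]
  · intro w
    rw [lift_reducedWord_prod]
    simp only [smul_leaf]
    by_cases hL : w.toList = []
    · rw [if_pos hL, hL]
      have hk : ((w.head : G) • Γ.tgt q₀) = Γ.tgt q₀ := w.head.2
      have hpath : IsPath Γ.Adj (leaf (Γ.tgt q₀)) (leaf (Γ.tgt q₀)) [leaf (Γ.tgt q₀)] :=
        ⟨trivial, rfl, rfl⟩
      simp only [List.map_nil, List.prod_nil, mul_one, Subgroup.subtype_apply, hk]
      rw [pathWord_eq Γ.isTreeAdj hpath]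
      rfl
    · rw [if_neg hL]
      have hch : (w.toList.map fun p => (p.1, (p.2 : G))).IsChain (HNNTurn q₀ t) :=
        List.isChain_map_of_isChain _ (fun p q h => hnnTurn_of_chain hΓ ht hA hB p q h) w.chain
      have hmem : ∀ p ∈ w.toList.map fun p => (p.1, (p.2 : G)), p.2 • Γ.tgt q₀ = Γ.tgt q₀ := by
        intro p hp
        obtain ⟨p', -, rfl⟩ := List.mem_map.1 hp
        exact p'.2.2
      have hne : w.toList.map (fun p => (p.1, (p.2 : G))) ≠ [] := by simpa using hL
      have hpath := isPath_hnnPath hΓ ht (v := (w.head : G)) w.head.2 hch hmem hne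
      obtain ⟨-, hword⟩ := hnnPath_spec hΓ ht hinv (fun g hg => hsign g hg) _ hch hmem hne
        (w.head : G)
      simp only [Subgroup.subtype_apply]
      rw [pathWord_eq Γ.isTreeAdj hpath]
      obtain ⟨p, L, hpL⟩ := List.exists_cons_of_ne_nil hne
      rw [hpL] at hword ⊢
      rw [hnnPath] at hword ⊢
      rw [turnList_cons, ← FreeGroup.mul_mk, hword, turnLetter_some (hnnColor_vert _), FreeGroup.mk_singleton]
      simp [linkPos, mul_assoc]

end HNN

end OrientedTree

/-! ### Groups acting on trees with one orbit of edges -/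

namespace OrientedTree

open TreeNode

section OneOrbit

variable {P Q : Type*} {Γ : OrientedTree P Q} {G : Type*} [Group G] [MulAction G P] [MulAction G Q]
variable {q₀ : Q} {r : Q → Q → Prop}

theorem amalgamColor_smul (g : G) (x : TreeNode P Q) :
    Γ.amalgamColor G q₀ (g • x) = Γ.amalgamColor G q₀ x := by
  rcases x with p | q | p
  · have : (∃ h : G, g • p = h • Γ.src q₀) ↔ ∃ h : G, p = h • Γ.src q₀ := by
      constructor
      · rintro ⟨h, e⟩
        exact ⟨g⁻¹ * h, by rw [mul_smul, ← e, inv_smul_smul]⟩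
      · rintro ⟨h, rfl⟩
        exact ⟨g * h, (mul_smul _ _ _).symm⟩
    exact congrArg some (decide_eq_decide.2 (not_congr this))
  · rfl
  · rfl

/-- The conclusion on an element `g` that is detected by the letter-quasimorphism of a splitting
over `C`. -/
def IsDetectedBySplitting {G : Type*} [Group G] (g : G) (C : Subgroup G) : Prop :=
  ∃ φ : G → ℝ, IsHomogeneousQuasimorphism φ ∧ 1 ≤ φ g ∧ defect φ ≤ 1 ∧ 1 / 2 ≤ scl g ∧
    ∃ Φ : G → FreeGroup Bool, IsLetterQuasimorphism Φ ∧
      (IsAmalgamLetterMap C Φ ∨ IsHNNLetterMap C Φ) ∧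
      ∃ (b : FreeGroup Bool) (rot : FreeGroup Bool → ℝ),
        IsAlternating b ∧ Even b.toWord.length ∧ 0 < b.toWord.length ∧
        IsCircleQuasimorphism b rot ∧
        ∀ h : G, Tendsto (fun n : ℕ => rot (Φ (h ^ n)) / (n * b.toWord.length)) atTop
          (𝓝 (φ h))

theorem isDetectedBySplitting_of_forall_ne (hΓ : Γ.IsEquivariant G)
    (htrans : ∀ q, ∃ g : G, q = g • q₀) (hno : ∀ h : G, h • Γ.src q₀ ≠ Γ.tgt q₀)
    (hr : IsStrictTotalOrder Q r) (hinv : ∀ (g : G) q q', r (g • q) (g • q') ↔ r q q')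
    {g : G} {M : List (TreeNode P Q)}
    (hM : Reduced Γ.Adj (edge q₀ :: vert (Γ.tgt q₀) :: M ++
      [edge (g • q₀), vert (g • Γ.tgt q₀)])) :
    IsDetectedBySplitting g (MulAction.stabilizer G q₀) := by
  have hp := (IsVertexOrder.of_total (Γ := Γ) hr).isLinkOrder
  have hc := isAlternatingColoring_amalgam hΓ htrans hno
  have hpos := hΓ.linkPos_smul (lt := fun _ => r) fun g _ => hinv g
  obtain ⟨φ, h1, h2, h3, h4, h5⟩ := exists_homogeneous_of_axis Γ.isTreeAdj hp hc hΓ.adj_smul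
    amalgamColor_smul hpos (o := edge q₀) rfl (x := edge q₀) (y := vert (Γ.tgt q₀)) (D := M)
    (A := []) (B := M ++ [edge (g • q₀)]) (c := true) hM (reduced_pair.2 (Or.inr rfl))
    (by
      have := hM
      rw [show edge q₀ :: vert (Γ.tgt q₀) :: M ++ [edge (g • q₀), vert (g • Γ.tgt q₀)] =
        (edge q₀ :: vert (Γ.tgt q₀) :: (M ++ [edge (g • q₀)])) ++ [vert (g • Γ.tgt q₀)] by
          simp] at this
      exact this.left)
    (by simpa [endpoint] using amalgamColor_vert hno 1 true) rfl
    (by rw [← List.cons_append, ← List.cons_append, List.getLast?_append]; rfl) rfl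
  exact ⟨φ, h1, h2, h3, h4, _, isLetterQuasimorphism_pathWord Γ.isTreeAdj hp hc hΓ.adj_smul
    amalgamColor_smul hpos rfl, Or.inl (isAmalgamLetterMap hΓ htrans hno hr hinv), h5⟩

theorem isDetectedBySplitting_of_smul_eq (hΓ : Γ.IsEquivariant G)
    (htrans : ∀ q, ∃ g : G, q = g • q₀) {t : G} (ht : t • Γ.src q₀ = Γ.tgt q₀)
    (hr : IsStrictTotalOrder Q r) (hinv : ∀ (g : G) q q', r (g • q) (g • q') ↔ r q q')
    {g : G} {M : List (TreeNode P Q)}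
    (hM : Reduced Γ.Adj (edge q₀ :: vert (Γ.tgt q₀) :: M ++
      [edge (g • q₀), vert (g • Γ.tgt q₀)])) :
    IsDetectedBySplitting g (MulAction.stabilizer G q₀) := by
  have hp := (IsVertexOrder.of_total (Γ := Γ) hr).isLinkOrder
  have hc := isAlternatingColoring_hnn (Γ := Γ)
  have hpos := hΓ.linkPos_smul (lt := fun _ => r) fun g _ => hinv g
  obtain ⟨y, N, hN⟩ : ∃ y N, M ++ [edge (g • q₀)] = y :: N :=
    List.exists_cons_of_ne_nil (by simp)
  -- two periods of the axis
  have hMM : Reduced Γ.Adj (edge q₀ :: vert (Γ.tgt q₀) :: y :: N ++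
      vert (g • Γ.tgt q₀) :: (g • y) :: (N.map (fun z => g • z) ++ [g • vert (g • Γ.tgt q₀)])) := by
    have h1 := hM.map (MulAction.injective g) (hΓ.adj_smul g)
    have h2 := reduced_append.2 ⟨hM, (by simpa using h1 :
      Reduced Γ.Adj (edge (g • q₀) :: vert (g • Γ.tgt q₀) :: (M.map (fun z => g • z) ++
      [edge (g • g • q₀), vert (g • g • Γ.tgt q₀)])))⟩
    have h3 : M.map (fun z => g • z) ++ [edge (g • g • q₀), vert (g • g • Γ.tgt q₀)] =
        (g • y) :: (N.map (fun z => g • z) ++ [g • vert (g • Γ.tgt q₀)]) := by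
      have := congrArg (List.map fun z => g • z) hN
      simp only [List.map_append, List.map_cons, List.map_nil] at this
      rw [← List.cons_append, ← this]
      simp
    rw [h3] at h2
    have h4 : edge q₀ :: vert (Γ.tgt q₀) :: M ++ edge (g • q₀) :: vert (g • Γ.tgt q₀) :: (g • y) ::
        (N.map (fun z => g • z) ++ [g • vert (g • Γ.tgt q₀)]) =
        edge q₀ :: vert (Γ.tgt q₀) :: (M ++ [edge (g • q₀)]) ++ vert (g • Γ.tgt q₀) :: (g • y) ::
        (N.map (fun z => g • z) ++ [g • vert (g • Γ.tgt q₀)]) := by simp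
    rw [h4, hN] at h2
    exact h2
  have hD : Reduced Γ.Adj (vert (Γ.tgt q₀) :: y :: N ++ [vert (g • Γ.tgt q₀), g • y]) := by
    have h := hMM.tail
    refine (Reduced.left (B := N.map (fun z => g • z) ++ [g • vert (g • Γ.tgt q₀)]) ?_)
    simpa using h
  have hy : ∃ q, y = edge q := by
    rcases y with p | q | p
    · exact hD.1.elim
    · exact ⟨q, rfl⟩
    · have h1 : Γ.tgt q₀ = p := hD.1
      have h2 : Γ.Adj (leaf p) ((N ++ [vert (g • Γ.tgt q₀), g • leaf p]).head (by simp)) ∧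
          vert (Γ.tgt q₀) ≠ (N ++ [vert (g • Γ.tgt q₀), g • leaf p]).head (by simp) := by
        rcases N with _ | ⟨z, N⟩
        · exact ⟨hD.2.2.1, hD.2.1 _ (by simp)⟩
        · exact ⟨hD.2.2.1, hD.2.1 _ (by simp)⟩
      exfalso
      generalize (N ++ [vert (g • Γ.tgt q₀), g • leaf p]).head (by simp) = z at h2
      rcases z with p' | q | p'
      · exact h2.2 (by rw [h1, show p = p' from h2.1.symm ▸ rfl])
      · exact h2.1.elim
      · exact h2.1.elim
  obtain ⟨q, rfl⟩ := hy
  have hA : Reduced Γ.Adj ([leaf (Γ.tgt q₀)] ++ [vert (Γ.tgt q₀), edge q]) :=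
    reduced_triple.2 ⟨rfl, by simp, hD.1⟩
  have hB : Reduced Γ.Adj (vert (Γ.tgt q₀) :: edge q ::
      (N ++ [vert (g • Γ.tgt q₀), leaf (g • Γ.tgt q₀)])) := by
    have : vert (Γ.tgt q₀) :: edge q :: (N ++ [vert (g • Γ.tgt q₀), leaf (g • Γ.tgt q₀)]) =
        (vert (Γ.tgt q₀) :: M) ++ edge (g • q₀) :: vert (g • Γ.tgt q₀) :: [leaf (g • Γ.tgt q₀)] := by
      rw [← List.cons_append, ← hN]; simp
    rw [this, reduced_append]
    exact ⟨hM.tail, reduced_triple.2 ⟨hM.right.1, by simp, rfl⟩⟩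
  have hlast : (vert (Γ.tgt q₀) :: edge q ::
      (N ++ [vert (g • Γ.tgt q₀), leaf (g • Γ.tgt q₀)])).getLast? = some (g • leaf (Γ.tgt q₀)) := by
    simp only [← List.cons_append, List.getLast?_append]
    rfl
  obtain ⟨φ, h1, h2, h3, h4, h5⟩ := exists_homogeneous_of_axis Γ.isTreeAdj hp hc hΓ.adj_smul
    hnnColor_smul hpos rfl hD hA hB (c := true) rfl rfl hlast rfl
  exact ⟨φ, h1, h2, h3, h4, _, isLetterQuasimorphism_pathWord Γ.isTreeAdj hp hc hΓ.adj_smul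
    hnnColor_smul hpos rfl, Or.inr (isHNNLetterMap hΓ htrans ht hr hinv), h5⟩

/-- The tree with the opposite orientation. -/
def flip (Γ : OrientedTree P Q) : OrientedTree P Q where
  src := Γ.tgt
  tgt := Γ.src
  pot p q := - Γ.pot p q
  pot_tgt_self q := by rw [Γ.pot_tgt_self]; ring
  pot_tgt_of_ne q q' h := by rw [Γ.pot_tgt_of_ne q q' h]
  conn p p' := by
    induction Γ.conn p p' with
    | rel a b h =>
      obtain ⟨q, rfl, rfl⟩ := h
      exact .symm _ _ (.rel _ _ ⟨q, rfl, rfl⟩)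
    | refl => exact .refl _
    | symm _ _ _ ih => exact .symm _ _ ih
    | trans _ _ _ _ _ h1 h2 => exact .trans _ _ _ h1 h2

theorem flip_adj : Γ.flip.Adj = Γ.Adj := by
  funext x y
  rcases x with p | q | p <;> rcases y with p' | q' | p' <;> simp [flip, or_comm]

/-- An element with an axis through `q₀`, for an action on a tree with one orbit of edges and an
invariant order on them, is detected by the splitting over the stabilizer of `q₀`. -/
theorem isDetectedBySplitting_of_axis (hΓ : Γ.IsEquivariant G)
    (htrans : ∀ q, ∃ g : G, q = g • q₀)
    (hr : IsStrictTotalOrder Q r) (hinv : ∀ (g : G) q q', r (g • q) (g • q') ↔ r q q')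
    {g : G} {p : P} {M : List (TreeNode P Q)}
    (hM : Reduced Γ.Adj (edge q₀ :: vert p :: M ++ [edge (g • q₀), vert (g • p)])) :
    IsDetectedBySplitting g (MulAction.stabilizer G q₀) := by
  have key : ∀ {Γ : OrientedTree P Q}, Γ.IsEquivariant G →
      Reduced Γ.Adj (edge q₀ :: vert (Γ.tgt q₀) :: M ++ [edge (g • q₀), vert (g • Γ.tgt q₀)]) →
      IsDetectedBySplitting g (MulAction.stabilizer G q₀) := by
    intro Γ hΓ hM
    by_cases h : ∃ t : G, t • Γ.src q₀ = Γ.tgt q₀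
    · obtain ⟨t, ht⟩ := h
      exact isDetectedBySplitting_of_smul_eq hΓ htrans ht hr hinv hM
    · exact isDetectedBySplitting_of_forall_ne hΓ htrans (fun t ht => h ⟨t, ht⟩) hr hinv hM
  rcases (show p = Γ.src q₀ ∨ p = Γ.tgt q₀ from hM.1) with rfl | rfl
  · exact key (Γ := Γ.flip) ⟨hΓ.tgt_smul, hΓ.src_smul⟩ (by rw [flip_adj]; exact hM)
  · exact key hΓ hM

end OneOrbit

end OrientedTree

/-! ### The axis of an element without fixed points, and collapsing to one orbit of edges -/

namespace OrientedTree

open TreeNode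

section Collapse

variable {P Q : Type*} {Γ : OrientedTree P Q} {G : Type*} [Group G] [MulAction G P] [MulAction G Q]

/-- An element without fixed vertices has an axis: a node with minimal displacement lies on it. -/
theorem exists_axis (hΓ : Γ.IsEquivariant G) {g : G} (hg : ∀ p : P, g • p ≠ p) (p₀ : P) :
    ∃ (q : Q) (p : P) (M : List (TreeNode P Q)),
      Reduced Γ.Adj (edge q :: vert p :: M ++ [edge (g • q), vert (g • p)]) := by
  classical
  have hgn : ∀ x : TreeNode P Q, g • x ≠ x := by
    rintro (p | q | p) h
    · exact hg p (by simpa using h)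
    · refine hg (Γ.src q) ?_
      rw [smul_edge] at h
      injection h with h
      rw [← hΓ.src_smul, h]
    · exact hg p (by simpa using h)
  have hex : ∃ n, ∃ x L, IsPath Γ.Adj x (g • x) L ∧ L.length = n := by
    obtain ⟨L, hL⟩ := Γ.isTreeAdj.exists_isPath (vert p₀) (g • vert p₀)
    exact ⟨_, _, L, hL, rfl⟩
  obtain ⟨x, L, hL, hlen⟩ := Nat.find_spec hex
  have hmin : ∀ x' L', IsPath Γ.Adj x' (g • x') L' → L.length ≤ L'.length := fun x' L' h => by
    rw [hlen]; exact Nat.find_min' hex ⟨x', L', h, rfl⟩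
  clear hlen
  obtain ⟨h1, h2, h3⟩ := hL
  rcases L with _ | ⟨a, L⟩
  · simp at h2
  obtain rfl : a = x := by simpa using h2
  rcases L.eq_nil_or_concat with rfl | ⟨N, b, rfl⟩
  · exact absurd (by simpa using h3) (hgn a).symm
  obtain rfl : b = g • a := by
    rw [List.concat_eq_append, ← List.cons_append, List.getLast?_concat] at h3
    exact Option.some.inj h3
  rw [List.concat_eq_append] at h1 hmin
  rcases N with _ | ⟨y, N⟩
  · exfalso
    have h4 := reduced_pair.1 h1
    rcases a with p | q | p <;> exact h4
  obtain ⟨N', z, hz⟩ : ∃ N' z, y :: N = N' ++ [z] := by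
    rcases (y :: N).eq_nil_or_concat with h | ⟨N', z, h⟩
    · simp at h
    · exact ⟨N', z, by rw [h, List.concat_eq_append]⟩
  -- a node next to `x` on the path to `g x` is moved at least as far as `x`
  have hzy : z ≠ g • y := by
    intro e
    have h5 : IsPath Γ.Adj y (g • y) (y :: N) := by
      refine ⟨?_, rfl, ?_⟩
      · exact (h1.tail : Reduced Γ.Adj ((y :: N) ++ [g • a])).left
      · rw [hz, List.getLast?_concat, e]
    have := hmin _ _ h5
    simp at this
  have hay : Γ.Adj a y := h1.1
  have hext : Reduced Γ.Adj (a :: y :: N ++ [g • a, g • y]) := by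
    have e1 : a :: y :: N ++ [g • a, g • y] = (a :: N') ++ z :: g • a :: g • y :: [] := by
      rw [List.cons_append, hz]; simp
    have e2 : a :: (y :: N ++ [g • a]) = (a :: N') ++ [z, g • a] := by rw [hz]; simp
    rw [e2] at h1
    rw [e1]
    rw [reduced_append]
    exact ⟨h1, reduced_triple.2 ⟨reduced_pair.1 h1.right, hzy, hΓ.adj_smul g _ _ hay⟩⟩
  have hzga : Γ.Adj z (g • a) := by
    have e2 : a :: (y :: N ++ [g • a]) = (a :: N') ++ [z, g • a] := by rw [hz]; simp
    rw [e2] at h1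
    exact reduced_pair.1 h1.right
  rcases a with p | q | p
  · rcases y with p' | q | p'
    · exact hay.elim
    · -- rotate the path by one step
      have h6 := hext.map (MulAction.injective g) (hΓ.adj_smul g)
      obtain ⟨w, M, hw⟩ : ∃ w M, N ++ [g • vert p] = w :: M :=
        List.exists_cons_of_ne_nil (by simp)
      have h7 : Reduced Γ.Adj (edge q :: w :: M ++ [g • edge q, g • w]) := by
        have e3 : edge q :: w :: M ++ [g • edge q, g • w] =
            (edge q :: N) ++ (g • vert p) :: (g • edge q) :: [g • w] := by
          rw [List.cons_append, ← hw]; simp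
        rw [e3, reduced_append]
        refine ⟨hext.tail, ?_⟩
        have e4 : (vert p :: edge q :: N ++ [g • vert p, g • edge q]).map (fun x => g • x) =
            [g • vert p, g • edge q, g • w] ++ (M ++ [g • edge q]).map (fun x => g • x) := by
          have : vert p :: edge q :: N ++ [g • vert p, g • edge q] =
              [vert p, edge q] ++ (N ++ [g • vert p]) ++ [g • edge q] := by simp
          rw [this, hw]
          simp
        rw [e4] at h6
        exact h6.left
      rcases w with p' | q' | p'
      · exact ⟨q, p', M, h7⟩
      · exact h7.1.elim
      · exact h7.1.elim
    · -- the path would turn back at a leaf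
      exfalso
      obtain rfl : p = p' := hay
      rcases N with _ | ⟨w, N⟩
      · obtain rfl : z = leaf p := by
          rcases N' with _ | ⟨_, N'⟩
          · simpa using hz.symm
          · simp at hz
        exact hg p (by simpa using hzga)
      · have h7 : Γ.Adj (leaf p) w := h1.tail.1
        rcases w with w | w | w
        · exact h1.2.1 (vert w) (by simp) (by rw [show w = p from h7])
        · exact h7.elim
        · exact h7.elim
  · rcases y with p | q' | p
    · exact ⟨q, p, N, hext⟩
    · exact hay.elim
    · exact hay.elim
  · exfalso
    rcases y with p' | q' | p'
    · obtain rfl : p' = p := hay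
      rcases z with p | q | p
      · exact hzy (by rw [show p = g • p' from hzga]; rfl)
      · exact hzga.elim
      · exact hzga.elim
    · exact hay.elim
    · exact hay.elim

theorem IsEquivariant.pot_smul_sub (hΓ : Γ.IsEquivariant G) (g : G) (p p' : P) (q : Q) :
    Γ.pot (g • p') (g • q) - Γ.pot (g • p) (g • q) = Γ.pot p' q - Γ.pot p q := by
  induction Γ.conn p p' with
  | rel a b h =>
    obtain ⟨q', rfl, rfl⟩ := h
    rw [← hΓ.src_smul, ← hΓ.tgt_smul]
    by_cases h : q' = q
    · subst h
      rw [Γ.pot_tgt_self, Γ.pot_tgt_self]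
      ring
    · rw [Γ.pot_tgt_of_ne _ _ h, Γ.pot_tgt_of_ne _ _ fun e => h (smul_left_cancel g e)]
      ring
  | refl => simp
  | symm _ _ _ ih => linarith
  | trans _ _ _ _ _ h1 h2 => linarith

/-- A path between vertices that contains an edge separates them. -/
theorem pot_ne_of_mem {p p' : P} {q : Q} {L : List (TreeNode P Q)}
    (hL : IsPath Γ.Adj (vert p) (vert p') L) (hq : edge q ∈ L) : Γ.pot p q ≠ Γ.pot p' q := by
  obtain ⟨h1, h2, h3⟩ := hL
  obtain ⟨A, B, rfl⟩ := List.append_of_mem hq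
  rcases A.eq_nil_or_concat with rfl | ⟨A, a, rfl⟩
  · simp at h2
  rcases B with _ | ⟨b, B⟩
  · simp at h3
  rw [List.concat_eq_append] at h1 h2
  have e : A ++ [a] ++ edge q :: b :: B = A ++ a :: edge q :: b :: B := by simp
  rw [e, reduced_append] at h1
  obtain ⟨h4, h5⟩ := h1
  have n1 : edge q ∉ A ++ [a] := Γ.isTreeAdj.notMem_init (by simpa using h4)
  have n2 : edge q ∉ b :: B := Γ.isTreeAdj.notMem_tail h5.tail
  have c1 : Γ.nodePot q 0 (vert p) = Γ.nodePot q 0 a := by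
    rcases A with _ | ⟨a', A⟩
    · obtain rfl : a = vert p := by simpa using h2
      rfl
    · obtain rfl : a' = vert p := by simpa using h2
      refine Γ.nodePot_eq_of_isChain (l := A ++ [a]) ?_ ?_ n1
      · have : vert p :: A ++ [a, edge q] = (vert p :: (A ++ [a])) ++ [edge q] := by simp
        rw [this] at h4
        exact h4.left.isChain
      · rw [← List.cons_append, List.getLast?_concat]
  have c2 : Γ.nodePot q 0 b = Γ.nodePot q 0 (vert p') := by
    refine Γ.nodePot_eq_of_isChain (l := B) h5.tail.tail.isChain ?_ n2
    rw [← h3]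
    rw [List.getLast?_append_cons, List.getLast?_cons_cons]
  obtain ⟨h6, h7, h8⟩ := reduced_triple.1 (Reduced.left (B := B) (A := [a, edge q, b]) h5)
  rcases a with a | a | a
  · rcases b with b | b | b
    · simp only [nodePot] at c1 c2
      have := Γ.pot_tgt_self q
      rw [c1, ← c2]
      rcases (h6 : a = Γ.src q ∨ a = Γ.tgt q) with rfl | rfl <;>
        rcases (h8 : b = Γ.src q ∨ b = Γ.tgt q) with rfl | rfl
      · exact absurd rfl h7
      · omega
      · omega
      · exact absurd rfl h7
    · exact h8.elim
    · exact h8.elim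
  · exact h6.elim
  · exact h6.elim

/-- Two vertices are identified if no edge of the orbit of `q₀` separates them. -/
def collapseSetoid (Γ : OrientedTree P Q) (G : Type*) [Group G] [MulAction G Q] (q₀ : Q) :
    Setoid P where
  r p p' := ∀ q ∈ MulAction.orbit G q₀, Γ.pot p q = Γ.pot p' q
  iseqv := ⟨fun _ _ _ => rfl, fun h q hq => (h q hq).symm,
    fun h h' q hq => (h q hq).trans (h' q hq)⟩

/-- The tree that results from collapsing all edges outside the orbit of `q₀`. -/
def collapse (Γ : OrientedTree P Q) (G : Type*) [Group G] [MulAction G Q] (q₀ : Q) :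
    OrientedTree (Quotient (Γ.collapseSetoid G q₀)) (MulAction.orbit G q₀) where
  src q := Quotient.mk _ (Γ.src q)
  tgt q := Quotient.mk _ (Γ.tgt q)
  pot p q := Quotient.lift (fun p => Γ.pot p q) (fun a b (h : (Γ.collapseSetoid G q₀).r a b) => h q q.2) p
  pot_tgt_self q := Γ.pot_tgt_self q
  pot_tgt_of_ne q q' h := Γ.pot_tgt_of_ne q q' fun e => h (Subtype.ext e)
  conn := by
    rintro ⟨p⟩ ⟨p'⟩
    change Relation.EqvGen _ (Quotient.mk (Γ.collapseSetoid G q₀) p)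
      (Quotient.mk (Γ.collapseSetoid G q₀) p')
    induction Γ.conn p p' with
    | rel a b h =>
      obtain ⟨q, rfl, rfl⟩ := h
      by_cases hq : q ∈ MulAction.orbit G q₀
      · exact .rel _ _ ⟨⟨q, hq⟩, rfl, rfl⟩
      · rw [Quotient.sound (a := Γ.src q) (b := Γ.tgt q) (s := Γ.collapseSetoid G q₀)
          fun q' hq' => (Γ.pot_tgt_of_ne q q' fun e => hq (e ▸ hq')).symm]
        exact .refl _
    | refl => exact .refl _
    | symm _ _ _ ih => exact .symm _ _ ih
    | trans _ _ _ _ _ h1 h2 => exact .trans _ _ _ h1 h2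

/-- The action on the vertices of the collapsed tree. -/
abbrev collapseAction (hΓ : Γ.IsEquivariant G) (q₀ : Q) :
    MulAction G (Quotient (Γ.collapseSetoid G q₀)) where
  smul g := Quotient.map (fun p => g • p) fun p p' h q hq => by
    have h1 := hΓ.pot_smul_sub g p p' (g⁻¹ • q)
    rw [smul_inv_smul] at h1
    have h2 := h (g⁻¹ • q) (by
      obtain ⟨k, rfl⟩ := hq
      exact ⟨g⁻¹ * k, mul_smul _ _ _⟩)
    omega
  one_smul := by
    rintro ⟨p⟩
    exact congrArg (Quotient.mk _) (one_smul G p)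
  mul_smul g h := by
    rintro ⟨p⟩
    exact congrArg (Quotient.mk _) (mul_smul g h p)

/-- An element without fixed vertices, for an action on a tree with an invariant order on the edges,
is detected by a splitting over the stabilizer of an edge. -/
theorem exists_isDetectedBySplitting (hΓ : Γ.IsEquivariant G) {r : Q → Q → Prop}
    (hr : IsStrictTotalOrder Q r) (hinv : ∀ (g : G) q q', r (g • q) (g • q') ↔ r q q')
    {g : G} (hg : ∀ p : P, g • p ≠ p) (p₀ : P) :
    ∃ q₀ : Q, IsDetectedBySplitting g (MulAction.stabilizer G q₀) := by
  obtain ⟨q₀, p, M, hM⟩ := exists_axis hΓ hg p₀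
  refine ⟨q₀, ?_⟩
  let := collapseAction hΓ q₀
  let ε : MulAction.orbit G q₀ := ⟨q₀, MulAction.mem_orbit_self q₀⟩
  have hΓ' : (Γ.collapse G q₀).IsEquivariant G :=
    ⟨fun g q => congrArg (Quotient.mk _) (hΓ.src_smul g q),
      fun g q => congrArg (Quotient.mk _) (hΓ.tgt_smul g q)⟩
  have htrans : ∀ q : MulAction.orbit G q₀, ∃ g : G, q = g • ε := by
    rintro ⟨_, h, rfl⟩
    exact ⟨h, rfl⟩
  have hr' : IsStrictTotalOrder (MulAction.orbit G q₀) fun q q' => r q q' := by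
    have htri := hr.trichotomous
    have hirr := hr.irrefl
    have htr := hr.trans
    exact { trichotomous := fun q q' h h' => Subtype.ext (htri _ _ h h')
            irrefl := fun q => hirr _
            trans := fun q q' q'' => htr _ _ _ }
  have hstab : MulAction.stabilizer G ε = MulAction.stabilizer G q₀ := by
    ext h
    simp only [MulAction.mem_stabilizer_iff]
    exact Subtype.ext_iff
  rw [← hstab]
  -- the last vertex of the axis before `g q₀`
  obtain ⟨N, z, hz⟩ : ∃ N z, vert p :: M = N ++ [z] := by
    rcases (vert p :: M).eq_nil_or_concat with h | ⟨N', z, h⟩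
    · simp at h
    · exact ⟨N', z, by rw [h, List.concat_eq_append]⟩
  have hM' : Reduced Γ.Adj ((edge q₀ :: N) ++ z :: edge (g • q₀) :: [vert (g • p)]) := by
    have e : (edge q₀ :: N) ++ z :: edge (g • q₀) :: [vert (g • p)] =
        edge q₀ :: vert p :: M ++ [edge (g • q₀), vert (g • p)] := by
      rw [List.cons_append, List.cons_append, hz]
      simp
    rw [e]; exact hM
  obtain ⟨c1, c2, c3⟩ := reduced_triple.1 hM'.right
  rcases z with z | z | z
  rotate_left
  · exact c1.elim
  · exact c1.elim
  have hch : (vert p :: M).IsChain Γ.Adj := by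
    have : ((vert p :: M) ++ [edge (g • q₀), vert (g • p)]).IsChain Γ.Adj := hM.tail.isChain
    exact this.left_of_append
  have hlast : (vert p :: M).getLast? = some (vert z) := by rw [hz, List.getLast?_concat]
  have n1 : edge q₀ ∉ vert p :: M ++ [edge (g • q₀), vert (g • p)] :=
    Γ.isTreeAdj.notMem_tail hM
  have n2 : edge (g • q₀) ∉ vert p :: M := by
    have h : Reduced Γ.Adj ((vert p :: M) ++ [edge (g • q₀)] ++ [vert (g • p)]) := by
      simpa using hM.tail
    exact Γ.isTreeAdj.notMem_init h.left
  have p1 : Γ.pot p q₀ = Γ.pot z q₀ := Γ.nodePot_eq_of_isChain (c := 0) hch hlast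
    fun h => n1 (List.mem_append_left _ h)
  have p2 : Γ.pot p (g • q₀) = Γ.pot z (g • q₀) :=
    Γ.nodePot_eq_of_isChain (c := 0) hch hlast n2
  let π : P → Quotient (Γ.collapseSetoid G q₀) := Quotient.mk _
  -- the path between the images of the endpoints avoids `q₀` and `g q₀`
  obtain ⟨L, hL⟩ := (Γ.collapse G q₀).isTreeAdj.exists_isPath (vert (π p)) (vert (π z))
  have m1 : edge ε ∉ L := fun h => pot_ne_of_mem hL h p1
  have m2 : edge (g • ε) ∉ L := fun h => pot_ne_of_mem hL h p2
  have hne : ε ≠ g • ε := by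
    intro e
    have e' : q₀ = g • q₀ := congrArg Subtype.val e
    exact n1 (by simp [← e'])
  have hpz : π z ≠ π (g • p) := by
    intro e
    have e' := Quotient.exact e (g • q₀) ⟨g, rfl⟩
    have := Γ.pot_tgt_self (g • q₀)
    rcases (c1 : z = Γ.src (g • q₀) ∨ z = Γ.tgt (g • q₀)) with rfl | rfl <;>
      rcases (c3 : g • p = Γ.src (g • q₀) ∨ g • p = Γ.tgt (g • q₀)) with e | e
    · exact c2 (by rw [e])
    · rw [e] at e'; omega
    · rw [e] at e'; omega
    · exact c2 (by rw [e])
  have a0 : (Γ.collapse G q₀).Adj (edge ε) (vert (π p)) := by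
    rcases (hM.1 : p = Γ.src q₀ ∨ p = Γ.tgt q₀) with e | e
    · exact Or.inl (congrArg π e)
    · exact Or.inr (congrArg π e)
  have a1 : (Γ.collapse G q₀).Adj (vert (π z)) (edge (g • ε)) := by
    rcases (c1 : z = Γ.src (g • q₀) ∨ z = Γ.tgt (g • q₀)) with e | e
    · exact Or.inl (congrArg π e)
    · exact Or.inr (congrArg π e)
  have a2 : (Γ.collapse G q₀).Adj (edge (g • ε)) (vert (g • π p)) := hΓ'.adj_smul g _ _ a0
  obtain ⟨l1, l2, l3⟩ := hL
  rcases L with _ | ⟨x, L⟩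
  · simp at l2
  obtain rfl : x = vert (π p) := by simpa using l2
  refine isDetectedBySplitting_of_axis hΓ' htrans hr' (fun h q q' => hinv h q q')
    (p := π p) (M := L) ?_
  have s1 : Reduced (Γ.collapse G q₀).Adj (edge ε :: vert (π p) :: L) := by
    rw [reduced_cons_cons]
    refine ⟨a0, ?_, l1⟩
    intro w hw e
    refine m1 (List.mem_cons_of_mem _ (e ▸ List.mem_of_mem_head? hw))
  obtain ⟨K, w, hw⟩ : ∃ K w, edge ε :: vert (π p) :: L = K ++ [w, vert (π z)] ∧
      w ≠ edge (g • ε) := by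
    rcases L.eq_nil_or_concat with rfl | ⟨L, w, rfl⟩
    · refine ⟨[], edge ε, ?_, fun e => hne (by injection e)⟩
      have : π p = π z := by simpa using l3
      rw [this]; rfl
    · rw [List.concat_eq_append, ← List.cons_append, List.getLast?_concat] at l3
      obtain rfl : w = vert (π z) := Option.some.inj l3
      rw [List.concat_eq_append] at m2 ⊢
      rcases (vert (π p) :: L).eq_nil_or_concat with h | ⟨K, w, h⟩
      · simp at h
      · rw [List.concat_eq_append] at h
        rw [← List.cons_append, h] at m2 ⊢
        exact ⟨edge ε :: K, w, by simp, fun e => m2 (by simp [e])⟩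
  have e1 : edge ε :: vert (π p) :: L ++ [edge (g • ε), vert (g • π p)] =
      K ++ w :: vert (π z) :: [edge (g • ε), vert (g • π p)] := by
    rw [hw.1]; simp
  rw [hw.1] at s1
  rw [e1, reduced_append]
  refine ⟨s1, ?_⟩
  rw [reduced_cons_cons, reduced_triple]
  refine ⟨reduced_pair.1 s1.right, by simpa using hw.2, a1, ?_, a2⟩
  intro e
  injection e with e
  exact hpz e

end Collapse

end OrientedTree

/-! ### Potentials on trees -/

section Potential

/-- The product of the values of a function on the successive steps of a walk. -/
def SimpleGraph.Walk.stepProd {V A : Type*} [Group A] {Γ : SimpleGraph V} (c : V → V → A) :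
    ∀ {u v : V}, Γ.Walk u v → A
  | _, _, .nil => 1
  | u, _, .cons (v := v) _ p => c u v * p.stepProd c

theorem SimpleGraph.Walk.stepProd_concat {V A : Type*} [Group A] {Γ : SimpleGraph V}
    (c : V → V → A) {u v w : V} (p : Γ.Walk u v) (h : Γ.Adj v w) :
    (p.concat h).stepProd c = p.stepProd c * c v w := by
  induction p with
  | nil => simp [SimpleGraph.Walk.stepProd, SimpleGraph.Walk.concat_nil]
  | cons h' p ih => simp only [SimpleGraph.Walk.concat_cons, SimpleGraph.Walk.stepProd, ih, mul_assoc]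

/-- On a tree, every function on the edges with values in a group has a potential. -/
theorem GraphOfGroups.IsSpanningTree.exists_potential {V E A : Type*} [Group A]
    {𝒢 : GraphOfGroups V E} {T : Set E} (hT : 𝒢.IsSpanningTree T) (d : E → A) :
    ∃ α : V → A, ∀ e ∈ T, α (𝒢.tgt e) = α (𝒢.src e) * d e := by
  classical
  obtain ⟨hloop, hinj, htree⟩ := hT
  let c : V → V → A := fun u v =>
    if h : ∃ e ∈ T, 𝒢.src e = u ∧ 𝒢.tgt e = v then d h.choose
    else if h : ∃ e ∈ T, 𝒢.src e = v ∧ 𝒢.tgt e = u then (d h.choose)⁻¹ else 1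
  have hsome : ∀ e ∈ T, ∀ h : ∃ e' ∈ T, 𝒢.src e' = 𝒢.src e ∧ 𝒢.tgt e' = 𝒢.tgt e,
      h.choose = e := by
    intro e he h
    obtain ⟨h1, h2, h3⟩ := h.choose_spec
    refine hinj h1 he ?_
    simp only [h2, h3]
  have hfwd : ∀ e ∈ T, c (𝒢.src e) (𝒢.tgt e) = d e := by
    intro e he
    have h : ∃ e' ∈ T, 𝒢.src e' = 𝒢.src e ∧ 𝒢.tgt e' = 𝒢.tgt e := ⟨e, he, rfl, rfl⟩
    simp only [c, dif_pos h, hsome e he h]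
  have hbwd : ∀ e ∈ T, c (𝒢.tgt e) (𝒢.src e) = (d e)⁻¹ := by
    intro e he
    have h : ∃ e' ∈ T, 𝒢.src e' = 𝒢.src e ∧ 𝒢.tgt e' = 𝒢.tgt e := ⟨e, he, rfl, rfl⟩
    have h' : ¬ ∃ e' ∈ T, 𝒢.src e' = 𝒢.tgt e ∧ 𝒢.tgt e' = 𝒢.src e := by
      rintro ⟨e', he', h1, h2⟩
      have : e' = e := hinj he' he (by simp only [h1, h2]; exact Sym2.eq_swap)
      subst this
      exact hloop e' he' h1
    simp only [c, dif_neg h', dif_pos h, hsome e he h]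
  let root : V := htree.connected.nonempty.some
  choose p hp _ using htree.existsUnique_path root
  refine ⟨fun v => (p v).stepProd c, fun e he => ?_⟩
  have hadj : (SimpleGraph.fromEdgeSet ((fun e => s(𝒢.src e, 𝒢.tgt e)) '' T)).Adj
      (𝒢.src e) (𝒢.tgt e) := by
    rw [SimpleGraph.fromEdgeSet_adj]
    exact ⟨⟨e, he, rfl⟩, hloop e he⟩
  simp only
  by_cases h : 𝒢.src e ∈ (p (𝒢.tgt e)).support
  · rw [htree.isAcyclic.path_concat (hp _) (hp _) hadj h, SimpleGraph.Walk.stepProd_concat,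
      hfwd e he]
  · rw [htree.isAcyclic.path_concat (hp _) (hp _) hadj.symm
      (htree.isAcyclic.mem_support_of_ne_mem_support_of_adj_of_isPath (hp _) (hp _) hadj h),
      SimpleGraph.Walk.stepProd_concat, hbwd e he, inv_mul_cancel_right]

end Potential

/-! ### The fundamental group of a graph of groups -/

namespace GraphOfGroups

section Lift

variable {V E : Type*} {𝒢 : GraphOfGroups V E} {T : Set E}

/-- The element of the fundamental group given by an edge. -/
def ofEdge (𝒢 : GraphOfGroups V E) (T : Set E) (e : E) : 𝒢.FundamentalGroup T :=
  QuotientGroup.mk' _ (𝒢.edgeElt e)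

theorem ofEdge_mul (e : E) (c : 𝒢.eGroup e) :
    𝒢.ofEdge T e * 𝒢.ofVertex T (𝒢.tgt e) (𝒢.tgtHom e c) =
      𝒢.ofVertex T (𝒢.src e) (𝒢.srcHom e c) * 𝒢.ofEdge T e := by
  have h : 𝒢.edgeElt e * 𝒢.vertexIncl (𝒢.tgt e) (𝒢.tgtHom e c) *
      (𝒢.edgeElt e)⁻¹ * (𝒢.vertexIncl (𝒢.src e) (𝒢.srcHom e c))⁻¹ ∈
      Subgroup.normalClosure (𝒢.relators T) :=
    Subgroup.subset_normalClosure (Or.inl ⟨e, c, rfl⟩)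
  have h2 := (QuotientGroup.eq_one_iff _).2 h
  have h3 : 𝒢.ofEdge T e * 𝒢.ofVertex T (𝒢.tgt e) (𝒢.tgtHom e c) *
      (𝒢.ofEdge T e)⁻¹ * (𝒢.ofVertex T (𝒢.src e) (𝒢.srcHom e c))⁻¹ = 1 := h2
  rwa [mul_inv_eq_one, mul_inv_eq_iff_eq_mul] at h3

theorem ofEdge_eq_one {e : E} (he : e ∈ T) : 𝒢.ofEdge T e = 1 :=
  (QuotientGroup.eq_one_iff _).2 (Subgroup.subset_normalClosure (Or.inr ⟨e, he, rfl⟩))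

/-- The universal property of the fundamental group. -/
theorem exists_lift {H : Type*} [Group H] (f : ∀ v, 𝒢.vGroup v →* H) (b : E → H)
    (hb : ∀ e c, b e * f (𝒢.tgt e) (𝒢.tgtHom e c) = f (𝒢.src e) (𝒢.srcHom e c) * b e)
    (hT : ∀ e ∈ T, b e = 1) :
    ∃ F : 𝒢.FundamentalGroup T →* H, (∀ v x, F (𝒢.ofVertex T v x) = f v x) ∧
      ∀ e, F (𝒢.ofEdge T e) = b e := by
  let F₀ : 𝒢.BigFreeProduct →* H :=
    Monoid.Coprod.lift (Monoid.CoprodI.lift f) (FreeGroup.lift b)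
  have hv : ∀ v x, F₀ (𝒢.vertexIncl v x) = f v x := by
    intro v x
    simp [F₀, vertexIncl]
  have he : ∀ e, F₀ (𝒢.edgeElt e) = b e := by
    intro e
    simp [F₀, edgeElt]
  have hle : Subgroup.normalClosure (𝒢.relators T) ≤ F₀.ker := by
    refine Subgroup.normalClosure_le_normal ?_
    rintro _ (⟨e, c, rfl⟩ | ⟨e, h, rfl⟩)
    · change F₀ _ = 1
      rw [map_mul, map_mul, map_mul, map_inv, map_inv, hv, hv, he, hb, mul_inv_cancel_right,
        mul_inv_cancel]
    · exact (he e).trans (hT e h)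
  exact ⟨QuotientGroup.lift _ F₀ hle, hv, he⟩

theorem mem_of_generators (S : Subgroup (𝒢.FundamentalGroup T))
    (hv : ∀ v x, 𝒢.ofVertex T v x ∈ S) (he : ∀ e, 𝒢.ofEdge T e ∈ S)
    (g : 𝒢.FundamentalGroup T) : g ∈ S := by
  induction g using QuotientGroup.induction_on with | _ g => ?_
  induction g using Monoid.Coprod.induction_on with
  | inl m =>
    induction m using Monoid.CoprodI.induction_on with
    | one => rw [map_one]; exact one_mem S
    | of v x => exact hv v x
    | mul x y hx hy => rw [map_mul]; exact mul_mem hx hy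
  | inr n =>
    induction n using FreeGroup.induction_on with
    | C1 => rw [map_one]; exact one_mem S
    | of e => exact he e
    | inv_of e h => rw [map_inv]; exact inv_mem h
    | mul x y hx hy => rw [map_mul]; exact mul_mem hx hy
  | mul x y hx hy => exact mul_mem hx hy

end Lift

/-! ### Vertex groups embed in the fundamental group -/

section Injective

open Cardinal in
theorem nonempty_prod_equiv {X Z : Type*} [Nonempty X] [Infinite Z] (i : X ↪ Z) :
    Nonempty (X × Z ≃ Z) := by
  obtain ⟨e⟩ : Nonempty (Z × Z ≃ Z) := by
    rw [← Cardinal.eq, Cardinal.mk_prod, Cardinal.lift_id]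
    exact Cardinal.mul_eq_self (Cardinal.aleph0_le_mk Z)
  exact Function.Embedding.antisymm ((i.prodMap (.refl Z)).trans e.toEmbedding)
    ⟨fun z => (Classical.arbitrary X, z), fun z z' h => (Prod.ext_iff.1 h).2⟩

/-- The action of a group by left multiplication on infinitely many copies of itself restricts to a
subgroup as infinitely many copies of the subgroup. -/
theorem exists_equivariant_equiv {C K Z : Type*} [Group C] [Group K] [Infinite Z] {j : C →* K}
    (hj : Function.Injective j) (i : K ↪ Z) (ψ : K × Z ≃ Z) :
    ∃ θ : Z ≃ C × Z, ∀ c z, θ (ψ (j c * (ψ.symm z).1, (ψ.symm z).2)) = (c * (θ z).1, (θ z).2) := by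
  obtain ⟨R, hR, h1⟩ := Subgroup.exists_isComplement_right j.range 1
  have : Nonempty R := ⟨⟨1, h1⟩⟩
  obtain ⟨χ⟩ := nonempty_prod_equiv (X := R) ((Function.Embedding.subtype _).trans i)
  let κ : C ≃* j.range := MonoidHom.ofInjective hj
  refine ⟨ψ.symm.trans ((hR.equiv.prodCongr (.refl Z)).trans ((Equiv.prodAssoc _ _ _).trans
    (κ.toEquiv.symm.prodCongr χ))), fun c z => ?_⟩
  have h2 : hR.equiv (j c * (ψ.symm z).1) =
      (κ c * (hR.equiv (ψ.symm z).1).1, (hR.equiv (ψ.symm z).1).2) :=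
    Subgroup.IsComplement.equiv_mul_left hR (κ c) _
  simp only [Equiv.trans_apply, Equiv.symm_apply_apply, Equiv.prodCongr_apply, Prod.map,
    Equiv.prodAssoc_apply, Equiv.refl_apply, h2]
  simp only [MulEquiv.toEquiv_eq_coe, MulEquiv.coe_toEquiv_symm, map_mul,
    MulEquiv.symm_apply_apply]

variable {V E : Type*} {𝒢 : GraphOfGroups V E} {T : Set E}

/-- All vertex groups act freely on a set `Z`, with equally many orbits, so the two actions of an edge
group on `Z` are conjugate, and the conjugating permutations extend the actions to the fundamental
group. -/
theorem ofVertex_injective (hT : 𝒢.IsSpanningTree T) (v : V) :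
    Function.Injective (𝒢.ofVertex T v) := by
  have : Nonempty V := ⟨v⟩
  let Z := (Σ v, 𝒢.vGroup v) × ℕ
  have : Nonempty (Σ v, 𝒢.vGroup v) := ⟨⟨v, 1⟩⟩
  have i : ∀ v, 𝒢.vGroup v ↪ Z := fun v =>
    ⟨fun x => (⟨v, x⟩, 0), fun x y h => eq_of_heq (Sigma.mk.inj (Prod.ext_iff.1 h).1).2⟩
  have ψ : ∀ v, 𝒢.vGroup v × Z ≃ Z := fun v => (nonempty_prod_equiv (i v)).some
  -- free actions of the vertex groups on `Z`
  let L : ∀ v, 𝒢.vGroup v →* Equiv.Perm Z := fun v =>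
    { toFun := fun x => (ψ v).permCongr ((Equiv.mulLeft x).prodCongr (.refl Z))
      map_one' := by ext z : 1; simp [Equiv.permCongr_apply]
      map_mul' := fun x y => by ext z : 1; simp [Equiv.permCongr_apply, Prod.map] }
  have hL : ∀ v x z, L v x z = ψ v (x * ((ψ v).symm z).1, ((ψ v).symm z).2) := fun v x z => rfl
  choose θs hs using fun e => exists_equivariant_equiv (𝒢.srcHom_injective e) (i _) (ψ _)
  choose θt ht using fun e => exists_equivariant_equiv (𝒢.tgtHom_injective e) (i _) (ψ _)
  let b : E → Equiv.Perm Z := fun e => (θt e).trans (θs e).symm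
  have hb : ∀ e c, b e * L (𝒢.tgt e) (𝒢.tgtHom e c) = L (𝒢.src e) (𝒢.srcHom e c) * b e := by
    intro e c
    ext z : 1
    rw [Equiv.Perm.mul_apply, Equiv.Perm.mul_apply, hL, hL]
    simp only [b, Equiv.trans_apply]
    rw [Equiv.symm_apply_eq, ht, hs, Equiv.apply_symm_apply]
  -- conjugation by a potential makes the edges of the tree act trivially
  obtain ⟨α, hα⟩ := hT.exists_potential b
  obtain ⟨F, hF, -⟩ := exists_lift (𝒢 := 𝒢) (T := T)
    (fun v => (MulAut.conj (α v)).toMonoidHom.comp (L v))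
    (fun e => α (𝒢.src e) * b e * (α (𝒢.tgt e))⁻¹)
    (by
      intro e c
      have := hb e c
      simp only [MonoidHom.comp_apply, MulEquiv.coe_toMonoidHom, MulAut.conj_apply]
      calc _ = α (𝒢.src e) * (b e * L (𝒢.tgt e) (𝒢.tgtHom e c)) * (α (𝒢.tgt e))⁻¹ := by group
        _ = _ := by rw [this]; group)
    (by
      intro e he
      rw [hα e he, mul_inv_cancel])
  rw [injective_iff_map_eq_one]
  intro x hx
  have h1 := hF v x
  rw [hx, map_one] at h1
  have h2 : L v x = 1 := (MulAut.conj (α v)).injective (h1.symm.trans (map_one _).symm)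
  have h3 := congrArg (fun p : Equiv.Perm Z => p (ψ v (1, Classical.arbitrary Z))) h2
  simp only [hL, Equiv.symm_apply_apply, mul_one, Equiv.Perm.one_apply,
    EmbeddingLike.apply_eq_iff_eq] at h3
  exact (Prod.ext_iff.1 h3).1

end Injective

end GraphOfGroups

/-! ### The Bass–Serre tree -/

namespace GraphOfGroups

section BassSerre

variable {V E : Type*} (𝒢 : GraphOfGroups V E) (T : Set E)

/-- The vertices of the Bass–Serre tree: the cosets of the vertex groups. -/
abbrev TreeVertex : Type _ := Σ v, 𝒢.FundamentalGroup T ⧸ (𝒢.ofVertex T v).range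

/-- The edges of the Bass–Serre tree: the cosets of the edge groups. -/
abbrev TreeEdge : Type _ := Σ e, 𝒢.FundamentalGroup T ⧸ 𝒢.edgeSubgroup T e

variable {𝒢 T}

/-- The vertex given by a coset representative. -/
def treeVertex (v : V) (g : 𝒢.FundamentalGroup T) : 𝒢.TreeVertex T := ⟨v, (g : _ ⧸ _)⟩

/-- The edge given by a coset representative. -/
def treeEdge (e : E) (g : 𝒢.FundamentalGroup T) : 𝒢.TreeEdge T := ⟨e, (g : _ ⧸ _)⟩

theorem smul_treeVertex (v : V) (g h : 𝒢.FundamentalGroup T) :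
    h • treeVertex v g = treeVertex v (h * g) := rfl

theorem smul_treeEdge (e : E) (g h : 𝒢.FundamentalGroup T) :
    h • treeEdge e g = treeEdge e (h * g) := rfl

theorem treeVertex_eq_iff {v : V} {g h : 𝒢.FundamentalGroup T} :
    treeVertex v g = treeVertex v h ↔ ∃ x, g⁻¹ * h = 𝒢.ofVertex T v x := by
  simp only [treeVertex, Sigma.mk.injEq, heq_eq_eq, true_and, QuotientGroup.eq, MonoidHom.mem_range,
    eq_comm]

theorem treeEdge_eq_iff {e : E} {g h : 𝒢.FundamentalGroup T} :
    treeEdge e g = treeEdge e h ↔ ∃ c, g⁻¹ * h = 𝒢.ofVertex T (𝒢.tgt e) (𝒢.tgtHom e c) := by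
  rw [treeEdge, treeEdge, Sigma.mk.inj_iff]
  simp only [heq_eq_eq, true_and]
  rw [QuotientGroup.eq, edgeSubgroup, MonoidHom.mem_range]
  simp only [MonoidHom.comp_apply, eq_comm]

theorem exists_treeVertex (p : 𝒢.TreeVertex T) : ∃ v g, p = treeVertex v g := by
  obtain ⟨v, p⟩ := p
  induction p using QuotientGroup.induction_on with | _ g => exact ⟨v, g, rfl⟩

theorem exists_treeEdge (q : 𝒢.TreeEdge T) : ∃ e g, q = treeEdge e g := by
  obtain ⟨e, q⟩ := q
  induction q using QuotientGroup.induction_on with | _ g => exact ⟨e, g, rfl⟩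

theorem ofEdge_conj (e : E) (c : 𝒢.eGroup e) :
    𝒢.ofEdge T e * 𝒢.ofVertex T (𝒢.tgt e) (𝒢.tgtHom e c) * (𝒢.ofEdge T e)⁻¹ =
      𝒢.ofVertex T (𝒢.src e) (𝒢.srcHom e c) := by
  rw [ofEdge_mul, mul_inv_cancel_right]

/-- The origin of an edge of the Bass–Serre tree. As `e t_e(c) e⁻¹ = o_e(c)` and the edge groups are
taken as subgroups of the groups at their ends, the origin of `g G_e` is `g e⁻¹ G_{o(e)}`. -/
def treeSrc (q : 𝒢.TreeEdge T) : 𝒢.TreeVertex T :=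
  ⟨𝒢.src q.1, Quotient.map' (fun g => g * (𝒢.ofEdge T q.1)⁻¹) (by
    intro a b h
    rw [QuotientGroup.leftRel_apply] at h ⊢
    obtain ⟨c, hc⟩ := h
    refine ⟨𝒢.srcHom q.1 c, ?_⟩
    rw [← ofEdge_conj]
    rw [MonoidHom.comp_apply] at hc
    rw [hc]
    group) q.2⟩

/-- The end of an edge of the Bass–Serre tree. -/
def treeTgt (q : 𝒢.TreeEdge T) : 𝒢.TreeVertex T :=
  ⟨𝒢.tgt q.1, Quotient.map' id (by
    intro a b h
    rw [QuotientGroup.leftRel_apply] at h ⊢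
    obtain ⟨c, hc⟩ := h
    exact ⟨𝒢.tgtHom q.1 c, hc⟩) q.2⟩

theorem treeSrc_treeEdge (e : E) (g : 𝒢.FundamentalGroup T) :
    treeSrc (treeEdge e g) = treeVertex (𝒢.src e) (g * (𝒢.ofEdge T e)⁻¹) := rfl

theorem treeTgt_treeEdge (e : E) (g : 𝒢.FundamentalGroup T) :
    treeTgt (treeEdge e g) = treeVertex (𝒢.tgt e) g := rfl

/-- The vertices of the Bass–Serre tree are connected by edges. -/
theorem tree_connected (hT : 𝒢.IsSpanningTree T) (p p' : 𝒢.TreeVertex T) :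
    Relation.EqvGen (fun a b => ∃ q, treeSrc q = a ∧ treeTgt q = b) p p' := by
  set R : 𝒢.TreeVertex T → 𝒢.TreeVertex T → Prop :=
    Relation.EqvGen fun a b => ∃ q, treeSrc q = a ∧ treeTgt q = b with hR
  have hrefl : ∀ a, R a a := fun a => .refl a
  have hsymm : ∀ {a b}, R a b → R b a := fun h => .symm _ _ h
  have htrans : ∀ {a b c}, R a b → R b c → R a c := fun h h' => .trans _ _ _ h h'
  have hedge : ∀ e g, R (treeVertex (𝒢.src e) (g * (𝒢.ofEdge T e)⁻¹)) (treeVertex (𝒢.tgt e) g) :=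
    fun e g => .rel _ _ ⟨treeEdge e g, rfl, rfl⟩
  have hsmul : ∀ (g : 𝒢.FundamentalGroup T) {a b}, R a b → R (g • a) (g • b) := by
    intro g a b h
    induction h with
    | rel a b h =>
      obtain ⟨q, rfl, rfl⟩ := h
      obtain ⟨e, k, rfl⟩ := exists_treeEdge q
      have := hedge e (g * k)
      rwa [mul_assoc] at this
    | refl => exact hrefl _
    | symm _ _ _ ih => exact hsymm ih
    | trans _ _ _ _ _ h1 h2 => exact htrans h1 h2
  have hbase : ∀ v w : V, R (treeVertex v 1) (treeVertex w 1) := by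
    intro v w
    obtain ⟨p⟩ := hT.2.2.connected v w
    induction p with
    | nil => exact hrefl _
    | cons h _ ih =>
      refine htrans ?_ ih
      rw [SimpleGraph.fromEdgeSet_adj] at h
      obtain ⟨⟨e, he, h1⟩, -⟩ := h
      have h2 := hedge e 1
      rw [ofEdge_eq_one he, inv_one, mul_one] at h2
      rcases Sym2.eq_iff.1 h1 with ⟨rfl, rfl⟩ | ⟨rfl, rfl⟩
      · exact h2
      · exact hsymm h2
  obtain ⟨v₀⟩ := hT.2.2.connected.nonempty
  have hall : ∀ g : 𝒢.FundamentalGroup T, R (treeVertex v₀ 1) (g • treeVertex v₀ 1) := by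
    let S : Subgroup (𝒢.FundamentalGroup T) :=
      { carrier := {g | R (treeVertex v₀ 1) (g • treeVertex v₀ 1)}
        one_mem' := by
          change R _ ((1 : 𝒢.FundamentalGroup T) • _)
          rw [one_smul]
          exact hrefl _
        mul_mem' := fun {a b} ha hb => by
          have := hsmul a hb
          rw [smul_smul] at this
          exact htrans ha this
        inv_mem' := fun {a} ha => by
          have := hsmul a⁻¹ ha
          rw [inv_smul_smul] at this
          exact hsymm this }
    refine mem_of_generators S ?_ ?_
    · intro v x
      have h1 := hsmul (𝒢.ofVertex T v x) (hbase v v₀)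
      have h2 : 𝒢.ofVertex T v x • (treeVertex v 1 : 𝒢.TreeVertex T) = treeVertex v 1 := by
        rw [smul_treeVertex, eq_comm, treeVertex_eq_iff]
        exact ⟨x, by simp⟩
      rw [h2] at h1
      exact htrans (hbase v₀ v) h1
    · intro e
      have h1 := hedge e (𝒢.ofEdge T e)
      rw [mul_inv_cancel] at h1
      have h2 := hsmul (𝒢.ofEdge T e) (hbase (𝒢.tgt e) v₀)
      rw [smul_treeVertex, mul_one] at h2
      exact htrans (hbase v₀ _) (htrans h1 h2)
  have hto : ∀ p, R (treeVertex v₀ 1) p := by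
    intro p
    obtain ⟨v, g, rfl⟩ := exists_treeVertex p
    have := hsmul g (hbase v₀ v)
    rw [smul_treeVertex v, mul_one] at this
    exact htrans (hall g) this
  exact htrans (hsymm (hto p)) (hto p')

open Classical in
/-- The potentials of the Bass–Serre tree: the fundamental group acts on the integral functions on
the edges by affine maps, such that the vertex groups have fixed points whose translates differ along
an edge by the characteristic function of this edge. -/
theorem exists_treePotential (hT : 𝒢.IsSpanningTree T) :
    ∃ pot : 𝒢.TreeVertex T → 𝒢.TreeEdge T → ℤ,
      ∀ q, pot (treeTgt q) = pot (treeSrc q) + Pi.single q 1 := by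
  let M := 𝒢.TreeEdge T → ℤ
  let L : 𝒢.FundamentalGroup T →* Equiv.Perm M :=
    { toFun := fun g =>
        { toFun := fun m q => m (g⁻¹ • q)
          invFun := fun m q => m (g • q)
          left_inv := fun m => by funext q; simp only [inv_smul_smul]
          right_inv := fun m => by funext q; simp only [smul_inv_smul] }
      map_one' := by ext m : 1; funext q; simp
      map_mul' := fun g h => by
        ext m : 1
        funext q
        simp [mul_smul] }
  have hLadd : ∀ g (m m' : M), L g (m + m') = L g m + L g m' := fun g m m' => rfl
  have hLsub : ∀ g (m m' : M), L g (m - m') = L g m - L g m' := fun g m m' => rfl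
  have hLmul : ∀ g h (m : M), L (g * h) m = L g (L h m) := fun g h m => by
    rw [map_mul, Equiv.Perm.mul_apply]
  have hLsingle : ∀ g (q : 𝒢.TreeEdge T), L g (Pi.single q 1 : M) = Pi.single (g • q) 1 := by
    intro g q
    funext q'
    change (Pi.single q 1 : M) (g⁻¹ • q') = _
    simp only [Pi.single_apply, inv_smul_eq_iff]
  obtain ⟨α, hα⟩ := hT.exists_potential (A := Multiplicative M)
    fun e => Multiplicative.ofAdd (Pi.single (treeEdge e 1) 1 : M)
  let u : V → M := fun v => (α v).toAdd
  have hu : ∀ e ∈ T, u (𝒢.tgt e) = u (𝒢.src e) + Pi.single (treeEdge e 1) 1 := by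
    intro e he
    simp only [u, hα e he]
    rfl
  have hconj : ∀ (p : Equiv.Perm M) (w m : M),
      (MulAut.conj (Equiv.addRight w : Equiv.Perm M)) p m = p (m - w) + w := fun p w m => by
    rw [sub_eq_add_neg]; rfl
  have hmul : ∀ (p : Equiv.Perm M) (a b m : M),
      (Equiv.addRight a * p * (Equiv.addRight b : Equiv.Perm M)⁻¹) m = p (m - b) + a :=
    fun p a b m => by rw [sub_eq_add_neg]; rfl
  obtain ⟨F, hFv, hFe⟩ := exists_lift (𝒢 := 𝒢) (T := T)
    (fun v => (MulAut.conj (Equiv.addRight (u v) : Equiv.Perm M)).toMonoidHom.comp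
      (L.comp (𝒢.ofVertex T v)))
    (fun e => Equiv.addRight (u (𝒢.src e)) * L (𝒢.ofEdge T e) *
      (Equiv.addRight (u (𝒢.tgt e) - Pi.single (treeEdge e 1) 1) : Equiv.Perm M)⁻¹)
    (by
      intro e c
      ext m : 1
      have h1 : 𝒢.ofVertex T (𝒢.tgt e) (𝒢.tgtHom e c) • (treeEdge e 1 : 𝒢.TreeEdge T) =
          treeEdge e 1 := by
        rw [smul_treeEdge, eq_comm, treeEdge_eq_iff]
        exact ⟨c, by simp⟩
      have h2 : ∀ m : M, L (𝒢.ofVertex T (𝒢.src e) (𝒢.srcHom e c)) (L (𝒢.ofEdge T e) m) =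
          L (𝒢.ofEdge T e) (L (𝒢.ofVertex T (𝒢.tgt e) (𝒢.tgtHom e c)) m) := by
        intro m
        rw [← hLmul, ← hLmul, ofEdge_mul]
      simp only [MonoidHom.comp_apply, MulEquiv.coe_toMonoidHom]
      refine (Equiv.Perm.mul_apply _ _ m).trans (Eq.trans ?_ (Equiv.Perm.mul_apply _ _ m).symm)
      rw [hmul, hmul, hconj, hconj,
        add_sub_cancel_right, h2]
      congr 2
      rw [sub_sub_eq_add_sub, sub_sub_eq_add_sub, add_sub_right_comm, add_sub_cancel_right,
        add_sub_right_comm, hLadd, hLsingle, h1])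
    (by
      intro e he
      ext m : 1
      rw [hmul, ofEdge_eq_one he, map_one, Equiv.Perm.one_apply, hu e he, add_sub_cancel_right,
        sub_add_cancel, Equiv.Perm.one_apply])
  have hFv' : ∀ v x (m : M), F (𝒢.ofVertex T v x) m = L (𝒢.ofVertex T v x) (m - u v) + u v := by
    intro v x m
    rw [hFv]
    exact hconj _ _ _
  have hFe' : ∀ e (m : M), F (𝒢.ofEdge T e) m =
      L (𝒢.ofEdge T e) (m - (u (𝒢.tgt e) - Pi.single (treeEdge e 1) 1)) + u (𝒢.src e) := by
    intro e m
    rw [hFe, hmul]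
  have hinv : ∀ g (m : M), F g (F g⁻¹ m) = m := fun g m => by
    rw [← Equiv.Perm.mul_apply, ← map_mul, mul_inv_cancel, map_one, Equiv.Perm.one_apply]
  have hlin : ∀ g (m m' : M), F g m - F g m' = L g (m - m') := by
    let S : Subgroup (𝒢.FundamentalGroup T) :=
      { carrier := {g | ∀ m m' : M, F g m - F g m' = L g (m - m')}
        one_mem' := fun m m' => by simp
        mul_mem' := fun {a b} ha hb m m' => by
          rw [map_mul, Equiv.Perm.mul_apply, Equiv.Perm.mul_apply, ha, hb, hLmul]
        inv_mem' := fun {a} ha m m' => by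
          have h := ha (F a⁻¹ m) (F a⁻¹ m')
          rw [hinv, hinv] at h
          rw [h, ← hLmul, inv_mul_cancel, map_one, Equiv.Perm.one_apply] }
    refine mem_of_generators S ?_ ?_
    · intro v x m m'
      rw [hFv', hFv', add_sub_add_right_eq_sub, ← hLsub, sub_sub_sub_cancel_right]
    · intro e m m'
      rw [hFe', hFe', add_sub_add_right_eq_sub, ← hLsub, sub_sub_sub_cancel_right]
  have hfix : ∀ v x, F (𝒢.ofVertex T v x) (u v) = u v := by
    intro v x
    rw [hFv', sub_self]
    exact zero_add _
  refine ⟨fun p => Quotient.lift (fun g => F g (u p.1)) (fun a b h => ?_) p.2, fun q => ?_⟩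
  · obtain ⟨x, hx⟩ := QuotientGroup.leftRel_apply.1 h
    have : b = a * 𝒢.ofVertex T p.1 x := by rw [hx, mul_inv_cancel_left]
    rw [this, map_mul, Equiv.Perm.mul_apply, hfix]
  · obtain ⟨e, g, rfl⟩ := exists_treeEdge q
    change F g (u (𝒢.tgt e)) = F (g * (𝒢.ofEdge T e)⁻¹) (u (𝒢.src e)) + _
    have h1 : F (𝒢.ofEdge T e) (u (𝒢.tgt e) - Pi.single (treeEdge e 1) 1) = u (𝒢.src e) := by
      rw [hFe', sub_self]
      exact zero_add _
    have h2 : F (𝒢.ofEdge T e)⁻¹ (u (𝒢.src e)) = u (𝒢.tgt e) - Pi.single (treeEdge e 1) 1 := by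
      rw [← h1, ← Equiv.Perm.mul_apply, ← map_mul, inv_mul_cancel, map_one, Equiv.Perm.one_apply]
    have h3 := hlin g (u (𝒢.tgt e)) (u (𝒢.tgt e) - Pi.single (treeEdge e 1) 1)
    rw [sub_sub_cancel, hLsingle, smul_treeEdge, mul_one] at h3
    rw [map_mul, Equiv.Perm.mul_apply, h2, ← h3]
    abel

open Classical in
/-- The Bass–Serre tree of a graph of groups. -/
noncomputable def bassSerreTree (hT : 𝒢.IsSpanningTree T) :
    OrientedTree (𝒢.TreeVertex T) (𝒢.TreeEdge T) where
  src := treeSrc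
  tgt := treeTgt
  pot := (exists_treePotential hT).choose
  pot_tgt_self q := by
    rw [(exists_treePotential hT).choose_spec q, Pi.add_apply, Pi.single_eq_same]
  pot_tgt_of_ne q q' h := by
    rw [(exists_treePotential hT).choose_spec q, Pi.add_apply, Pi.single_eq_of_ne h.symm, add_zero]
  conn := tree_connected hT

theorem isEquivariant_bassSerreTree (hT : 𝒢.IsSpanningTree T) :
    (bassSerreTree hT).IsEquivariant (𝒢.FundamentalGroup T) where
  src_smul g q := by
    obtain ⟨e, k, rfl⟩ := exists_treeEdge q
    exact congrArg (treeVertex _) (mul_assoc _ _ _)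
  tgt_smul g q := by
    obtain ⟨e, k, rfl⟩ := exists_treeEdge q
    rfl

theorem smul_ne_of_isHyperbolic {g : 𝒢.FundamentalGroup T} (hg : 𝒢.IsHyperbolic T g)
    (p : 𝒢.TreeVertex T) : g • p ≠ p := by
  obtain ⟨v, k, rfl⟩ := exists_treeVertex p
  intro h
  rw [smul_treeVertex, eq_comm, treeVertex_eq_iff] at h
  obtain ⟨x, hx⟩ := h
  refine hg v x k ?_
  rw [← hx]
  group

theorem stabilizer_treeEdge (e : E) (k : 𝒢.FundamentalGroup T) :
    MulAction.stabilizer (𝒢.FundamentalGroup T) (treeEdge e k) =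
      (𝒢.edgeSubgroup T e).map (MulAut.conj k).toMonoidHom := by
  ext g
  rw [MulAction.mem_stabilizer_iff, smul_treeEdge, eq_comm, treeEdge_eq_iff, Subgroup.mem_map]
  constructor
  · rintro ⟨c, hc⟩
    refine ⟨_, ⟨c, rfl⟩, ?_⟩
    simp only [MonoidHom.comp_apply, ← hc, MulEquiv.coe_toMonoidHom, MulAut.conj_apply]
    group
  · rintro ⟨_, ⟨c, rfl⟩, rfl⟩
    refine ⟨c, ?_⟩
    simp only [MonoidHom.comp_apply, MulEquiv.coe_toMonoidHom, MulAut.conj_apply]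
    group

end BassSerre

end GraphOfGroups

/-! ### Orders on the edges of the Bass–Serre tree -/

/-- An invariant order on the cosets `K / D` gives an invariant relation on the orbit of an element
with stabilizer `D`, which is a total order on the translates of the `K`-orbit. -/
theorem exists_translateOrder {G K Q : Type*} [Group G] [Group K] [MulAction G Q] {j : K →* G}
    (hj : Function.Injective j) {q₀ : Q} {D : Subgroup K}
    (hstab : ∀ g : G, g • q₀ = q₀ ↔ ∃ x ∈ D, j x = g) {r : K ⧸ D → K ⧸ D → Prop}
    (hr : IsInvariantCosetOrder D r) {R : Q → Q → Prop}
    (hR : ∀ q q', R q q' → ∃ g : G, q = g • q₀)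
    (hR' : ∀ (g : G) q', R (g • q₀) q' → ∃ b, q' = (g * j b) • q₀) :
    ∃ ord : Q → Q → Prop, (∀ (g : G) q q', ord (g • q) (g • q') ↔ ord q q') ∧
      (∀ q q', R q q' → q ≠ q' → (ord q q' ↔ ¬ ord q' q)) ∧
      ∀ q q' q'', R q q' → R q q'' → ord q q' → ord q' q'' → ord q q'' := by
  let ord : Q → Q → Prop := fun q q' =>
    ∃ (g : G) (x : K), q = g • q₀ ∧ q' = (g * j x) • q₀ ∧ r (1 : K) (x : K)
  have hsmul : ∀ (g : G) q q', ord q q' → ord (g • q) (g • q') := by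
    rintro g _ _ ⟨k, x, rfl, rfl, hx⟩
    exact ⟨g * k, x, (mul_smul _ _ _).symm, by rw [mul_assoc, mul_smul g], hx⟩
  have hcoset : ∀ a b : K, (a : K ⧸ D) = b ↔ j a • q₀ = j b • q₀ := by
    intro a b
    rw [QuotientGroup.eq, eq_comm (a := j a • q₀), ← inv_smul_eq_iff, smul_smul, ← map_inv,
      ← map_mul, hstab]
    exact ⟨fun h => ⟨_, h, rfl⟩, fun ⟨x, hx, e⟩ => hj e ▸ hx⟩
  have key : ∀ (g : G) (a b : K), ord ((g * j a) • q₀) ((g * j b) • q₀) ↔ r (a : K) (b : K) := by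
    intro g a b
    constructor
    · rintro ⟨k, x, h1, h2, hx⟩
      obtain ⟨c, hc, e⟩ := (hstab ((g * j a)⁻¹ * k)).1 (by rw [mul_smul, ← h1, inv_smul_smul])
      have hk : k = g * j (a * c) := by rw [map_mul, e]; group
      have h3 := hr.2 (a * c) _ _ hx
      have h4 : ((a * c) • ((1 : K) : K ⧸ D)) = (a : K ⧸ D) := by
        refine QuotientGroup.eq.2 ?_
        simpa using hc
      have h5 : ((a * c) • (x : K ⧸ D)) = (b : K ⧸ D) := by
        refine (hcoset (a * c * x) b).2 ?_
        rw [hk, mul_assoc, ← map_mul, mul_smul, mul_smul g] at h2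
        exact (smul_left_cancel g h2).symm
      rwa [h4, h5] at h3
    · intro h
      refine ⟨g * j a, a⁻¹ * b, rfl, by simp [mul_assoc], ?_⟩
      have h3 := hr.2 a⁻¹ _ _ h
      have h4 : (a⁻¹ • (a : K ⧸ D)) = ((1 : K) : K ⧸ D) :=
        congrArg _ (inv_mul_cancel a)
      rw [h4] at h3
      exact h3
  have htri := hr.1.trichotomous
  have hirr := hr.1.irrefl
  have htr := hr.1.trans
  refine ⟨ord, fun g q q' => ⟨fun h => ?_, hsmul g q q'⟩, ?_, ?_⟩
  · simpa using hsmul g⁻¹ _ _ h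
  · intro q q' h hne
    obtain ⟨g, rfl⟩ := hR q q' h
    obtain ⟨b, rfl⟩ := hR' g q' h
    have e : g • q₀ = (g * j 1) • q₀ := by rw [map_one, mul_one]
    rw [e, key, key]
    constructor
    · exact fun h1 h2 => hirr _ (htr _ _ _ h1 h2)
    · intro h1
      by_contra h2
      refine hne ?_
      have := (hcoset 1 b).1 (htri _ _ h2 h1)
      rw [mul_smul, ← this, map_one, one_smul]
  · intro q q' q'' h h'
    obtain ⟨g, rfl⟩ := hR q q' h
    obtain ⟨b, rfl⟩ := hR' g q' h
    obtain ⟨c, rfl⟩ := hR' g q'' h'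
    have e : g • q₀ = (g * j 1) • q₀ := by rw [map_one, mul_one]
    rw [e, key, key, key]
    exact htr _ _ _

namespace GraphOfGroups

section EdgeOrder

variable {V E : Type*} {𝒢 : GraphOfGroups V E} {T : Set E}

/-- One of the two endpoints of an edge. -/
def treeEnd (b : Bool) (q : 𝒢.TreeEdge T) : 𝒢.TreeVertex T := cond b (treeTgt q) (treeSrc q)

/-- Left relative convexity of an edge group in a vertex group orders the edges of the corresponding
type at the corresponding vertices of the Bass–Serre tree. -/
theorem exists_halfEdgeOrder (hT : 𝒢.IsSpanningTree T)
    (hconv : ∀ e : E, IsLeftRelativelyConvex (𝒢.srcHom e).range ∧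
      IsLeftRelativelyConvex (𝒢.tgtHom e).range) (d : E × Bool) :
    ∃ ord : 𝒢.TreeEdge T → 𝒢.TreeEdge T → Prop,
      (∀ (g : 𝒢.FundamentalGroup T) q q', ord (g • q) (g • q') ↔ ord q q') ∧
      (∀ q q', (q.1 = d.1 ∧ q'.1 = d.1 ∧ treeEnd d.2 q = treeEnd d.2 q') → q ≠ q' →
        (ord q q' ↔ ¬ ord q' q)) ∧
      ∀ q q' q'', (q.1 = d.1 ∧ q'.1 = d.1 ∧ treeEnd d.2 q = treeEnd d.2 q') →
        (q.1 = d.1 ∧ q''.1 = d.1 ∧ treeEnd d.2 q = treeEnd d.2 q'') →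
        ord q q' → ord q' q'' → ord q q'' := by
  obtain ⟨e, b⟩ := d
  cases b
  · obtain ⟨r, hr⟩ := (hconv e).1
    refine exists_translateOrder (ofVertex_injective hT (𝒢.src e)) (q₀ := treeEdge e (𝒢.ofEdge T e))
      ?_ hr ?_ ?_
    · intro g
      rw [smul_treeEdge, eq_comm, treeEdge_eq_iff]
      constructor
      · rintro ⟨c, hc⟩
        refine ⟨_, ⟨c, rfl⟩, ?_⟩
        rw [← ofEdge_conj, ← hc]
        group
      · rintro ⟨_, ⟨c, rfl⟩, rfl⟩
        refine ⟨c, ?_⟩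
        rw [← ofEdge_conj]
        group
    · rintro q q' ⟨rfl, -⟩
      obtain ⟨e, g, rfl⟩ := exists_treeEdge q
      exact ⟨g * (𝒢.ofEdge T e)⁻¹, by
        change _ = treeEdge e (g * (𝒢.ofEdge T e)⁻¹ * 𝒢.ofEdge T e)
        rw [inv_mul_cancel_right]⟩
    · rintro g q' ⟨-, h, h'⟩
      obtain ⟨e', g', rfl⟩ := exists_treeEdge q'
      obtain rfl : e' = e := h
      change treeSrc (treeEdge e' (g * 𝒢.ofEdge T e')) = treeSrc (treeEdge e' g') at h'
      rw [treeSrc_treeEdge, treeSrc_treeEdge, treeVertex_eq_iff, mul_inv_cancel_right] at h'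
      obtain ⟨x, hx⟩ := h'
      refine ⟨x, ?_⟩
      change _ = treeEdge e' (g * _ * 𝒢.ofEdge T e')
      rw [← hx]
      congr 1
      group
  · obtain ⟨r, hr⟩ := (hconv e).2
    refine exists_translateOrder (ofVertex_injective hT (𝒢.tgt e)) (q₀ := treeEdge e 1)
      ?_ hr ?_ ?_
    · intro g
      rw [smul_treeEdge, eq_comm, treeEdge_eq_iff, mul_one, inv_one, one_mul]
      constructor
      · rintro ⟨c, hc⟩
        exact ⟨_, ⟨c, rfl⟩, hc.symm⟩
      · rintro ⟨_, ⟨c, rfl⟩, rfl⟩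
        exact ⟨c, rfl⟩
    · rintro q q' ⟨rfl, -⟩
      obtain ⟨e, g, rfl⟩ := exists_treeEdge q
      exact ⟨g, by
        change _ = treeEdge e (g * 1)
        rw [mul_one]⟩
    · rintro g q' ⟨-, h, h'⟩
      obtain ⟨e', g', rfl⟩ := exists_treeEdge q'
      obtain rfl : e' = e := h
      change treeTgt (treeEdge e' (g * 1)) = treeTgt (treeEdge e' g') at h'
      rw [treeTgt_treeEdge, treeTgt_treeEdge, treeVertex_eq_iff, mul_one] at h'
      obtain ⟨x, hx⟩ := h'
      refine ⟨x, ?_⟩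
      change _ = treeEdge e' (g * _ * 1)
      rw [← hx]
      congr 1
      group

/-- If the edge groups are left relatively convex in the vertex groups, the edges of the Bass–Serre
tree have an invariant total order: at each vertex, order the edges by type and then by the given
orders on cosets. -/
theorem exists_treeEdgeOrder (hT : 𝒢.IsSpanningTree T)
    (hconv : ∀ e : E, IsLeftRelativelyConvex (𝒢.srcHom e).range ∧
      IsLeftRelativelyConvex (𝒢.tgtHom e).range) :
    ∃ r : 𝒢.TreeEdge T → 𝒢.TreeEdge T → Prop, IsStrictTotalOrder (𝒢.TreeEdge T) r ∧
      ∀ (g : 𝒢.FundamentalGroup T) q q', r (g • q) (g • q') ↔ r q q' := by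
  classical
  choose ord hsmul hasymm htrans using exists_halfEdgeOrder hT hconv
  let typ : 𝒢.TreeVertex T → 𝒢.TreeEdge T → E × Bool := fun p q => (q.1, decide (p = treeTgt q))
  have htyp : ∀ p q q', (p = treeSrc q ∨ p = treeTgt q) → (p = treeSrc q' ∨ p = treeTgt q') →
      typ p q = typ p q' → q.1 = (typ p q).1 ∧ q'.1 = (typ p q).1 ∧
        treeEnd (typ p q).2 q = treeEnd (typ p q).2 q' := by
    intro p q q' h h' e
    refine ⟨rfl, congrArg Prod.fst e.symm, ?_⟩
    have h2 : decide (p = treeTgt q) = decide (p = treeTgt q') := congrArg Prod.snd e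
    by_cases hp : p = treeTgt q
    · have hp' : p = treeTgt q' := by simpa [hp] using h2
      simp only [typ, treeEnd, decide_eq_true hp, cond_true]
      exact hp.symm.trans hp'
    · have hp' : p ≠ treeTgt q' := by simpa [hp] using h2
      simp only [typ, treeEnd, decide_eq_false hp, cond_false]
      exact (h.resolve_right hp).symm.trans (h'.resolve_right hp')
  have hΓ := isEquivariant_bassSerreTree hT
  have hwirr : ∀ a : E × Bool, ¬ WellOrderingRel a a := fun a => irrefl a
  have hwtrans : ∀ {a b c : E × Bool}, WellOrderingRel a b → WellOrderingRel b c →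
    WellOrderingRel a c := fun h h' => _root_.trans h h'
  have hwtri : ∀ a b : E × Bool, WellOrderingRel a b ∨ a = b ∨ WellOrderingRel b a :=
    fun a b => trichotomous_of WellOrderingRel a b
  refine hΓ.exists_edgeOrder (lt := fun p q q' => WellOrderingRel (typ p q) (typ p q') ∨
    typ p q = typ p q' ∧ ord (typ p q) q q') ⟨?_, ?_⟩ ?_
  · intro p q q' h h' hne
    rcases hwtri (typ p q) (typ p q') with hw | hw | hw
    · refine ⟨fun _ => ?_, fun _ => Or.inl hw⟩
      rintro (h1 | ⟨h1, -⟩)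
      · exact hwirr _ (hwtrans hw h1)
      · exact hwirr _ (h1 ▸ hw)
    · have := hasymm _ q q' (htyp p q q' h h' hw) hne
      rw [← hw]
      simp only [hwirr, false_or, true_and, this]
    · refine ⟨?_, fun h1 => (h1 (Or.inl hw)).elim⟩
      rintro (h1 | ⟨h1, -⟩)
      · exact (hwirr _ (hwtrans hw h1)).elim
      · exact (hwirr _ (h1 ▸ hw)).elim
  · intro p q q' q'' h h' h''
    rintro (h1 | ⟨h1, h2⟩) (h3 | ⟨h3, h4⟩)
    · exact Or.inl (hwtrans h1 h3)
    · exact Or.inl (h3 ▸ h1)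
    · exact Or.inl (h1 ▸ h3)
    · refine Or.inr ⟨h1.trans h3, ?_⟩
      rw [← h1] at h4
      exact htrans _ q q' q'' (htyp p q q' h h' h1) (htyp p q q'' h h'' (h1.trans h3)) h2 h4
  · intro g p q q'
    have ht : ∀ q, typ (g • p) (g • q) = typ p q := by
      intro q
      have : treeTgt (g • q) = g • treeTgt q := hΓ.tgt_smul g q
      simp only [typ, this, smul_left_cancel_iff]
      rfl
    simp only [ht, hsmul]

end EdgeOrder

end GraphOfGroups

theorem theorem5p14 {V E : Type*} (𝒢 : GraphOfGroups V E) (T : Set E) (hT : 𝒢.IsSpanningTree T)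
    (hconv : ∀ e : E, IsLeftRelativelyConvex (𝒢.srcHom e).range ∧
      IsLeftRelativelyConvex (𝒢.tgtHom e).range)
    (g : 𝒢.FundamentalGroup T) (hg : 𝒢.IsHyperbolic T g) :
    ∃ φ : 𝒢.FundamentalGroup T → ℝ,
      IsHomogeneousQuasimorphism φ ∧ 1 ≤ φ g ∧ defect φ ≤ 1 ∧ 1 / 2 ≤ scl g ∧
      ∃ Φ : 𝒢.FundamentalGroup T → FreeGroup Bool,
        IsLetterQuasimorphism Φ ∧
        (∃ (e : E) (k : 𝒢.FundamentalGroup T),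
          IsAmalgamLetterMap ((𝒢.edgeSubgroup T e).map (MulAut.conj k).toMonoidHom) Φ ∨
          IsHNNLetterMap ((𝒢.edgeSubgroup T e).map (MulAut.conj k).toMonoidHom) Φ) ∧
        ∃ (b : FreeGroup Bool) (rot : FreeGroup Bool → ℝ),
          IsAlternating b ∧ Even b.toWord.length ∧ 0 < b.toWord.length ∧
          IsCircleQuasimorphism b rot ∧
          ∀ h : 𝒢.FundamentalGroup T,
            Tendsto (fun n : ℕ => rot (Φ (h ^ n)) / (n * b.toWord.length)) atTop (𝓝 (φ h)) := by
  obtain ⟨r, hr, hinv⟩ := GraphOfGroups.exists_treeEdgeOrder hT hconv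
  obtain ⟨v⟩ := hT.2.2.connected.nonempty
  obtain ⟨q, φ, h1, h2, h3, h4, Φ, h5, h6, h7⟩ :=
    OrientedTree.exists_isDetectedBySplitting (GraphOfGroups.isEquivariant_bassSerreTree hT) hr hinv
      (fun p => GraphOfGroups.smul_ne_of_isHyperbolic hg p) (GraphOfGroups.treeVertex v 1)
  obtain ⟨e, k, rfl⟩ := GraphOfGroups.exists_treeEdge q
  rw [GraphOfGroups.stabilizer_treeEdge] at h6
  exact ⟨φ, h1, h2, h3, h4, Φ, h5, ⟨e, k, h6⟩, h7⟩
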